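/- Let $d\ge 2$ and let $\gamma:\mathbb{R}\to\mathbb{R}^d$ be a $C^\infty$ curve with $|\dot\gamma(s)|=1$ for all $s\in\mathbb{R}$ whose image $\Gamma=\gamma(\mathbb{R})$ is unbounded (an unbounded complete curve parameterised by arc length). For $a>0$ let $\Omega_a=\{x\in\mathbb{R}^d:\operatorname{dist}(x,\Gamma)<a\}$. Assume that $\Omega_a$ does not overlap itself: for every smooth unit normal vector field $N$ along $\gamma$, the map $(s,t)\mapsto\gamma(s)+t\,N(s)$ is a smooth diffeomorphism of $\mathbb{R}\times(-a,a)$ onto its image. If $d=2$, assume in addition that the boundary of the strip does not touch itself along a set of positive length: the set of points at distance exactly $a$ from $\Gamma$ that have at least two nearest points on $\Gamma$ has zero one-dimensional Hausdorff measure. For an open set $\Omega\subset\mathbb{R}^d$ put $$h(\Omega)=\inf_{S}\frac{P(S)}{|S|},$$ where the infimum is taken over all bounded Borel sets $S\subset\Omega$ of positive Lebesgue measure $|S|$, and $$P(S)=\sup\Big\{\int_S\operatorname{div}X\,dx:\ X\in C^1_c(\mathbb{R}^d;\mathbb{R}^d),\ |X|\le 1\Big\}$$ is the perimeter of $S$.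 Then $$h(\Omega_a)=\frac{d-1}{a},$$ and the infimum is not attained: there is no Cheeger set of $\Omega_a$, that is, no bounded Borel set $S\subset\Omega_a$ with $|S|>0$ and $P(S)/|S|=h(\Omega_a)$. -/

import Mathlib

open Set MeasureTheory
open scoped ENNReal ContDiff

noncomputable section

/-- The Euclidean divergence `∑ i, ∂ᵢ Xᵢ` of a vector field on `ℝ^d`. -/
def divergence {d : ℕ} (X : EuclideanSpace ℝ (Fin d) → EuclideanSpace ℝ (Fin d))
    (x : EuclideanSpace ℝ (Fin d)) : ℝ :=
  ∑ i : Fin d, (fderiv ℝ X x (EuclideanSpace.single i 1)) i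

/-- The (De Giorgi, variational) perimeter of a Borel set `S ⊆ ℝ^d`: the supremum of
`∫_S div X` over all compactly supported `C¹` vector fields `X` on `ℝ^d` with `|X| ≤ 1`. -/
def perimeter {d : ℕ} (S : Set (EuclideanSpace ℝ (Fin d))) : ℝ≥0∞ :=
  ⨆ (X : EuclideanSpace ℝ (Fin d) → EuclideanSpace ℝ (Fin d))
    (_ : ContDiff ℝ 1 X) (_ : HasCompactSupport X) (_ : ∀ x, ‖X x‖ ≤ 1),
    ENNReal.ofReal (∫ x in S, divergence X x)

/-- The competitors of the Cheeger problem in `Ω`: bounded Borel subsets of `Ω`, of positive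
volume so that the quotient of perimeter and volume is meaningful. -/
structure IsCompetitor {d : ℕ} (Ω S : Set (EuclideanSpace ℝ (Fin d))) : Prop where
  subset : S ⊆ Ω
  bounded : Bornology.IsBounded S
  measurable : MeasurableSet S
  volume_ne_zero : volume S ≠ 0

/-- The Cheeger constant of `Ω`: the infimum of perimeter over volume. -/
def cheegerConstant {d : ℕ} (Ω : Set (EuclideanSpace ℝ (Fin d))) : ℝ≥0∞ :=
  ⨅ (S : Set (EuclideanSpace ℝ (Fin d))) (_ : IsCompetitor Ω S), perimeter S / volume S

/-- A Cheeger set of `Ω`: a competitor that attains the infimum. -/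
def IsCheegerSet {d : ℕ} (Ω S : Set (EuclideanSpace ℝ (Fin d))) : Prop :=
  IsCompetitor Ω S ∧ perimeter S / volume S = cheegerConstant Ω

/-- `γ` is a smooth arc-length parameterisation, over the whole real line, of an unbounded
complete curve in `ℝ^d`. -/
structure IsUnboundedCompleteCurve {d : ℕ} (γ : ℝ → EuclideanSpace ℝ (Fin d)) : Prop where
  smooth : ContDiff ℝ ∞ γ
  unit_speed : ∀ s, ‖deriv γ s‖ = 1
  unbounded : ¬ Bornology.IsBounded (range γ)

/-- The tube of radius `a` about the curve: all points at distance less than `a` from it. -/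
def tube {d : ℕ} (γ : ℝ → EuclideanSpace ℝ (Fin d)) (a : ℝ) :
    Set (EuclideanSpace ℝ (Fin d)) :=
  {x | Metric.infDist x (range γ) < a}

/-- `N` is a smooth unit normal vector field along the curve. -/
structure IsUnitNormalField {d : ℕ} (γ N : ℝ → EuclideanSpace ℝ (Fin d)) : Prop where
  smooth : ContDiff ℝ ∞ N
  unit : ∀ s, ‖N s‖ = 1
  normal : ∀ s, inner ℝ (N s) (deriv γ s) = 0

/-- `F` restricted to the open set `U` is a smooth diffeomorphism onto its image: it is smooth and
has a smooth inverse (smoothness on the image being that of a map on a subset of `ℝ^d`). -/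
def IsDiffeoOntoImage {d : ℕ} (F : ℝ × ℝ → EuclideanSpace ℝ (Fin d)) (U : Set (ℝ × ℝ)) : Prop :=
  ContDiffOn ℝ ∞ F U ∧
    ∃ G : EuclideanSpace ℝ (Fin d) → ℝ × ℝ, ContDiffOn ℝ ∞ G (F '' U) ∧ ∀ p ∈ U, G (F p) = p

/-- The tube of radius `a` does not overlap itself: for every smooth unit normal field `N`
the map `(s, t) ↦ γ s + t N s` is a diffeomorphism of `ℝ × (-a, a)` onto its image. The parameter
`t` takes both signs, so that the curve itself and, in the plane, both of its sides are covered. -/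
def DoesNotOverlap {d : ℕ} (γ : ℝ → EuclideanSpace ℝ (Fin d)) (a : ℝ) : Prop :=
  ∀ N : ℝ → EuclideanSpace ℝ (Fin d), IsUnitNormalField γ N →
    IsDiffeoOntoImage (fun p : ℝ × ℝ => γ p.1 + p.2 • N p.1) (univ ×ˢ Ioo (-a) a)

/-- The points where the boundary of the tube touches itself: points at distance exactly `a`
from the curve which have at least two nearest points on the curve. -/
def touchingSet {d : ℕ} (γ : ℝ → EuclideanSpace ℝ (Fin d)) (a : ℝ) :
    Set (EuclideanSpace ℝ (Fin d)) :=
  {x | Metric.infDist x (range γ) = a ∧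
    ∃ p ∈ range γ, ∃ q ∈ range γ, p ≠ q ∧ dist x p = a ∧ dist x q = a}

end

/-!
Write `σ x` for the parameter of a point of the curve nearest to `x`, `v = x - γ (σ x)` for the
normal displacement, `T` and `κ` for the tangent and the curvature vector at `σ x`, and
`f = 1 - ⟪κ, v⟫` for the Jacobian of the tube.

*Geometry.* Applied to suitable unit normal fields, non-overlapping says that the curvature is at
most `1 / a` and that the open normal discs of radius `a` are disjoint
(`DoesNotOverlap.isTubeAxis`). Hence `σ` is continuously differentiable on the tube, with gradient
`T / f`, and `f > 0` there. Consequently `T` and `κ / f` are divergence free, and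
`div v = d - 1 / f`.

*Lower bound.* The field `Y = v / a - (a² - |v|²) / (2 a) · κ / f` satisfies `div Y = (d - 1) / a`
and `|Y| < 1` on the tube (`divergence_calibration`, `norm_calibration_lt`). If the Gauss-Green
inequality `∫_S div Y ≤ P(S)` holds, then `P(S) ≥ (d - 1) / a · |S|`. A competitor may touch the
boundary of the tube, where `Y` is smooth except at points with two nearest points or with `f = 0`.
Gauss-Green survives such a closed set if its `(d - 1)`-dimensional measure vanishes
(`setIntegral_divergence_le_perimeter`): cut it out by small balls. The points with `f = 0` are
centres of curvature: in the plane they are critical values of a curve, and so negligible by Sard's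
theorem in one dimension; in higher dimensions it is enough that they lie on a curve. At any other
point with two nearest points the normal discs meet from opposite sides, so that the point is the
midpoint of the two. Such points are negligible by hypothesis if `d = 2`, because their pairs of
parameters form a null set of `ℝ × ℝ` if `d = 3`, and for dimension reasons if `d ≥ 4`
(`hausdorffMeasure_irregularSet`).

*Strictness.* Since `|Y| < 1` on compact subsets of the tube with room to spare, `Y` may be
perturbed in every direction. Equality would thus force the indicator function of `S` to have zero
distributional gradient in the tube, which is connected, so that `S` would be the whole unbounded
tube up to a null set (`not_perimeter_le`).

*Upper bound.* The competitors are the parts of the tube over `(0, L]`. Testing the divergence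
theorem with `A(σ) β(|v|²) T`, `α(σ) q(|v|²) κ / f` and `α(σ) β(|v|²) v` computes all the integrals
that occur for a smoothed indicator function `α(σ) β(|v|²)`, without any change of variables: its
lateral variation is `(d - 1) / a` times its mass, and the two ends together contribute `2 / L`
times its mass (`setIntegral_weight_mul_divergence_le`). Let the smoothing tend to zero, then `L` to
infinity.
-/

open Filter Topology
open scoped Convolution
open IsUnboundedCompleteCurve

/-! ### Unit normal fields along the curve -/

/-- Differentiating the identity `⟪N, γ'⟫ = 0`. -/
lemma inner_deriv_of_inner_eq_zero {V : Type*} [NormedAddCommGroup V] [InnerProductSpace ℝ V]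
    {N T : ℝ → V} {N' T' : V} {s : ℝ} (hN : HasDerivAt N N' s) (hT : HasDerivAt T T' s)
    (h : ∀ s, inner ℝ (N s) (T s) = 0) : inner ℝ N' (T s) = - inner ℝ (N s) T' := by
  have h1 := hN.inner ℝ hT
  have h2 : (fun t => inner ℝ (N t) (T t)) = fun _ => (0 : ℝ) := funext h
  rw [h2] at h1
  have := h1.unique (hasDerivAt_const s (0 : ℝ))
  linarith

lemma inner_deriv_self_of_norm_eq_one {V : Type*} [NormedAddCommGroup V] [InnerProductSpace ℝ V]
    {N : ℝ → V} {N' : V} {s : ℝ} (hN : HasDerivAt N N' s)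
    (h : ∀ s, ‖N s‖ = 1) : inner ℝ (N s) N' = 0 := by
  have h1 := hN.inner ℝ hN
  have h2 : (fun t => inner ℝ (N t) (N t)) = fun _ => (1 : ℝ) := by
    funext t; rw [real_inner_self_eq_norm_sq, h t]; norm_num
  rw [h2] at h1
  have := h1.unique (hasDerivAt_const s (1 : ℝ))
  have h3 := real_inner_comm N' (N s)
  linarith

namespace IsUnboundedCompleteCurve

variable {d : ℕ} {γ : ℝ → EuclideanSpace ℝ (Fin d)}

lemma contDiff_deriv (hγ : ContDiff ℝ ∞ γ) : ContDiff ℝ ∞ (deriv γ) :=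
  (contDiff_infty_iff_deriv.1 hγ).2

lemma hasDerivAt (hγ : ContDiff ℝ ∞ γ) (s : ℝ) : HasDerivAt γ (deriv γ s) s :=
  (hγ.differentiable (by simp) s).hasDerivAt

end IsUnboundedCompleteCurve


section NormalFields

variable {d : ℕ} {γ : ℝ → EuclideanSpace ℝ (Fin d)}

/-- In the plane a unit normal field is obtained by rotating the tangent. -/
lemma exists_isUnitNormalField_plane {γ : ℝ → EuclideanSpace ℝ (Fin 2)} (hγ : ContDiff ℝ ∞ γ)
    (hu : ∀ s, ‖deriv γ s‖ = 1) : ∃ N, IsUnitNormalField γ N := by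
  refine ⟨fun s => !₂[-(deriv γ s) 1, (deriv γ s) 0], ⟨?_, ?_, ?_⟩⟩
  · rw [contDiff_euclidean]
    have h := contDiff_euclidean.1 (contDiff_deriv hγ)
    intro i
    fin_cases i
    · simpa using (h 1).neg
    · simpa using h 0
  · intro s
    have := hu s
    rw [EuclideanSpace.norm_eq] at this ⊢
    simpa [add_comm] using this
  · intro s
    simp [PiLp.inner_apply]
    ring

/-- Two vectors orthogonal to a unit vector of the plane, one of them of length one: the other
is a multiple of it. -/
lemma eq_smul_of_orthogonal_plane {T n v : EuclideanSpace ℝ (Fin 2)} (hT : ‖T‖ = 1)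
    (hn : ‖n‖ = 1) (hnT : inner ℝ n T = 0) (hv : inner ℝ v n = 0) : v = (inner ℝ v T) • T := by
  have e1 : T 0 ^ 2 + T 1 ^ 2 = 1 := by
    have := EuclideanSpace.norm_sq_eq T
    rw [hT] at this; simpa using this.symm
  have e2 : n 0 ^ 2 + n 1 ^ 2 = 1 := by
    have := EuclideanSpace.norm_sq_eq n
    rw [hn] at this; simpa using this.symm
  simp [PiLp.inner_apply] at hnT hv
  have hvT : inner ℝ v T = T 0 * v 0 + T 1 * v 1 := by simp [PiLp.inner_apply]
  -- `D = ± 1` is the determinant of the orthonormal frame `(T, n)`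
  obtain ⟨D, hD⟩ : ∃ D, D = T 0 * n 1 - T 1 * n 0 := ⟨_, rfl⟩
  have n0 : n 0 = - D * T 1 := by rw [hD]; linear_combination (-n 0) * e1 + T 0 * hnT
  have n1 : n 1 = D * T 0 := by rw [hD]; linear_combination (-n 1) * e1 + T 1 * hnT
  have hD2 : D ^ 2 = 1 := by
    rw [n0, n1] at e2; linear_combination e2 - D ^ 2 * e1
  have h3 : v 0 * T 1 - v 1 * T 0 = 0 := by
    rw [n0, n1] at hv
    linear_combination (-D) * hv - (v 0 * T 1 - v 1 * T 0) * hD2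
  rw [hvT]
  ext i
  fin_cases i
  · simp; linear_combination (-v 0) * e1 + T 1 * h3
  · simp; linear_combination (-v 1) * e1 - T 0 * h3

/-- The normalised projection of a vector field which is nowhere tangent. -/
lemma isUnitNormalField_normalize (hγ : ContDiff ℝ ∞ γ) (hu : ∀ s, ‖deriv γ s‖ = 1)
    {e : ℝ → EuclideanSpace ℝ (Fin d)} (he : ContDiff ℝ ∞ e)
    (hne : ∀ s, e s - (inner ℝ (deriv γ s) (e s) : ℝ) • deriv γ s ≠ 0) :
    IsUnitNormalField γ (fun s => ‖e s - (inner ℝ (deriv γ s) (e s) : ℝ) • deriv γ s‖⁻¹ •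
      (e s - (inner ℝ (deriv γ s) (e s) : ℝ) • deriv γ s)) := by
  have hT := contDiff_deriv hγ
  have hP : ContDiff ℝ ∞ (fun s => e s - (inner ℝ (deriv γ s) (e s) : ℝ) • deriv γ s) :=
    he.sub ((hT.inner ℝ he).smul hT)
  refine ⟨?_, ?_, ?_⟩
  · exact ((hP.norm ℝ hne).inv fun s => norm_ne_zero_iff.2 (hne s)).smul hP
  · intro s
    rw [norm_smul, norm_inv, norm_norm, inv_mul_cancel₀ (norm_ne_zero_iff.2 (hne s))]
  · intro s
    rw [inner_smul_left, inner_sub_left, inner_smul_left, real_inner_self_eq_norm_sq, hu s,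
      real_inner_comm]
    simp

/-- A smooth family of vectors of an at least three-dimensional space can be made nowhere
tangent to the curve by adding a generic constant multiple of a given function `χ`, provided that
it is not tangent where `χ` vanishes: the bad vectors are the values of a smooth map of two
variables. -/
lemma exists_forall_not_tangent (hd : 3 ≤ d) (hγ : ContDiff ℝ ∞ γ)
    {e : ℝ → EuclideanSpace ℝ (Fin d)} (he : ContDiff ℝ ∞ e) {χ : ℝ → ℝ} (hχ : ContDiff ℝ ∞ χ)
    (h0 : ∀ s, χ s = 0 → e s - (inner ℝ (deriv γ s) (e s) : ℝ) • deriv γ s ≠ 0) :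
    ∃ w : EuclideanSpace ℝ (Fin d), ∀ s, (e s + χ s • w) -
      (inner ℝ (deriv γ s) (e s + χ s • w) : ℝ) • deriv γ s ≠ 0 := by
  have hT := contDiff_deriv hγ
  let F : ℝ × ℝ → EuclideanSpace ℝ (Fin d) := fun p => (χ p.1)⁻¹ • (p.2 • deriv γ p.1 - e p.1)
  let A : Set (ℝ × ℝ) := {p | χ p.1 ≠ 0}
  have hF : ∀ p ∈ A, ContDiffAt ℝ 1 F p := by
    intro p hp
    have hχ' := hχ.contDiffAt (x := p.1)
    have he' := he.contDiffAt (x := p.1)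
    have hT' := hT.contDiffAt (x := p.1)
    have hp' : χ p.1 ≠ 0 := hp
    have h1 : ContDiffAt ℝ ∞ F p := by fun_prop (disch := assumption)
    exact h1.of_le (by simp)
  have hdim : dimH (F '' A) < Module.finrank ℝ (EuclideanSpace ℝ (Fin d)) := by
    have h1 : dimH (F '' A) ≤ dimH A := by
      refine dimH_image_le_of_locally_lipschitzOn fun p hp => ?_
      obtain ⟨C, t, ht, hl⟩ := (hF p hp).exists_lipschitzOnWith
      exact ⟨C, t, mem_nhdsWithin_of_mem_nhds ht, hl⟩
    have h2 : dimH A ≤ 2 := by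
      refine (dimH_mono (subset_univ A)).trans ?_
      rw [Real.dimH_univ_eq_finrank]
      simp
    rw [finrank_euclideanSpace_fin]
    refine lt_of_le_of_lt (h1.trans h2) ?_
    exact_mod_cast (show (2 : ℕ) < d by omega)
  obtain ⟨w, hw⟩ := (dense_compl_of_dimH_lt_finrank hdim).nonempty
  refine ⟨w, fun s hs => ?_⟩
  by_cases hc : χ s = 0
  · simp only [hc, zero_smul, add_zero] at hs
    exact h0 s hc hs
  · apply hw
    refine ⟨(s, inner ℝ (deriv γ s) (e s + χ s • w)), hc, ?_⟩
    simp only [F]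
    rw [← sub_eq_zero.1 hs, add_sub_cancel_left, smul_smul, inv_mul_cancel₀ hc, one_smul]

/-- Derivative of a normalised projection at a point where the projected field is stationary,
normal and of length one. -/
lemma hasDerivAt_normalize (hγ : ContDiff ℝ ∞ γ)
    {e : ℝ → EuclideanSpace ℝ (Fin d)} {s₀ : ℝ} (he : HasDerivAt e 0 s₀) (h1 : ‖e s₀‖ = 1)
    (hn : inner ℝ (e s₀) (deriv γ s₀) = 0) :
    HasDerivAt (fun s => ‖e s - (inner ℝ (deriv γ s) (e s) : ℝ) • deriv γ s‖⁻¹ •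
      (e s - (inner ℝ (deriv γ s) (e s) : ℝ) • deriv γ s))
      (-(inner ℝ (e s₀) (deriv (deriv γ) s₀) : ℝ) • deriv γ s₀) s₀ := by
  have hT := hasDerivAt (contDiff_deriv hγ) s₀
  have hn' : inner ℝ (deriv γ s₀) (e s₀) = 0 := by rw [real_inner_comm]; exact hn
  have hP : HasDerivAt (fun s => e s - (inner ℝ (deriv γ s) (e s) : ℝ) • deriv γ s)
      (-(inner ℝ (e s₀) (deriv (deriv γ) s₀) : ℝ) • deriv γ s₀) s₀ := by
    refine (he.sub ((hT.inner ℝ he).smul hT)).congr_deriv ?_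
    rw [hn', real_inner_comm (e s₀)]
    simp
  have hP0 : e s₀ - (inner ℝ (deriv γ s₀) (e s₀) : ℝ) • deriv γ s₀ = e s₀ := by rw [hn']; simp
  have hsq : HasDerivAt (fun s => ‖e s - (inner ℝ (deriv γ s) (e s) : ℝ) • deriv γ s‖ ^ 2) 0 s₀ := by
    refine hP.norm_sq.congr_deriv ?_
    rw [hP0, inner_smul_right, hn]; simp
  have hinv : HasDerivAt (fun s => ‖e s - (inner ℝ (deriv γ s) (e s) : ℝ) • deriv γ s‖⁻¹) 0 s₀ := by
    have := (hsq.sqrt (by rw [hP0, h1]; norm_num)).inv (by rw [hP0, h1]; simp)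
    refine (this.congr_deriv (by simp)).congr_of_eventuallyEq (Eventually.of_forall fun s => ?_)
    simp [Real.sqrt_sq (norm_nonneg _)]
  refine (hinv.smul hP).congr_deriv ?_
  rw [hP0, h1]; simp

/-- A unit normal field with prescribed value at one parameter, prescribed value up to sign at
another one, and parallel to first order at the former. In the plane the sign cannot be
chosen. -/
lemma exists_isUnitNormalField (hd : 2 ≤ d) (hγ : ContDiff ℝ ∞ γ) (hu : ∀ s, ‖deriv γ s‖ = 1)
    {s₀ s₁ : ℝ} (hs : s₀ ≠ s₁) {n₀ n₁ : EuclideanSpace ℝ (Fin d)} (h0 : ‖n₀‖ = 1)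
    (h1 : ‖n₁‖ = 1) (hn0 : inner ℝ n₀ (deriv γ s₀) = 0) (hn1 : inner ℝ n₁ (deriv γ s₁) = 0) :
    ∃ N, IsUnitNormalField γ N ∧ N s₀ = n₀ ∧ (N s₁ = n₁ ∨ N s₁ = -n₁) ∧
      deriv N s₀ = -(inner ℝ n₀ (deriv (deriv γ) s₀) : ℝ) • deriv γ s₀ := by
  rcases hd.eq_or_lt with rfl | hd3
  · obtain ⟨N, hN⟩ := exists_isUnitNormalField_plane hγ hu
    have key : ∀ s (n : EuclideanSpace ℝ (Fin 2)), ‖n‖ = 1 → inner ℝ n (deriv γ s) = 0 →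
        N s = n ∨ N s = -n := by
      intro s n hn hnT
      have := eq_smul_of_orthogonal_plane hn (hu s) (by rw [real_inner_comm]; exact hnT)
        (hN.normal s)
      have h2 : |(inner ℝ (N s) n : ℝ)| = 1 := by
        have h3 := congrArg norm this
        rw [norm_smul, hn, hN.unit s] at h3
        simpa using h3.symm
      rcases (abs_eq zero_le_one).1 h2 with h | h
      · left; rw [this, h, one_smul]
      · right; rw [this, h]; simp
    -- the derivative of any unit normal field of a plane curve is tangent
    have hder : ∀ N : ℝ → EuclideanSpace ℝ (Fin 2), IsUnitNormalField γ N → ∀ s,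
        deriv N s = -(inner ℝ (N s) (deriv (deriv γ) s) : ℝ) • deriv γ s := by
      intro N hN s
      have hd' := hasDerivAt hN.smooth s
      rw [← inner_deriv_of_inner_eq_zero hd' (hasDerivAt (contDiff_deriv hγ) s) hN.normal]
      exact eq_smul_of_orthogonal_plane (hu s) (hN.unit s) (hN.normal s)
        (by rw [real_inner_comm]; exact inner_deriv_self_of_norm_eq_one hd' hN.unit)
    rcases key s₀ n₀ h0 hn0 with h | h
    · exact ⟨N, hN, h, key s₁ n₁ h1 hn1, by rw [hder N hN, h]⟩
    · have hN' : IsUnitNormalField γ (fun s => - N s) :=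
        ⟨hN.smooth.neg, fun s => by rw [norm_neg, hN.unit], fun s => by
          rw [inner_neg_left, hN.normal, neg_zero]⟩
      refine ⟨fun s => - N s, hN', by simp [h], ?_, by rw [hder _ hN']; simp [h]⟩
      rcases key s₁ n₁ h1 hn1 with h' | h'
      · right; simp [h']
      · left; simp [h']
  · -- the field to be projected is stationary at `s₀` whatever the vector `w` is
    let e : ℝ → EuclideanSpace ℝ (Fin d) :=
      fun s => n₀ + (((s - s₀) / (s₁ - s₀)) ^ 2) • (n₁ - n₀)
    let χ : ℝ → ℝ := fun s => (s - s₀) ^ 2 * (s - s₁) ^ 2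
    have hsub : s₁ - s₀ ≠ 0 := sub_ne_zero.2 hs.symm
    have he0 : e s₀ = n₀ := by simp [e]
    have he1 : e s₁ = n₁ := by simp [e, div_self hsub]
    have he : ContDiff ℝ ∞ e := by fun_prop
    have hχ : ContDiff ℝ ∞ χ := by fun_prop
    have hn0' : inner ℝ (deriv γ s₀) n₀ = 0 := by rw [real_inner_comm]; exact hn0
    have hn1' : inner ℝ (deriv γ s₁) n₁ = 0 := by rw [real_inner_comm]; exact hn1
    have hne : ∀ s, χ s = 0 → e s - (inner ℝ (deriv γ s) (e s) : ℝ) • deriv γ s ≠ 0 := by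
      intro s hs0
      have : s = s₀ ∨ s = s₁ := by
        rcases mul_eq_zero.1 hs0 with h | h
        · left; exact sub_eq_zero.1 (pow_eq_zero_iff two_ne_zero |>.1 h)
        · right; exact sub_eq_zero.1 (pow_eq_zero_iff two_ne_zero |>.1 h)
      rcases this with rfl | rfl
      · rw [he0, hn0', zero_smul, sub_zero]; exact norm_ne_zero_iff.1 (by rw [h0]; simp)
      · rw [he1, hn1', zero_smul, sub_zero]; exact norm_ne_zero_iff.1 (by rw [h1]; simp)
    obtain ⟨w, hw⟩ := exists_forall_not_tangent hd3 hγ he hχ hne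
    have hχ0 : χ s₀ = 0 := by simp [χ]
    have hχ1 : χ s₁ = 0 := by simp [χ]
    have hder : HasDerivAt (fun s => e s + χ s • w) 0 s₀ := by
      have a1 : HasDerivAt (fun s : ℝ => ((s - s₀) / (s₁ - s₀)) ^ 2) 0 s₀ := by
        exact ((((hasDerivAt_id s₀).sub_const s₀).div_const (s₁ - s₀)).pow 2).congr_deriv (by simp)
      have a2 : HasDerivAt χ 0 s₀ := by
        exact ((((hasDerivAt_id s₀).sub_const s₀).pow 2).mul
          (((hasDerivAt_id s₀).sub_const s₁).pow 2)).congr_deriv (by simp)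
      exact (((a1.smul_const (n₁ - n₀)).const_add n₀).add (a2.smul_const w)).congr_deriv (by simp)
    have hN := isUnitNormalField_normalize hγ hu
      (show ContDiff ℝ ∞ (fun s => e s + χ s • w) by fun_prop) hw
    refine ⟨_, hN, ?_, Or.inl ?_, ?_⟩
    · simp [hχ0, he0, hn0', h0]
    · simp [hχ1, he1, hn1', h1]
    · have := (hasDerivAt_normalize hγ hder (by simpa [hχ0, he0] using h0)
        (by simpa [hχ0, he0] using hn0)).deriv
      rw [this]; simp [hχ0, he0]

/-- Polar decomposition of a normal vector, including the zero vector. -/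
lemma exists_unit_normal_eq_norm_smul (hd : 2 ≤ d) {T v : EuclideanSpace ℝ (Fin d)}
    (hv : inner ℝ v T = 0) : ∃ n : EuclideanSpace ℝ (Fin d), ‖n‖ = 1 ∧ inner ℝ n T = 0 ∧
      v = ‖v‖ • n := by
  by_cases h : v = 0
  · have : 0 < Module.finrank ℝ ((ℝ ∙ T)ᗮ : Submodule ℝ (EuclideanSpace ℝ (Fin d))) := by
      have h1 := Submodule.finrank_add_finrank_orthogonal (ℝ ∙ T)
      have h2 := finrank_span_le_card (R := ℝ) ({T} : Set (EuclideanSpace ℝ (Fin d)))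
      rw [finrank_euclideanSpace_fin] at h1
      simp at h2
      omega
    obtain ⟨u, hu⟩ := Module.finrank_pos_iff_exists_ne_zero.1 this
    have hu0 : (u : EuclideanSpace ℝ (Fin d)) ≠ 0 := fun h => hu (Subtype.ext h)
    refine ⟨‖(u : EuclideanSpace ℝ (Fin d))‖⁻¹ • (u : EuclideanSpace ℝ (Fin d)), ?_, ?_, by simp [h]⟩
    · rw [norm_smul, norm_inv, norm_norm, inv_mul_cancel₀ (norm_ne_zero_iff.2 hu0)]
    · have := Submodule.mem_orthogonal_singleton_iff_inner_left.1 u.2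
      rw [inner_smul_left, this, mul_zero]
  · have hv0 := norm_ne_zero_iff.2 h
    refine ⟨‖v‖⁻¹ • v, ?_, ?_, ?_⟩
    · rw [norm_smul, norm_inv, norm_norm, inv_mul_cancel₀ hv0]
    · rw [inner_smul_left, hv, mul_zero]
    · rw [smul_smul, mul_inv_cancel₀ hv0, one_smul]

end NormalFields

/-! ### The geometry of a tube that does not overlap itself -/

/-- The consequences of non-overlapping on which the argument rests: the curvature is at most
`1 / a`, and the open normal discs of radius `a` at different points are disjoint. -/
structure IsTubeAxis {d : ℕ} (γ : ℝ → EuclideanSpace ℝ (Fin d)) (a : ℝ) : Prop where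
  pos : 0 < a
  smooth : ContDiff ℝ ∞ γ
  unit_speed : ∀ s, ‖deriv γ s‖ = 1
  curvature_le : ∀ s, a * ‖deriv (deriv γ) s‖ ≤ 1
  param_unique : ∀ x s s', ‖x - γ s‖ < a → ‖x - γ s'‖ < a → inner ℝ (x - γ s) (deriv γ s) = 0 →
    inner ℝ (x - γ s') (deriv γ s') = 0 → s = s'

section OfDoesNotOverlap

variable {d : ℕ} {γ : ℝ → EuclideanSpace ℝ (Fin d)} {a : ℝ}

lemma inner_deriv_deriv_of_unit_speed (hγ : ContDiff ℝ ∞ γ) (hu : ∀ s, ‖deriv γ s‖ = 1) (s : ℝ) :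
    inner ℝ (deriv γ s) (deriv (deriv γ) s) = 0 :=
  inner_deriv_self_of_norm_eq_one (hasDerivAt (contDiff_deriv hγ) s) hu

/-- If the curvature exceeded `1 / a` at `s₀`, the parallel normal field pointing to the centre
of curvature would make the differential of the tube map degenerate at that centre. -/
lemma curvature_le_of_doesNotOverlap (hd : 2 ≤ d) (hγ : ContDiff ℝ ∞ γ)
    (hu : ∀ s, ‖deriv γ s‖ = 1) (ha : 0 < a) (hover : DoesNotOverlap γ a) (s₀ : ℝ) :
    a * ‖deriv (deriv γ) s₀‖ ≤ 1 := by
  by_contra! hcon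
  set k := deriv (deriv γ) s₀ with hk
  have hk0 : 0 < ‖k‖ := by
    by_contra! h
    have : ‖k‖ = 0 := le_antisymm h (norm_nonneg _)
    rw [this] at hcon; norm_num at hcon
  have hkT : inner ℝ k (deriv γ s₀) = 0 := by
    rw [real_inner_comm]; exact inner_deriv_deriv_of_unit_speed hγ hu s₀
  have hn0 : ‖‖k‖⁻¹ • k‖ = 1 := by
    rw [norm_smul, norm_inv, norm_norm, inv_mul_cancel₀ hk0.ne']
  obtain ⟨n₁, hn1, hn1T, -⟩ := exists_unit_normal_eq_norm_smul hd
    (T := deriv γ (s₀ + 1)) (v := 0) (by simp)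
  obtain ⟨N, hN, hN0, -, hN'⟩ := exists_isUnitNormalField hd hγ hu (s₀ := s₀) (s₁ := s₀ + 1)
    (by simp) hn0 hn1 (by rw [inner_smul_left, hkT, mul_zero]) hn1T
  obtain ⟨hF, G, hG, hGF⟩ := hover N hN
  set F := fun p : ℝ × ℝ => γ p.1 + p.2 • N p.1 with hFdef
  set t := ‖k‖⁻¹ with ht
  have hta : t ∈ Ioo (-a) a := by
    have h1 : 0 < t := inv_pos.2 hk0
    refine ⟨by linarith, ?_⟩
    rw [ht, inv_lt_iff_one_lt_mul₀ hk0]; exact hcon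
  have hU : ∀ s, (s, t) ∈ (univ : Set ℝ) ×ˢ Ioo (-a) a := fun s => ⟨mem_univ _, hta⟩
  have hc : HasDerivAt (fun s => F (s, t)) 0 s₀ := by
    have h1 := (hasDerivAt hγ s₀).add ((hasDerivAt hN.smooth s₀).const_smul t)
    refine h1.congr_deriv ?_
    rw [hN', inner_smul_left, real_inner_self_eq_norm_sq, smul_smul]
    have : t * -((starRingEnd ℝ) t * ‖k‖ ^ 2) = -1 := by
      simp only [ht, conj_trivial]; field_simp
    rw [this]; simp
  have hGd : DifferentiableWithinAt ℝ G (F '' (univ ×ˢ Ioo (-a) a)) (F (s₀, t)) :=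
    (hG _ (mem_image_of_mem F (hU s₀))).differentiableWithinAt (by simp)
  have hcomp := hGd.hasFDerivWithinAt.comp_hasDerivWithinAt (s := univ) s₀ hc.hasDerivWithinAt
    (fun s _ => mem_image_of_mem F (hU s))
  rw [hasDerivWithinAt_univ, map_zero] at hcomp
  have h2 : (G ∘ fun s => F (s, t)) = fun s => (s, t) := by
    funext s; exact hGF _ (hU s)
  rw [h2] at hcomp
  have := hcomp.unique ((hasDerivAt_id s₀).prodMk (hasDerivAt_const s₀ t))
  exact absurd (congrArg Prod.fst this) (by simp)

lemma param_unique_of_doesNotOverlap (hd : 2 ≤ d) (hγ : ContDiff ℝ ∞ γ)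
    (hu : ∀ s, ‖deriv γ s‖ = 1) (hover : DoesNotOverlap γ a)
    (x : EuclideanSpace ℝ (Fin d)) (s s' : ℝ) (hs : ‖x - γ s‖ < a) (hs' : ‖x - γ s'‖ < a)
    (hn : inner ℝ (x - γ s) (deriv γ s) = 0) (hn' : inner ℝ (x - γ s') (deriv γ s') = 0) :
    s = s' := by
  by_contra hne
  obtain ⟨n₀, h0, h0T, e0⟩ := exists_unit_normal_eq_norm_smul hd hn
  obtain ⟨n₁, h1, h1T, e1⟩ := exists_unit_normal_eq_norm_smul hd hn'
  obtain ⟨N, hN, hN0, hN1, -⟩ := exists_isUnitNormalField hd hγ hu hne h0 h1 h0T h1T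
  obtain ⟨-, G, -, hGF⟩ := hover N hN
  have hx0 : γ s + ‖x - γ s‖ • N s = x := by rw [hN0, ← e0]; abel
  have m0 : (s, ‖x - γ s‖) ∈ (univ : Set ℝ) ×ˢ Ioo (-a) a :=
    ⟨mem_univ _, by constructor <;> linarith [norm_nonneg (x - γ s)]⟩
  have g0 := hGF _ m0
  simp only [hx0] at g0
  rcases hN1 with h | h
  · have hx1 : γ s' + ‖x - γ s'‖ • N s' = x := by rw [h, ← e1]; abel
    have m1 : (s', ‖x - γ s'‖) ∈ (univ : Set ℝ) ×ˢ Ioo (-a) a :=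
      ⟨mem_univ _, by constructor <;> linarith [norm_nonneg (x - γ s')]⟩
    have g1 := hGF _ m1
    simp only [hx1] at g1
    rw [g0] at g1
    exact hne (congrArg Prod.fst g1)
  · have hx1 : γ s' + (-‖x - γ s'‖) • N s' = x := by rw [h, neg_smul_neg, ← e1]; abel
    have m1 : (s', -‖x - γ s'‖) ∈ (univ : Set ℝ) ×ˢ Ioo (-a) a :=
      ⟨mem_univ _, by constructor <;> linarith [norm_nonneg (x - γ s')]⟩
    have g1 := hGF _ m1
    simp only [hx1] at g1
    rw [g0] at g1
    exact hne (congrArg Prod.fst g1)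

lemma DoesNotOverlap.isTubeAxis (hd : 2 ≤ d) (hγ : IsUnboundedCompleteCurve γ) (ha : 0 < a)
    (hover : DoesNotOverlap γ a) : IsTubeAxis γ a :=
  ⟨ha, hγ.smooth, hγ.unit_speed,
    curvature_le_of_doesNotOverlap hd hγ.smooth hγ.unit_speed ha hover,
    param_unique_of_doesNotOverlap hd hγ.smooth hγ.unit_speed hover⟩

end OfDoesNotOverlap

namespace IsTubeAxis

variable {d : ℕ} {γ : ℝ → EuclideanSpace ℝ (Fin d)} {a : ℝ}

lemma hasDerivAt (h : IsTubeAxis γ a) (s : ℝ) : HasDerivAt γ (deriv γ s) s :=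
  IsUnboundedCompleteCurve.hasDerivAt h.smooth s

lemma hasDerivAt_deriv (h : IsTubeAxis γ a) (s : ℝ) :
    HasDerivAt (deriv γ) (deriv (deriv γ) s) s :=
  IsUnboundedCompleteCurve.hasDerivAt (contDiff_deriv h.smooth) s

lemma continuous (h : IsTubeAxis γ a) : Continuous γ := h.smooth.continuous

lemma inner_deriv_deriv (h : IsTubeAxis γ a) (s : ℝ) :
    inner ℝ (deriv γ s) (deriv (deriv γ) s) = 0 :=
  inner_deriv_deriv_of_unit_speed h.smooth h.unit_speed s

lemma inner_deriv_self (h : IsTubeAxis γ a) (s : ℝ) : inner ℝ (deriv γ s) (deriv γ s) = 1 := by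
  rw [real_inner_self_eq_norm_sq, h.unit_speed]; norm_num

/-- First-order condition at a local minimum of the distance to the points of the curve. -/
lemma inner_eq_zero_of_isLocalMin (h : IsTubeAxis γ a) {x : EuclideanSpace ℝ (Fin d)} {s : ℝ}
    (hs : IsLocalMin (fun t => ‖x - γ t‖) s) : inner ℝ (x - γ s) (deriv γ s) = 0 := by
  have h1 : IsLocalMin (fun t => ‖x - γ t‖ ^ 2) s := by
    filter_upwards [hs] with t ht
    gcongr
  have h2 := h1.hasDerivAt_eq_zero ((h.hasDerivAt s).const_sub x).norm_sq
  rw [inner_neg_right] at h2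
  linarith

lemma norm_deriv_sub_le (h : IsTubeAxis γ a) (s t : ℝ) :
    ‖deriv γ t - deriv γ s‖ ≤ a⁻¹ * |t - s| := by
  have := Convex.norm_image_sub_le_of_norm_deriv_le (f := deriv γ) (s := univ) (C := a⁻¹)
    (x := s) (y := t) (fun x _ => (h.hasDerivAt_deriv x).differentiableAt)
    (fun x _ => by
      rw [← one_div, le_div_iff₀ h.pos, mul_comm]; exact h.curvature_le x) convex_univ
    (mem_univ _) (mem_univ _)
  simpa using this

/-- Over a parameter distance of at most `a / 2` the curve moves by at least half of it. -/
lemma half_abs_le_norm_sub (h : IsTubeAxis γ a) (s t : ℝ) (hst : |t - s| ≤ a / 2) :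
    |t - s| / 2 ≤ ‖γ t - γ s‖ := by
  have ha := h.pos
  have h1 : ‖(γ t - t • deriv γ s) - (γ s - s • deriv γ s)‖ ≤ (1 / 2) * |t - s| := by
    have := Convex.norm_image_sub_le_of_norm_hasDerivWithin_le
      (f := fun u => γ u - u • deriv γ s) (f' := fun u => deriv γ u - deriv γ s)
      (s := uIcc s t) (C := 1 / 2) (x := s) (y := t)
      (fun u _ => ((h.hasDerivAt u).sub (by
        simpa using (hasDerivAt_id u).smul_const (deriv γ s))).hasDerivWithinAt)
      (fun u hu => by
        refine (h.norm_deriv_sub_le s u).trans ?_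
        have h3 : |u - s| ≤ |t - s| := abs_sub_left_of_mem_uIcc hu
        rw [inv_mul_le_iff₀ ha]; linarith)
      (convex_uIcc s t) left_mem_uIcc right_mem_uIcc
    simpa using this
  have h2 : (γ t - t • deriv γ s) - (γ s - s • deriv γ s) = (γ t - γ s) - (t - s) • deriv γ s := by
    rw [sub_smul]; abel
  rw [h2] at h1
  have h3 : ‖(t - s) • deriv γ s‖ = |t - s| := by rw [norm_smul, h.unit_speed]; simp
  have h4 := norm_sub_norm_le ((t - s) • deriv γ s) (γ t - γ s)
  rw [norm_sub_rev ((t - s) • deriv γ s)] at h4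
  linarith

/-- Points of the curve at parameter distance at least `a` keep a fixed distance: otherwise one
of them would lie in a normal disc around a point close to the other one. -/
lemma le_norm_sub_of_le_abs (h : IsTubeAxis γ a) (s t : ℝ) (hst : a ≤ |t - s|) :
    a / 8 ≤ ‖γ t - γ s‖ := by
  have ha := h.pos
  by_contra! hcon
  obtain ⟨u, hu, hmin⟩ := isCompact_Icc.exists_isMinOn (s := Icc (s - a / 2) (s + a / 2))
    ⟨s, by constructor <;> linarith⟩ (f := fun u => ‖γ t - γ u‖)
    (continuous_const.sub h.continuous).norm.continuousOn
  have hus : ‖γ t - γ u‖ < a / 8 :=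
    lt_of_le_of_lt (hmin (show s ∈ _ by constructor <;> linarith)) hcon
  have hnot : ∀ u, |u - s| = a / 2 → ¬ ‖γ t - γ u‖ < a / 8 := by
    intro u hu hlt
    have h1 := h.half_abs_le_norm_sub s u hu.le
    have h2 := norm_sub_le_norm_sub_add_norm_sub (γ u) (γ t) (γ s)
    rw [norm_sub_rev (γ u) (γ t)] at h2
    rw [hu] at h1
    linarith
  have hu' : u ∈ Ioo (s - a / 2) (s + a / 2) := by
    refine ⟨lt_of_le_of_ne hu.1 fun e => hnot u ?_ hus, lt_of_le_of_ne hu.2 fun e => hnot u ?_ hus⟩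
    · rw [← e]; simp; positivity
    · rw [e]; simp; positivity
  have hloc : IsLocalMin (fun v => ‖γ t - γ v‖) u := by
    filter_upwards [Ioo_mem_nhds hu'.1 hu'.2] with v hv
    exact hmin (Ioo_subset_Icc_self hv)
  have := h.param_unique (γ t) t u (by simp [ha]) (by linarith) (by simp)
    (h.inner_eq_zero_of_isLocalMin hloc)
  have h2 : |t - s| ≤ a / 2 := by rw [this, abs_le]; constructor <;> linarith [hu.1, hu.2]
  linarith

/-- The curve is proper: it spends a bounded set of parameters in a bounded region. -/
lemma isBounded_preimage_closedBall (h : IsTubeAxis γ a) (x : EuclideanSpace ℝ (Fin d)) (R : ℝ) :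
    Bornology.IsBounded {s | ‖x - γ s‖ ≤ R} := by
  have ha := h.pos
  -- finitely many balls of radius `a / 16` cover the region, and the preimage of each of them has
  -- diameter at most `a`
  obtain ⟨F, -, hF, hcov⟩ := (isCompact_closedBall x R).finite_cover_balls
    (show 0 < a / 16 by positivity)
  refine ((Bornology.isBounded_biUnion hF (f := fun c => {s | ‖c - γ s‖ < a / 16})).2 ?_).subset ?_
  · intro c _
    rcases eq_empty_or_nonempty {s | ‖c - γ s‖ < a / 16} with he | ⟨s₀, hs0⟩
    · rw [he]; exact Bornology.isBounded_empty
    · refine (Metric.isBounded_closedBall (x := s₀) (r := a)).subset fun s hs => ?_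
      rw [Metric.mem_closedBall, Real.dist_eq]
      by_contra! hcon
      have h1 := h.le_norm_sub_of_le_abs s₀ s hcon.le
      have h2 := norm_sub_le_norm_sub_add_norm_sub (γ s) c (γ s₀)
      rw [norm_sub_rev (γ s) c] at h2
      have h3 : ‖c - γ s‖ < a / 16 := hs
      have h4 : ‖c - γ s₀‖ < a / 16 := hs0
      linarith
  · intro s hs
    have : γ s ∈ Metric.closedBall x R := by
      rw [Metric.mem_closedBall, dist_eq_norm, norm_sub_rev]; exact hs
    obtain ⟨c, hc, hcs⟩ := mem_iUnion₂.1 (hcov this)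
    refine mem_iUnion₂.2 ⟨c, hc, ?_⟩
    rw [Metric.mem_ball, dist_eq_norm, norm_sub_rev] at hcs
    exact hcs

lemma isCompact_preimage_closedBall (h : IsTubeAxis γ a) (x : EuclideanSpace ℝ (Fin d)) (R : ℝ) :
    IsCompact {s | ‖x - γ s‖ ≤ R} :=
  Metric.isCompact_of_isClosed_isBounded
    (isClosed_le (continuous_const.sub h.continuous).norm continuous_const)
    (h.isBounded_preimage_closedBall x R)

/-- Every point has a nearest point on the curve. -/
lemma exists_nearest (h : IsTubeAxis γ a) (x : EuclideanSpace ℝ (Fin d)) :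
    ∃ s, ‖x - γ s‖ = Metric.infDist x (range γ) := by
  obtain ⟨s, hs, hmin⟩ := (h.isCompact_preimage_closedBall x ‖x - γ 0‖).exists_isMinOn
    ⟨0, le_refl ‖x - γ 0‖⟩ (f := fun u => ‖x - γ u‖) (continuous_const.sub h.continuous).norm.continuousOn
  refine ⟨s, le_antisymm ?_ ?_⟩
  · refine (Metric.le_infDist (range_nonempty γ)).2 ?_
    rintro _ ⟨u, rfl⟩
    rw [dist_eq_norm]
    by_cases hu : ‖x - γ u‖ ≤ ‖x - γ 0‖
    · exact hmin hu
    · exact (hmin (show (0 : ℝ) ∈ {u | ‖x - γ u‖ ≤ ‖x - γ 0‖} from le_refl ‖x - γ 0‖)).trans (not_le.1 hu).le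
  · rw [← dist_eq_norm]; exact Metric.infDist_le_dist_of_mem (mem_range_self s)

end IsTubeAxis

/-- The parameter of a nearest point of the curve, chosen arbitrarily where there are several. -/
noncomputable def nearestParam {d : ℕ} (γ : ℝ → EuclideanSpace ℝ (Fin d))
    (x : EuclideanSpace ℝ (Fin d)) : ℝ :=
  Classical.epsilon fun s => ‖x - γ s‖ = Metric.infDist x (range γ)

/-- The vector from the chosen nearest point of the curve to `x`. -/
noncomputable def normalPart {d : ℕ} (γ : ℝ → EuclideanSpace ℝ (Fin d))
    (x : EuclideanSpace ℝ (Fin d)) : EuclideanSpace ℝ (Fin d) :=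
  x - γ (nearestParam γ x)

/-- The factor `1 - ⟪κ, v⟫` by which the volume element of the tube differs from that of a straight
one. -/
noncomputable def tubeJacobian {d : ℕ} (γ : ℝ → EuclideanSpace ℝ (Fin d))
    (x : EuclideanSpace ℝ (Fin d)) : ℝ :=
  1 - inner ℝ (deriv (deriv γ) (nearestParam γ x)) (normalPart γ x)

namespace IsTubeAxis

variable {d : ℕ} {γ : ℝ → EuclideanSpace ℝ (Fin d)} {a : ℝ}

lemma norm_normalPart (h : IsTubeAxis γ a) (x : EuclideanSpace ℝ (Fin d)) :
    ‖normalPart γ x‖ = Metric.infDist x (range γ) :=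
  Classical.epsilon_spec (h.exists_nearest x)

lemma norm_normalPart_le (h : IsTubeAxis γ a) (x : EuclideanSpace ℝ (Fin d)) (s : ℝ) :
    ‖normalPart γ x‖ ≤ ‖x - γ s‖ := by
  rw [h.norm_normalPart, ← dist_eq_norm]
  exact Metric.infDist_le_dist_of_mem (mem_range_self s)

lemma inner_eq_zero_of_nearest (h : IsTubeAxis γ a) {x : EuclideanSpace ℝ (Fin d)} {s : ℝ}
    (hs : ‖x - γ s‖ = Metric.infDist x (range γ)) : inner ℝ (x - γ s) (deriv γ s) = 0 := by
  refine h.inner_eq_zero_of_isLocalMin (Eventually.of_forall fun t => ?_)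
  change ‖x - γ s‖ ≤ ‖x - γ t‖
  rw [hs, ← dist_eq_norm]
  exact Metric.infDist_le_dist_of_mem (mem_range_self t)

lemma inner_normalPart (h : IsTubeAxis γ a) (x : EuclideanSpace ℝ (Fin d)) :
    inner ℝ (normalPart γ x) (deriv γ (nearestParam γ x)) = 0 :=
  h.inner_eq_zero_of_nearest (h.norm_normalPart x)

lemma mem_tube_iff (h : IsTubeAxis γ a) {x : EuclideanSpace ℝ (Fin d)} :
    x ∈ tube γ a ↔ ‖normalPart γ x‖ < a := by
  rw [h.norm_normalPart]; rfl

/-- Inside the tube, normality determines the parameter. -/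
lemma nearestParam_eq (h : IsTubeAxis γ a) {x : EuclideanSpace ℝ (Fin d)} {s : ℝ}
    (hs : ‖x - γ s‖ < a) (hn : inner ℝ (x - γ s) (deriv γ s) = 0) : nearestParam γ x = s :=
  h.param_unique x _ _ ((h.norm_normalPart_le x s).trans_lt hs) hs (h.inner_normalPart x) hn

lemma inner_curvature_le (h : IsTubeAxis γ a) (s : ℝ) (v : EuclideanSpace ℝ (Fin d)) :
    inner ℝ (deriv (deriv γ) s) v ≤ ‖v‖ / a := by
  refine (real_inner_le_norm _ _).trans ?_
  rw [le_div_iff₀ h.pos]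
  nlinarith [h.curvature_le s, norm_nonneg v]

lemma one_sub_le_tubeJacobian (h : IsTubeAxis γ a) (x : EuclideanSpace ℝ (Fin d)) :
    1 - ‖normalPart γ x‖ / a ≤ tubeJacobian γ x := by
  have := h.inner_curvature_le (nearestParam γ x) (normalPart γ x)
  rw [tubeJacobian]; linarith

lemma tubeJacobian_pos (h : IsTubeAxis γ a) {x : EuclideanSpace ℝ (Fin d)} (hx : x ∈ tube γ a) :
    0 < tubeJacobian γ x := by
  refine lt_of_lt_of_le ?_ (h.one_sub_le_tubeJacobian x)
  rw [sub_pos, div_lt_one h.pos]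
  exact h.mem_tube_iff.1 hx

lemma isOpen_tube (γ : ℝ → EuclideanSpace ℝ (Fin d)) (a : ℝ) : IsOpen (tube γ a) :=
  isOpen_lt (Metric.continuous_infDist_pt _) continuous_const

lemma closure_tube_subset (γ : ℝ → EuclideanSpace ℝ (Fin d)) (a : ℝ) :
    closure (tube γ a) ⊆ {x | Metric.infDist x (range γ) ≤ a} :=
  closure_minimal (fun x hx => le_of_lt (show Metric.infDist x (range γ) < a from hx))
    (isClosed_le (Metric.continuous_infDist_pt _) continuous_const)

/-- The parameter depends continuously on the point where the nearest point is unique. -/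
lemma continuousAt_nearestParam (h : IsTubeAxis γ a) {x : EuclideanSpace ℝ (Fin d)}
    (hx : ∀ s, ‖x - γ s‖ = Metric.infDist x (range γ) → s = nearestParam γ x) :
    ContinuousAt (nearestParam γ) x := by
  rw [Metric.continuousAt_iff]
  intro ε hε
  set ρ := Metric.infDist x (range γ) with hρ
  set C := {s | ‖x - γ s‖ ≤ ρ + 2} ∩ {s | ε ≤ dist s (nearestParam γ x)} with hC
  have hCc : IsCompact C := (h.isCompact_preimage_closedBall x (ρ + 2)).inter_right
    (isClosed_le continuous_const (continuous_id.dist continuous_const))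
  obtain ⟨m, hm0, hm⟩ : ∃ m > 0, ∀ s ∈ C, ρ + m ≤ ‖x - γ s‖ := by
    rcases C.eq_empty_or_nonempty with he | hne
    · exact ⟨1, one_pos, fun s hs => by simp [he] at hs⟩
    · obtain ⟨s, hs, hmin⟩ := hCc.exists_isMinOn hne (f := fun u => ‖x - γ u‖)
        (continuous_const.sub h.continuous).norm.continuousOn
      have h1 : ρ < ‖x - γ s‖ := by
        refine lt_of_le_of_ne ?_ fun e => ?_
        · rw [hρ, ← h.norm_normalPart]; exact h.norm_normalPart_le x s
        · have h2 := hs.2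
          rw [hx s e.symm] at h2
          simp only [mem_ofPred_eq, dist_self] at h2
          linarith
      refine ⟨‖x - γ s‖ - ρ, by linarith, fun u hu => ?_⟩
      have : ‖x - γ s‖ ≤ ‖x - γ u‖ := hmin hu
      linarith
  refine ⟨min 1 (m / 2), by positivity, fun y hy => ?_⟩
  by_contra! hcon
  have hy1 : dist y x < 1 := lt_of_lt_of_le hy (min_le_left _ _)
  have hy2 : dist y x < m / 2 := lt_of_lt_of_le hy (min_le_right _ _)
  have h1 : ‖x - γ (nearestParam γ y)‖ ≤ ρ + 2 * dist y x := by
    have e1 := norm_sub_le_norm_sub_add_norm_sub x y (γ (nearestParam γ y))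
    have e2 : ‖y - γ (nearestParam γ y)‖ ≤ ρ + dist y x := by
      have := h.norm_normalPart y
      rw [normalPart] at this
      rw [this]
      exact Metric.infDist_le_infDist_add_dist
    rw [← dist_eq_norm x y, dist_comm] at e1
    linarith
  have h2 := hm _ ⟨by simp only [mem_ofPred_eq]; linarith, hcon⟩
  linarith

/-- The implicit function theorem, applied to the first-order condition: the parameter is
continuously differentiable where the nearest point is unique and the point is not focal. -/
lemma contDiffAt_nearestParam (h : IsTubeAxis γ a) {x : EuclideanSpace ℝ (Fin d)}
    (hx : ∀ s, ‖x - γ s‖ = Metric.infDist x (range γ) → s = nearestParam γ x)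
    (hf : tubeJacobian γ x ≠ 0) : ContDiffAt ℝ 1 (nearestParam γ) x := by
  let g : EuclideanSpace ℝ (Fin d) × ℝ → ℝ := fun p => inner ℝ (p.1 - γ p.2) (deriv γ p.2)
  have hT := contDiff_deriv h.smooth
  have hsm := h.smooth
  have hg : ContDiff ℝ ∞ g := by
    refine ContDiff.inner ℝ ?_ ?_
    · exact contDiff_fst.sub (hsm.comp contDiff_snd)
    · exact hT.comp contDiff_snd
  have hg1 : ContDiffAt ℝ 1 g (x, nearestParam γ x) := (hg.of_le (by simp)).contDiffAt
  have hd2 : ∀ r : ℝ, (fderiv ℝ g (x, nearestParam γ x) ∘L .inr ℝ _ ℝ) r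
      = -(tubeJacobian γ x) * r := by
    intro r
    have h1 : HasFDerivAt (fun t : ℝ => g (x, t))
        (fderiv ℝ g (x, nearestParam γ x) ∘L .inr ℝ _ ℝ) (nearestParam γ x) :=
      HasFDerivAt.comp (nearestParam γ x)
        (hg1.differentiableAt (by simp)).hasFDerivAt (hasFDerivAt_prodMk_right _ _)
    have h2 : HasDerivAt (fun t : ℝ => g (x, t)) (-(tubeJacobian γ x)) (nearestParam γ x) := by
      refine (((h.hasDerivAt _).const_sub x).inner ℝ (h.hasDerivAt_deriv _)).congr_deriv ?_
      rw [inner_neg_left, h.inner_deriv_self, tubeJacobian, real_inner_comm, normalPart]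
      ring
    have h3 := h1.hasDerivAt.unique h2
    rw [← h3]
    have := (fderiv ℝ g (x, nearestParam γ x) ∘L .inr ℝ _ ℝ).map_smul r 1
    simp only [smul_eq_mul, mul_one] at this
    rw [this, mul_comm]
  have hinv : (fderiv ℝ g (x, nearestParam γ x) ∘L .inr ℝ _ ℝ).IsInvertible := by
    refine ⟨ContinuousLinearEquiv.unitsEquivAut ℝ (Units.mk0 (-(tubeJacobian γ x))
      (neg_ne_zero.2 hf)), ?_⟩
    ext
    simp [hd2]
  have hψ := hg1.contDiffAt_implicitFunction one_ne_zero hinv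
  refine hψ.congr_of_eventuallyEq ?_
  have hcont : Tendsto (fun y => (y, nearestParam γ y)) (𝓝 x) (𝓝 (x, nearestParam γ x)) :=
    (continuousAt_id.prodMk (h.continuousAt_nearestParam hx))
  filter_upwards [hcont.eventually (hg1.eventually_apply_eq_iff_implicitFunction one_ne_zero hinv)]
    with y hy
  refine (hy.1 ?_).symm
  change inner ℝ (normalPart γ y) _ = inner ℝ (normalPart γ x) _
  rw [h.inner_normalPart, h.inner_normalPart]

lemma contDiffAt_nearestParam_of_mem (h : IsTubeAxis γ a) {x : EuclideanSpace ℝ (Fin d)}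
    (hx : x ∈ tube γ a) : ContDiffAt ℝ 1 (nearestParam γ) x :=
  h.contDiffAt_nearestParam (fun s hs => (h.nearestParam_eq (by rw [hs]; exact hx)
    (h.inner_eq_zero_of_nearest hs)).symm) (h.tubeJacobian_pos hx).ne'

end IsTubeAxis

/-! ### Calculus of the divergence -/

section Divergence

variable {d : ℕ} {X Y : EuclideanSpace ℝ (Fin d) → EuclideanSpace ℝ (Fin d)}
  {x : EuclideanSpace ℝ (Fin d)}

lemma sum_clm_single_mul (L : EuclideanSpace ℝ (Fin d) →L[ℝ] ℝ) (w : EuclideanSpace ℝ (Fin d)) :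
    ∑ i, L (EuclideanSpace.single i 1) * w i = L w := by
  have h : w = ∑ i, w i • EuclideanSpace.single i (1 : ℝ) := by
    ext j
    simp [Finset.sum_apply, Pi.single_apply]
  conv_rhs => rw [h]
  rw [map_sum]
  exact Finset.sum_congr rfl fun i _ => by rw [map_smul, smul_eq_mul, mul_comm]

lemma divergence_congr (h : X =ᶠ[𝓝 x] Y) : divergence X x = divergence Y x := by
  simp only [divergence, h.fderiv_eq]

lemma divergence_add (hX : DifferentiableAt ℝ X x) (hY : DifferentiableAt ℝ Y x) :
    divergence (fun y => X y + Y y) x = divergence X x + divergence Y x := by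
  simp only [divergence, fderiv_fun_add hX hY, ← Finset.sum_add_distrib]
  rfl

lemma divergence_sub (hX : DifferentiableAt ℝ X x) (hY : DifferentiableAt ℝ Y x) :
    divergence (fun y => X y - Y y) x = divergence X x - divergence Y x := by
  simp only [divergence, fderiv_fun_sub hX hY, ← Finset.sum_sub_distrib]
  rfl

lemma divergence_const_smul (c : ℝ) (hX : DifferentiableAt ℝ X x) :
    divergence (fun y => c • X y) x = c * divergence X x := by
  simp only [divergence, fderiv_fun_const_smul hX, Finset.mul_sum]
  rfl

lemma divergence_smul {g : EuclideanSpace ℝ (Fin d) → ℝ} {g' : EuclideanSpace ℝ (Fin d) →L[ℝ] ℝ}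
    (hg : HasFDerivAt g g' x) (hX : DifferentiableAt ℝ X x) :
    divergence (fun y => g y • X y) x = g x * divergence X x + g' (X x) := by
  have h := (hg.smul hX.hasFDerivAt).fderiv
  rw [divergence]
  change ∑ i, (fderiv ℝ (g • X) x (EuclideanSpace.single i 1)) i = _
  rw [h, ← sum_clm_single_mul g' (X x), divergence, Finset.mul_sum, ← Finset.sum_add_distrib]
  exact Finset.sum_congr rfl fun i _ => by simp

lemma divergence_smul_const {g : EuclideanSpace ℝ (Fin d) → ℝ}
    {g' : EuclideanSpace ℝ (Fin d) →L[ℝ] ℝ} (hg : HasFDerivAt g g' x)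
    (e : EuclideanSpace ℝ (Fin d)) : divergence (fun y => g y • e) x = g' e := by
  rw [divergence_smul hg (differentiableAt_const e)]
  simp [divergence]

/-- The divergence of a field that depends on one scalar function only. -/
lemma divergence_comp {c : ℝ → EuclideanSpace ℝ (Fin d)} {c' : EuclideanSpace ℝ (Fin d)}
    {g : EuclideanSpace ℝ (Fin d) → ℝ} {g' : EuclideanSpace ℝ (Fin d) →L[ℝ] ℝ}
    (hg : HasFDerivAt g g' x) (hc : HasDerivAt c c' (g x)) :
    divergence (fun y => c (g y)) x = g' c' := by
  have h := (hc.hasFDerivAt.comp x hg).fderiv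
  rw [divergence]
  change ∑ i, (fderiv ℝ (c ∘ g) x (EuclideanSpace.single i 1)) i = _
  rw [h, ← sum_clm_single_mul g' c']
  exact Finset.sum_congr rfl fun i _ => by simp

lemma divergence_id : divergence (fun y => y) x = d := by
  simp [divergence]

lemma continuous_divergence (hX : ContDiff ℝ 1 X) : Continuous (divergence X) := by
  have := hX.continuous_fderiv one_ne_zero
  unfold divergence
  fun_prop

lemma divergence_eq_zero_of_notMem_tsupport (hx : x ∉ tsupport X) : divergence X x = 0 := by
  have h0 : divergence (fun _ : EuclideanSpace ℝ (Fin d) => (0 : EuclideanSpace ℝ (Fin d))) x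
      = 0 := by simp [divergence]
  rw [← h0]
  exact divergence_congr (notMem_tsupport_iff_eventuallyEq.1 hx)

lemma hasCompactSupport_divergence (hX : HasCompactSupport X) :
    HasCompactSupport (divergence X) :=
  HasCompactSupport.intro hX fun _ hx => divergence_eq_zero_of_notMem_tsupport hx

lemma integrable_divergence (hX : ContDiff ℝ 1 X) (hc : HasCompactSupport X) :
    Integrable (divergence X) :=
  (continuous_divergence hX).integrable_of_hasCompactSupport (hasCompactSupport_divergence hc)

lemma integral_divergence_eq_zero (hX : ContDiff ℝ 1 X) (hc : HasCompactSupport X) :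
    ∫ x, divergence X x = 0 := by
  have hcoord : ∀ i : Fin d, ∀ x, (fderiv ℝ X x (EuclideanSpace.single i 1)) i
      = fderiv ℝ (fun y => X y i) x (EuclideanSpace.single i 1) := by
    intro i x
    have h := ((EuclideanSpace.proj (𝕜 := ℝ) i).hasFDerivAt.comp x
      (hX.differentiable one_ne_zero x).hasFDerivAt).fderiv
    change fderiv ℝ (fun y => X y i) x = _ at h
    rw [h]; rfl
  have hXi : ∀ i : Fin d, ContDiff ℝ 1 (fun y => X y i) := fun i => contDiff_euclidean.1 hX i
  have hci : ∀ i : Fin d, HasCompactSupport (fun y => X y i) := fun i =>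
    hc.comp_left (g := fun w : EuclideanSpace ℝ (Fin d) => w i) rfl
  have hint : ∀ i : Fin d, Integrable (fun x => fderiv ℝ (fun y => X y i) x
      (EuclideanSpace.single i 1)) := fun i =>
    ((((hXi i).continuous_fderiv one_ne_zero).clm_apply
      continuous_const).integrable_of_hasCompactSupport
        ((hci i).fderiv_apply (𝕜 := ℝ) _))
  simp only [divergence, hcoord]
  rw [integral_finsetSum _ fun i _ => hint i]
  refine Finset.sum_eq_zero fun i _ => ?_
  have := integral_mul_fderiv_eq_neg_fderiv_mul_of_integrable (μ := volume)
    (f := fun _ : EuclideanSpace ℝ (Fin d) => (1 : ℝ)) (g := fun y => X y i)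
    (v := EuclideanSpace.single i (1 : ℝ)) (by simp) (by simpa using hint i)
    (by simpa using (hXi i).continuous.integrable_of_hasCompactSupport (hci i))
    (fun _ _ => differentiableAt_const _)
    (fun x _ => ((hXi i).differentiable one_ne_zero x))
  simpa using this

/-- The divergence theorem for a field which is only smooth on an open set, but vanishes outside a
compact subset of it. -/
lemma integral_divergence_eq_zero_of_isCompact {Ω K : Set (EuclideanSpace ℝ (Fin d))}
    (hK : IsCompact K) (hKΩ : K ⊆ Ω) (hX : ∀ x ∈ Ω, ContDiffAt ℝ 1 X x)
    (h0 : ∀ x, x ∉ K → X x = 0) : ∫ x, divergence X x = 0 := by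
  refine integral_divergence_eq_zero (contDiff_iff_contDiffAt.2 fun x => ?_)
    (HasCompactSupport.intro hK h0)
  by_cases hx : x ∈ K
  · exact hX x (hKΩ hx)
  · refine contDiffAt_const (c := (0 : EuclideanSpace ℝ (Fin d))) |>.congr_of_eventuallyEq ?_
    filter_upwards [hK.isClosed.isOpen_compl.mem_nhds hx] with y hy using h0 y hy

end Divergence

/-! ### Divergence-free fields on the tube and the calibrating field -/

/-- The curvature vector at the nearest point, divided by the Jacobian of the tube. -/
noncomputable def curvatureField {d : ℕ} (γ : ℝ → EuclideanSpace ℝ (Fin d))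
    (x : EuclideanSpace ℝ (Fin d)) : EuclideanSpace ℝ (Fin d) :=
  (tubeJacobian γ x)⁻¹ • deriv (deriv γ) (nearestParam γ x)

/-- The calibrating field of the tube. For a straight tube it is `v / a`; the second term corrects
the effect of the curvature and vanishes on the boundary. -/
noncomputable def calibration {d : ℕ} (γ : ℝ → EuclideanSpace ℝ (Fin d)) (a : ℝ)
    (x : EuclideanSpace ℝ (Fin d)) : EuclideanSpace ℝ (Fin d) :=
  a⁻¹ • normalPart γ x - ((a ^ 2 - ‖normalPart γ x‖ ^ 2) / (2 * a)) • curvatureField γ x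

lemma HasDerivAt.comp_hasFDerivAt_smulRight {V W : Type*} [NormedAddCommGroup V] [NormedSpace ℝ V]
    [NormedAddCommGroup W] [NormedSpace ℝ W] {c : ℝ → W} {c' : W} {g : V → ℝ} {g' : V →L[ℝ] ℝ}
    {x : V} (hc : HasDerivAt c c' (g x)) (hg : HasFDerivAt g g' x) :
    HasFDerivAt (fun y => c (g y)) (g'.smulRight c') x :=
  (hc.hasFDerivAt.comp x hg).congr_fderiv (by ext; simp)

namespace IsTubeAxis

variable {d : ℕ} {γ : ℝ → EuclideanSpace ℝ (Fin d)} {a : ℝ} {x : EuclideanSpace ℝ (Fin d)}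

/-- A point near which the parameter is continuously differentiable and the Jacobian is nonzero. -/
def IsRegularPoint (γ : ℝ → EuclideanSpace ℝ (Fin d)) (x : EuclideanSpace ℝ (Fin d)) : Prop :=
  ContDiffAt ℝ 1 (nearestParam γ) x ∧ tubeJacobian γ x ≠ 0

lemma isRegularPoint_of_mem (h : IsTubeAxis γ a) (hx : x ∈ tube γ a) : IsRegularPoint γ x :=
  ⟨h.contDiffAt_nearestParam_of_mem hx, (h.tubeJacobian_pos hx).ne'⟩

lemma contDiff_deriv (h : IsTubeAxis γ a) : ContDiff ℝ ∞ (deriv γ) :=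
  IsUnboundedCompleteCurve.contDiff_deriv h.smooth

lemma contDiff_deriv_deriv (h : IsTubeAxis γ a) : ContDiff ℝ ∞ (deriv (deriv γ)) :=
  IsUnboundedCompleteCurve.contDiff_deriv h.contDiff_deriv

lemma contDiffAt_comp_nearestParam {V : Type*} [NormedAddCommGroup V] [NormedSpace ℝ V]
    {c : ℝ → V} (hc : ContDiff ℝ 1 c) (hx : ContDiffAt ℝ 1 (nearestParam γ) x) :
    ContDiffAt ℝ 1 (fun y => c (nearestParam γ y)) x :=
  hc.contDiffAt.comp x hx

lemma contDiffAt_normalPart (h : IsTubeAxis γ a) (hx : ContDiffAt ℝ 1 (nearestParam γ) x) :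
    ContDiffAt ℝ 1 (normalPart γ) x :=
  contDiffAt_id.sub (contDiffAt_comp_nearestParam (h.smooth.of_le (by simp)) hx)

lemma contDiffAt_curvature (h : IsTubeAxis γ a) (hx : ContDiffAt ℝ 1 (nearestParam γ) x) :
    ContDiffAt ℝ 1 (fun y => deriv (deriv γ) (nearestParam γ y)) x :=
  contDiffAt_comp_nearestParam (h.contDiff_deriv_deriv.of_le (by simp)) hx

lemma contDiffAt_tubeJacobian (h : IsTubeAxis γ a) (hx : ContDiffAt ℝ 1 (nearestParam γ) x) :
    ContDiffAt ℝ 1 (tubeJacobian γ) x :=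
  contDiffAt_const.sub ((h.contDiffAt_curvature hx).inner ℝ (h.contDiffAt_normalPart hx))

lemma contDiffAt_curvatureField (h : IsTubeAxis γ a) (hx : IsRegularPoint γ x) :
    ContDiffAt ℝ 1 (curvatureField γ) x :=
  ((h.contDiffAt_tubeJacobian hx.1).inv hx.2).smul (h.contDiffAt_curvature hx.1)

lemma contDiffAt_calibration (h : IsTubeAxis γ a) (hx : IsRegularPoint γ x) :
    ContDiffAt ℝ 1 (calibration γ a) x := by
  have h1 := h.contDiffAt_normalPart hx.1
  have h2 := h.contDiffAt_curvatureField hx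
  have h3 := h1.norm_sq ℝ
  unfold calibration
  fun_prop

lemma isOpen_setOf_isRegularPoint (h : IsTubeAxis γ a) : IsOpen {x | IsRegularPoint γ x} := by
  rw [isOpen_iff_mem_nhds]
  intro x hx
  have h1 := hx.1.eventually (by simp)
  have h2 := (h.contDiffAt_tubeJacobian hx.1).continuousAt.eventually_ne hx.2
  filter_upwards [h1, h2] with y hy1 hy2 using ⟨hy1, hy2⟩

/-- The gradient of the parameter is the tangent divided by the Jacobian. -/
lemma hasFDerivAt_nearestParam (h : IsTubeAxis γ a) (hx : IsRegularPoint γ x) :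
    HasFDerivAt (nearestParam γ)
      ((tubeJacobian γ x)⁻¹ • innerSL ℝ (deriv γ (nearestParam γ x))) x := by
  have hL := (hx.1.differentiableAt one_ne_zero).hasFDerivAt
  set L := fderiv ℝ (nearestParam γ) x
  refine hL.congr_fderiv ?_
  have h1 : HasFDerivAt (fun y => y - γ (nearestParam γ y)) _ x :=
    (hasFDerivAt_id x).sub ((h.hasDerivAt (nearestParam γ x)).hasFDerivAt.comp x hL)
  have h2 : HasFDerivAt (fun y => deriv γ (nearestParam γ y)) _ x :=
    (h.hasDerivAt_deriv (nearestParam γ x)).hasFDerivAt.comp x hL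
  have h3 := h1.inner ℝ h2
  have h4 : (fun y => inner ℝ (y - γ (nearestParam γ y)) (deriv γ (nearestParam γ y)))
      = fun _ => (0 : ℝ) := funext fun y => h.inner_normalPart y
  rw [h4] at h3
  have h5 := h3.unique (hasFDerivAt_const (0 : ℝ) x)
  ext w
  have h6 := DFunLike.congr_fun h5 w
  simp [fderivInnerCLM_apply, inner_sub_left, inner_smul_left, inner_smul_right,
    h.unit_speed] at h6
  have h7 := hx.2
  have h8 : inner ℝ (deriv γ (nearestParam γ x)) w = tubeJacobian γ x * L w := by
    rw [tubeJacobian, normalPart, real_inner_comm w, real_inner_comm (x - γ (nearestParam γ x)),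
      inner_sub_left]
    linarith
  simp [h8, h7]

lemma hasFDerivAt_comp_nearestParam (h : IsTubeAxis γ a) (hx : IsRegularPoint γ x) {α : ℝ → ℝ}
    {α' : ℝ} (hα : HasDerivAt α α' (nearestParam γ x)) :
    HasFDerivAt (fun y => α (nearestParam γ y))
      ((α' * (tubeJacobian γ x)⁻¹) • innerSL ℝ (deriv γ (nearestParam γ x))) x := by
  rw [mul_smul]
  exact hα.comp_hasFDerivAt x (h.hasFDerivAt_nearestParam hx)

lemma hasFDerivAt_normalPart (h : IsTubeAxis γ a) (hx : IsRegularPoint γ x) :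
    HasFDerivAt (normalPart γ) (ContinuousLinearMap.id ℝ _ -
      ((tubeJacobian γ x)⁻¹ • innerSL ℝ (deriv γ (nearestParam γ x))).smulRight
        (deriv γ (nearestParam γ x))) x :=
  (hasFDerivAt_id x).sub
    ((h.hasDerivAt (nearestParam γ x)).comp_hasFDerivAt_smulRight (h.hasFDerivAt_nearestParam hx))

lemma hasFDerivAt_norm_sq (h : IsTubeAxis γ a) (hx : IsRegularPoint γ x) :
    HasFDerivAt (fun y => ‖normalPart γ y‖ ^ 2) ((2 : ℝ) • innerSL ℝ (normalPart γ x)) x := by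
  refine (h.hasFDerivAt_normalPart hx).norm_sq.congr_fderiv ?_
  ext w
  simp [h.inner_normalPart]

lemma hasFDerivAt_comp_norm_sq (h : IsTubeAxis γ a) (hx : IsRegularPoint γ x) {β : ℝ → ℝ}
    {β' : ℝ} (hβ : HasDerivAt β β' (‖normalPart γ x‖ ^ 2)) :
    HasFDerivAt (fun y => β (‖normalPart γ y‖ ^ 2))
      ((β' * 2) • innerSL ℝ (normalPart γ x)) x := by
  rw [mul_smul]
  exact hβ.comp_hasFDerivAt x (h.hasFDerivAt_norm_sq hx)

lemma divergence_tangent (h : IsTubeAxis γ a) (hx : IsRegularPoint γ x) :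
    divergence (fun y => deriv γ (nearestParam γ y)) x = 0 := by
  rw [divergence_comp (h.hasFDerivAt_nearestParam hx) (h.hasDerivAt_deriv _)]
  simp [h.inner_deriv_deriv]

lemma divergence_normalPart (h : IsTubeAxis γ a) (hx : IsRegularPoint γ x) :
    divergence (normalPart γ) x = d - (tubeJacobian γ x)⁻¹ := by
  have hσ := h.hasFDerivAt_nearestParam hx
  change divergence (fun y => y - γ (nearestParam γ y)) x = _
  rw [divergence_sub differentiableAt_fun_id
    ((h.hasDerivAt _).comp_hasFDerivAt_smulRight hσ).differentiableAt,
    divergence_id, divergence_comp hσ (h.hasDerivAt _)]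
  simp [h.unit_speed]

lemma divergence_curvatureField (h : IsTubeAxis γ a) (hx : IsRegularPoint γ x) :
    divergence (curvatureField γ) x = 0 := by
  have hσ := h.hasFDerivAt_nearestParam hx
  have hκ : HasDerivAt (deriv (deriv γ)) (deriv (deriv (deriv γ)) (nearestParam γ x))
      (nearestParam γ x) := IsUnboundedCompleteCurve.hasDerivAt h.contDiff_deriv_deriv _
  have hf := (hκ.comp_hasFDerivAt_smulRight hσ).inner ℝ (h.hasFDerivAt_normalPart hx)
  have hf' : HasFDerivAt (tubeJacobian γ) _ x := hf.const_sub 1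
  have hinv : HasFDerivAt (fun y => (tubeJacobian γ y)⁻¹) _ x :=
    (hasDerivAt_inv hx.2).comp_hasFDerivAt x hf'
  have hTκ := h.inner_deriv_deriv (nearestParam γ x)
  have hT3 : inner ℝ (deriv γ (nearestParam γ x)) (deriv (deriv (deriv γ)) (nearestParam γ x))
      = - ‖deriv (deriv γ) (nearestParam γ x)‖ ^ 2 := by
    have := inner_deriv_of_inner_eq_zero hκ (h.hasDerivAt_deriv _)
      (fun s => by rw [real_inner_comm]; exact h.inner_deriv_deriv s)
    rw [real_inner_comm, this, real_inner_self_eq_norm_sq]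
  change divergence (fun y => (tubeJacobian γ y)⁻¹ • deriv (deriv γ) (nearestParam γ y)) x = 0
  rw [divergence_smul hinv (hκ.comp_hasFDerivAt_smulRight hσ).differentiableAt, divergence_comp hσ hκ]
  have h7 := hx.2
  simp [fderivInnerCLM_apply, hTκ, hT3]
  field_simp
  ring

lemma inner_tangent_curvatureField (h : IsTubeAxis γ a) :
    inner ℝ (deriv γ (nearestParam γ x)) (curvatureField γ x) = 0 := by
  rw [curvatureField, inner_smul_right, h.inner_deriv_deriv, mul_zero]

lemma inner_normalPart_curvatureField (hx : tubeJacobian γ x ≠ 0) :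
    inner ℝ (normalPart γ x) (curvatureField γ x) = (tubeJacobian γ x)⁻¹ - 1 := by
  have : inner ℝ (normalPart γ x) (deriv (deriv γ) (nearestParam γ x)) = 1 - tubeJacobian γ x := by
    rw [tubeJacobian, real_inner_comm]; ring
  rw [curvatureField, inner_smul_right, this]
  field_simp

lemma divergence_calibration (h : IsTubeAxis γ a) (hx : IsRegularPoint γ x) :
    divergence (calibration γ a) x = (d - 1) / a := by
  have ha := h.pos.ne'
  have hv := (h.hasFDerivAt_normalPart hx).differentiableAt
  have hk := (h.contDiffAt_curvatureField hx).differentiableAt one_ne_zero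
  have hg : HasFDerivAt (fun y => (a ^ 2 - ‖normalPart γ y‖ ^ 2) / (2 * a))
      (-(2 * a)⁻¹ • (2 : ℝ) • innerSL ℝ (normalPart γ x)) x := by
    have h1 : HasDerivAt (fun t : ℝ => (a ^ 2 - t) / (2 * a)) (-(2 * a)⁻¹)
        (‖normalPart γ x‖ ^ 2) :=
      (((hasDerivAt_id _).const_sub (a ^ 2)).div_const (2 * a)).congr_deriv (by
        rw [neg_div, one_div])
    exact h1.comp_hasFDerivAt x (h.hasFDerivAt_norm_sq hx)
  change divergence (fun y => a⁻¹ • normalPart γ y -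
    ((a ^ 2 - ‖normalPart γ y‖ ^ 2) / (2 * a)) • curvatureField γ y) x = _
  rw [divergence_sub (hv.fun_const_smul a⁻¹) (hg.differentiableAt.fun_smul hk),
    divergence_const_smul _ hv, divergence_smul hg hk, h.divergence_normalPart hx,
    h.divergence_curvatureField hx]
  simp [inner_normalPart_curvatureField hx.2]
  field_simp
  ring

/-- The pointwise inequality behind `norm_calibration_lt`, with `p = ⟪k, u⟫` for the rescaled
curvature vector `k` and position `u` in the normal disc, `r = ‖u‖` and `K = ‖k‖²`. -/
lemma sq_norm_calibration_aux {r p K : ℝ} (hr0 : 0 ≤ r) (hr : r < 1) (hp : p ≤ r) (hK : K ≤ 1) :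
    r ^ 2 - (1 - r ^ 2) / (1 - p) * p + ((1 - r ^ 2) / (2 * (1 - p))) ^ 2 * K < 1 := by
  have h1 : 0 < 1 - p := by linarith
  have h2 : 0 < 1 - r ^ 2 := by nlinarith
  have h3 : 0 < 4 * (1 - p) - (1 - r ^ 2) * K := by
    have : (1 - r ^ 2) * K ≤ (1 - r ^ 2) * 1 := by gcongr
    nlinarith
  have key : 1 - (r ^ 2 - (1 - r ^ 2) / (1 - p) * p + ((1 - r ^ 2) / (2 * (1 - p))) ^ 2 * K)
      = (1 - r ^ 2) / (4 * (1 - p) ^ 2) * (4 * (1 - p) - (1 - r ^ 2) * K) := by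
    field_simp
    ring
  have : 0 < (1 - r ^ 2) / (4 * (1 - p) ^ 2) * (4 * (1 - p) - (1 - r ^ 2) * K) := by positivity
  linarith

/-- The calibrating field is shorter than one everywhere in the open tube. -/
lemma norm_calibration_lt (h : IsTubeAxis γ a) (hx : x ∈ tube γ a) :
    ‖calibration γ a x‖ < 1 := by
  have ha := h.pos
  have hf := h.tubeJacobian_pos hx
  have hv := h.mem_tube_iff.1 hx
  set v := normalPart γ x with hvdef
  set k := deriv (deriv γ) (nearestParam γ x) with hk
  obtain ⟨p, hp⟩ : ∃ p, p = inner ℝ k v := ⟨_, rfl⟩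
  have hfp : tubeJacobian γ x = 1 - p := by rw [hp]; rfl
  have hpr : p ≤ ‖v‖ / a := by rw [hp]; exact h.inner_curvature_le _ _
  have hK : (a * ‖k‖) ^ 2 ≤ 1 := by
    have := h.curvature_le (nearestParam γ x)
    have h0 : 0 ≤ a * ‖k‖ := by positivity
    rw [← hk] at this
    nlinarith
  have hr : ‖v‖ / a < 1 := (div_lt_one ha).2 hv
  have hmain := sq_norm_calibration_aux (div_nonneg (norm_nonneg v) ha.le) hr hpr hK
  have hcal : calibration γ a x = a⁻¹ • v - ((a ^ 2 - ‖v‖ ^ 2) / (2 * a) * (1 - p)⁻¹) • k := by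
    rw [calibration, curvatureField, hfp, smul_smul]
  have hsq : ‖calibration γ a x‖ ^ 2 < 1 := by
    rw [hcal, norm_sub_sq_real, inner_smul_left, inner_smul_right, real_inner_comm, ← hp,
      norm_smul, norm_smul, mul_pow, mul_pow, Real.norm_eq_abs, Real.norm_eq_abs, sq_abs, sq_abs]
    have hp1 : 0 < 1 - p := hfp ▸ hf
    refine lt_of_eq_of_lt ?_ hmain
    simp only [conj_trivial]
    field_simp
  exact (sq_lt_one_iff₀ (norm_nonneg _)).1 hsq

end IsTubeAxis

/-! ### The Gauss-Green inequality up to a negligible closed set -/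

section GaussGreen

/-- A compact set of vanishing `m`-dimensional Hausdorff measure is covered by finitely many balls
of radius at most one with small total `m`-th power of the radii. -/
lemma exists_finite_ball_cover {V : Type*} [NormedAddCommGroup V] [MeasurableSpace V]
    [BorelSpace V] {K : Set V} (hK : IsCompact K) {m : ℕ} (hm : 1 ≤ m)
    (h0 : Measure.hausdorffMeasure (m : ℝ) K = 0) {ε : ℝ} (hε : 0 < ε) :
    ∃ (F : Finset ℕ) (c : ℕ → V) (r : ℕ → ℝ), (∀ i, 0 < r i ∧ r i ≤ 1) ∧
      K ⊆ ⋃ i ∈ F, Metric.ball (c i) (r i) ∧ ∑ i ∈ F, r i ^ m ≤ ε := by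
  classical
  set ε' : ℝ := ε / 2 ^ m with hε'
  have hε0 : 0 < ε' := by positivity
  rw [Measure.hausdorffMeasure_apply] at h0
  have h1 := le_of_eq h0
  rw [iSup₂_le_iff] at h1
  have h2 := lt_of_le_of_lt (h1 2⁻¹ (by simp)) (ENNReal.ofReal_pos.2 hε0)
  obtain ⟨t, ht⟩ := iInf_lt_iff.1 h2
  obtain ⟨hKt, ht⟩ := iInf_lt_iff.1 ht
  obtain ⟨htd, ht⟩ := iInf_lt_iff.1 ht
  set D : ℕ → ℝ≥0∞ := fun n => ⨆ (_ : (t n).Nonempty), Metric.ediam (t n) ^ (m : ℝ) with hD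
  let η : ℕ → ℝ := fun n => min (1 / 2) (ε' / 2 / 2 ^ n)
  have hη0 : ∀ n, 0 < η n := fun n => by positivity
  have hη1 : ∀ n, η n ≤ 1 / 2 := fun n => min_le_left _ _
  have hη2 : ∀ F : Finset ℕ, ∑ n ∈ F, η n ≤ ε' := by
    intro F
    refine (Finset.sum_le_sum fun n _ => min_le_right _ _).trans ?_
    refine (Summable.sum_le_tsum F (fun n _ => by positivity) (summable_geometric_two' ε')).trans ?_
    rw [tsum_geometric_two']
  let c : ℕ → V := fun n => if h : (t n).Nonempty then h.some else 0
  let r : ℕ → ℝ := fun n => (if (t n).Nonempty then (Metric.ediam (t n)).toReal else 0) + η n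
  have htop : ∀ n, Metric.ediam (t n) ≠ ⊤ := fun n => ne_top_of_le_ne_top (by simp) (htd n)
  have hdr : ∀ n, (Metric.ediam (t n)).toReal ≤ 1 / 2 := by
    intro n
    have := ENNReal.toReal_mono (by simp) (htd n)
    simpa using this
  have hr0 : ∀ n, 0 < r n := fun n => by
    have := hη0 n
    dsimp only [r]
    split_ifs <;> positivity
  have hr1 : ∀ n, r n ≤ 1 := fun n => by
    have := hη1 n
    have := hdr n
    dsimp only [r]
    split_ifs <;> linarith
  have hball : ∀ n, t n ⊆ Metric.ball (c n) (r n) := by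
    intro n y hy
    have hne : (t n).Nonempty := ⟨y, hy⟩
    have hc : c n ∈ t n := by simp only [c, dif_pos hne]; exact hne.some_mem
    rw [Metric.mem_ball, dist_edist]
    have h3 := ENNReal.toReal_mono (htop n) (Metric.edist_le_ediam_of_mem hy hc)
    simp only [r, if_pos hne]
    linarith [hη0 n]
  obtain ⟨F, hF⟩ := hK.elim_finite_subcover (fun n => Metric.ball (c n) (r n))
    (fun n => Metric.isOpen_ball) (hKt.trans (iUnion_mono hball))
  refine ⟨F, c, r, fun i => ⟨hr0 i, hr1 i⟩, hF, ?_⟩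
  have hDtop : ∀ n, D n ≠ ⊤ := fun n => by
    refine ne_top_of_le_ne_top ?_ (ENNReal.le_tsum n)
    exact ne_top_of_lt ht
  have hsum : ∑ n ∈ F, (D n).toReal ≤ ε' := by
    rw [← ENNReal.toReal_sum fun n _ => hDtop n]
    refine ENNReal.toReal_le_of_le_ofReal hε0.le ?_
    exact (ENNReal.sum_le_tsum F).trans ht.le
  have hterm : ∀ n, r n ^ m ≤ 2 ^ (m - 1) * ((D n).toReal + η n) := by
    intro n
    refine (add_pow_le (by split_ifs <;> positivity) (hη0 n).le m).trans ?_
    have e1 : η n ^ m ≤ η n := pow_le_of_le_one (hη0 n).le ((hη1 n).trans (by norm_num)) (by omega)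
    have e2 : (if (t n).Nonempty then (Metric.ediam (t n)).toReal else 0) ^ m ≤ (D n).toReal := by
      split_ifs with hne
      · simp [hD, hne]
      · rw [zero_pow (by omega)]; positivity
    gcongr
  refine (Finset.sum_le_sum fun n _ => hterm n).trans ?_
  rw [← Finset.mul_sum, Finset.sum_add_distrib]
  calc (2 : ℝ) ^ (m - 1) * (∑ n ∈ F, (D n).toReal + ∑ n ∈ F, η n)
      ≤ 2 ^ (m - 1) * (ε' + ε') := by gcongr; exact hη2 F
    _ = ε := by
      obtain ⟨k, rfl⟩ : ∃ k, m = k + 1 := ⟨m - 1, by omega⟩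
      rw [hε', Nat.add_sub_cancel, pow_succ]
      field_simp
      ring

variable {d : ℕ}

lemma integrable_cutoff {η : EuclideanSpace ℝ (Fin d) → ℝ} (h1 : ContDiff ℝ 1 η)
    (h2 : HasCompactSupport (fun x => 1 - η x)) :
    Integrable (fun x => 1 - η x) volume ∧ Integrable (fun x => ‖fderiv ℝ η x‖) volume := by
  have h1' : ContDiff ℝ 1 (fun x => 1 - η x) := contDiff_const.sub h1
  refine ⟨h1'.continuous.integrable_of_hasCompactSupport h2, ?_⟩
  have := ((h1'.continuous_fderiv one_ne_zero).integrable_of_hasCompactSupport (μ := volume)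
    (h2.fderiv (𝕜 := ℝ))).norm
  simpa only [fderiv_const_sub, norm_neg] using this

/-- Cutoff functions vanishing on a given finite union of balls: both the integral of the gradient
and the measure of the modification are controlled by the sum of the `(d - 1)`-th powers of the
radii. -/
lemma exists_cutoff {m : ℕ} (hd : d = m + 1) : ∃ C : ℝ, 0 ≤ C ∧
    ∀ (F : Finset ℕ) (c : ℕ → EuclideanSpace ℝ (Fin d)) (r : ℕ → ℝ),
      (∀ i, 0 < r i ∧ r i ≤ 1) → ∃ η : EuclideanSpace ℝ (Fin d) → ℝ, ContDiff ℝ 1 η ∧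
        (∀ x, 0 ≤ η x ∧ η x ≤ 1) ∧ (∀ i ∈ F, ∀ x ∈ Metric.ball (c i) (r i), η x = 0) ∧
        HasCompactSupport (fun x => 1 - η x) ∧ ∫ x, (1 - η x) ≤ C * ∑ i ∈ F, r i ^ m ∧
        ∫ x, ‖fderiv ℝ η x‖ ≤ C * ∑ i ∈ F, r i ^ m := by
  classical
  have hpow : ∀ t : ℝ, t ^ d = t ^ m * t := fun t => by rw [hd, pow_succ]
  let φ : ContDiffBump (0 : EuclideanSpace ℝ (Fin d)) := ⟨1, 2, one_pos, one_lt_two⟩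
  have hφ : ContDiff ℝ 1 φ := φ.contDiff
  set C := (∫ x, φ x) + ∫ x, ‖fderiv ℝ φ x‖ with hC
  have hC1 : 0 ≤ ∫ x, φ x := integral_nonneg fun _ => φ.nonneg
  have hC2 : 0 ≤ ∫ x, ‖fderiv ℝ φ x‖ := integral_nonneg fun _ => norm_nonneg _
  refine ⟨C, by positivity, fun F c r hr => ?_⟩
  -- the rescaled bump functions
  let b : ℕ → EuclideanSpace ℝ (Fin d) → ℝ := fun i x => φ ((r i)⁻¹ • (x - c i))
  have hb : ∀ i, ContDiff ℝ 1 (b i) := fun i =>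
    hφ.comp (g := φ) (show ContDiff ℝ 1 fun x => (r i)⁻¹ • (x - c i) by fun_prop)
  have hbc : ∀ i, HasCompactSupport (b i) := by
    intro i
    refine HasCompactSupport.intro (isCompact_closedBall (c i) (2 * r i)) fun x hx => ?_
    refine φ.zero_of_le_dist ?_
    rw [dist_zero_right, norm_smul, norm_inv, Real.norm_of_nonneg (hr i).1.le]
    rw [Metric.mem_closedBall, not_le, dist_eq_norm] at hx
    rw [inv_mul_eq_div, le_div_iff₀ (hr i).1]
    exact hx.le
  have hb1 : ∀ i, ∫ x, b i x ≤ C * r i ^ m := by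
    intro i
    have h1 : ∫ x, b i x = r i ^ d * ∫ x, φ x := by
      have := integral_sub_right_eq_self (μ := volume) (fun x => φ ((r i)⁻¹ • x)) (c i)
      simp only [b]
      rw [this, Measure.integral_comp_inv_smul]
      simp [abs_of_pos (hr i).1]
    rw [h1, hpow]
    have h2 : r i ^ m * r i ≤ r i ^ m * 1 := by
      have := (hr i).1; gcongr; exact (hr i).2
    have : 0 < r i := (hr i).1
    calc r i ^ m * r i * ∫ x, φ x ≤ r i ^ m * 1 * C := by
          apply mul_le_mul h2 (by linarith) hC1 (by positivity)
      _ = C * r i ^ m := by ring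
  have hb2 : ∀ i, ∫ x, ‖fderiv ℝ (b i) x‖ ≤ C * r i ^ m := by
    intro i
    have hri := (hr i).1
    have h0 : ∀ x, ‖fderiv ℝ (b i) x‖ = (r i)⁻¹ * ‖fderiv ℝ φ ((r i)⁻¹ • (x - c i))‖ := by
      intro x
      have e1 : HasFDerivAt (fun y => (r i)⁻¹ • (y - c i))
          ((r i)⁻¹ • ContinuousLinearMap.id ℝ (EuclideanSpace ℝ (Fin d))) x :=
        ((hasFDerivAt_id x).sub_const (c i)).fun_const_smul _
      have e2 := ((hφ.differentiable one_ne_zero ((r i)⁻¹ • (x - c i))).hasFDerivAt.comp x e1).fderiv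
      change fderiv ℝ (b i) x = _ at e2
      rw [e2, ContinuousLinearMap.comp_smul, ContinuousLinearMap.comp_id, norm_smul, norm_inv,
        Real.norm_of_nonneg hri.le]
    have h1 : ∫ x, ‖fderiv ℝ (b i) x‖ = r i ^ m * ∫ x, ‖fderiv ℝ φ x‖ := by
      have := integral_sub_right_eq_self (μ := volume)
        (fun x => ‖fderiv ℝ φ ((r i)⁻¹ • x)‖) (c i)
      simp only [h0]
      rw [integral_const_mul, this,
        Measure.integral_comp_inv_smul (μ := volume) (fun x => ‖fderiv ℝ φ x‖)]
      simp only [finrank_euclideanSpace_fin, smul_eq_mul]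
      rw [abs_of_pos (by positivity), ← mul_assoc, hpow]
      congr 1
      field_simp
    rw [h1, mul_comm]
    gcongr
    linarith
  induction F using Finset.induction_on with
  | empty => exact ⟨fun _ => 1, contDiff_const, by simp, by simp, 
      HasCompactSupport.intro isCompact_empty fun _ _ => sub_self _, by simp, by simp⟩
  | insert i F hi ih =>
    obtain ⟨η, h1, h2, h3, h4, h5, h6⟩ := ih
    have hb01 : ∀ x, 0 ≤ b i x ∧ b i x ≤ 1 := fun x => ⟨φ.nonneg, φ.le_one⟩
    have hsplit : ∀ x, 1 - η x * (1 - b i x) = (1 - η x) + η x * b i x := fun x => by ring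
    have hηb : ContDiff ℝ 1 (fun x => η x * b i x) := h1.mul (hb i)
    have hηbc : HasCompactSupport (fun x => η x * b i x) := (hbc i).mul_left
    obtain ⟨i1, i3⟩ := integrable_cutoff h1 h4
    have i2 : Integrable (b i) := (hb i).continuous.integrable_of_hasCompactSupport (hbc i)
    have i4 : Integrable (fun x => ‖fderiv ℝ (b i) x‖) :=
      (((hb i).continuous_fderiv one_ne_zero).integrable_of_hasCompactSupport
        ((hbc i).fderiv (𝕜 := ℝ))).norm
    refine ⟨fun x => η x * (1 - b i x), h1.mul (contDiff_const.sub (hb i)), fun x => ?_, ?_, ?_, ?_,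
      ?_⟩
    · have := h2 x
      have := hb01 x
      exact ⟨mul_nonneg (h2 x).1 (by linarith), mul_le_one₀ (h2 x).2 (by linarith) (by linarith)⟩
    · intro j hj x hx
      rcases Finset.mem_insert.1 hj with rfl | hj
      · have : b j x = 1 := by
          refine φ.one_of_mem_closedBall ?_
          rw [mem_closedBall_zero_iff, norm_smul, norm_inv, Real.norm_of_nonneg (hr j).1.le,
            inv_mul_eq_div, div_le_iff₀ (hr j).1]
          rw [Metric.mem_ball, dist_eq_norm] at hx
          linarith
        simp [this]
      · simp [h3 j hj x hx]
    · simp only [hsplit]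
      exact h4.add hηbc
    · rw [Finset.sum_insert hi, mul_add]
      calc ∫ x, (1 - η x * (1 - b i x)) ≤ ∫ x, ((1 - η x) + b i x) := by
            refine integral_mono_of_nonneg (Eventually.of_forall fun x => ?_) (i1.add i2)
              (Eventually.of_forall fun x => ?_)
            · simp only [hsplit, Pi.zero_apply]
              have := h2 x
              exact add_nonneg (by linarith) (mul_nonneg (h2 x).1 (hb01 x).1)
            · simp only [hsplit]
              have : η x * b i x ≤ 1 * b i x := mul_le_mul_of_nonneg_right (h2 x).2 (hb01 x).1
              linarith
        _ = (∫ x, (1 - η x)) + ∫ x, b i x := integral_add i1 i2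
        _ ≤ _ := by linarith [hb1 i]
    · rw [Finset.sum_insert hi, mul_add]
      calc ∫ x, ‖fderiv ℝ (fun x => η x * (1 - b i x)) x‖
          ≤ ∫ x, (‖fderiv ℝ η x‖ + ‖fderiv ℝ (b i) x‖) := by
            refine integral_mono_of_nonneg (Eventually.of_forall fun x => norm_nonneg _)
              (i3.add i4) (Eventually.of_forall fun x => ?_)
            have e1 := h1.differentiable one_ne_zero x
            have e2 := (hb i).differentiable one_ne_zero x
            simp only
            rw [fderiv_fun_mul e1 (e2.const_sub 1), fderiv_const_sub, smul_neg]
            refine (norm_add_le _ _).trans ?_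
            rw [norm_neg, norm_smul, norm_smul, Real.norm_of_nonneg (h2 x).1,
              Real.norm_of_nonneg (by linarith [(hb01 x).2])]
            have f1 : η x * ‖fderiv ℝ (b i) x‖ ≤ 1 * ‖fderiv ℝ (b i) x‖ :=
              mul_le_mul_of_nonneg_right (h2 x).2 (norm_nonneg _)
            have f2 : (1 - b i x) * ‖fderiv ℝ η x‖ ≤ 1 * ‖fderiv ℝ η x‖ :=
              mul_le_mul_of_nonneg_right (by linarith [(hb01 x).1]) (norm_nonneg _)
            linarith
        _ = (∫ x, ‖fderiv ℝ η x‖) + ∫ x, ‖fderiv ℝ (b i) x‖ := integral_add i3 i4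
        _ ≤ _ := by linarith [hb2 i]

lemma ofReal_setIntegral_divergence_le_perimeter
    {X : EuclideanSpace ℝ (Fin d) → EuclideanSpace ℝ (Fin d)} (S : Set (EuclideanSpace ℝ (Fin d)))
    (hX : ContDiff ℝ 1 X) (hc : HasCompactSupport X) (h1 : ∀ x, ‖X x‖ ≤ 1) :
    ENNReal.ofReal (∫ x in S, divergence X x) ≤ perimeter S := by
  unfold perimeter
  exact le_iSup_of_le X (le_iSup_of_le hX (le_iSup_of_le hc (le_iSup_of_le h1 le_rfl)))

/-- A compact set in an open set has a smooth cutoff function. -/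
lemma exists_smooth_cutoff {A O : Set (EuclideanSpace ℝ (Fin d))} (hA : IsCompact A)
    (hO : IsOpen O) (hAO : A ⊆ O) : ∃ ψ : EuclideanSpace ℝ (Fin d) → ℝ, ContDiff ℝ 1 ψ ∧
      (∀ x, 0 ≤ ψ x ∧ ψ x ≤ 1) ∧ HasCompactSupport ψ ∧ tsupport ψ ⊆ O ∧
      ∀ x ∈ A, ψ =ᶠ[𝓝 x] fun _ => 1 := by
  obtain ⟨δ, hδ, hδO⟩ := hA.exists_cthickening_subset_open hO hAO
  obtain ⟨ψ, h1, h2, h3⟩ := exists_contMDiffMap_one_nhds_of_subset_interior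
    (modelWithCornersSelf ℝ (EuclideanSpace ℝ (Fin d))) (n := 1) hA.isClosed
    (t := Metric.cthickening δ A) ((Metric.self_subset_thickening hδ A).trans
      (interior_maximal (Metric.thickening_subset_cthickening δ A) Metric.isOpen_thickening))
  have hc : IsCompact (Metric.cthickening δ A) := hA.cthickening
  refine ⟨ψ, ψ.contMDiff.contDiff, fun x => h3 x, HasCompactSupport.intro hc h2, ?_, fun x hx => ?_⟩
  · refine (closure_minimal (fun x hx => ?_) hc.isClosed).trans hδO
    by_contra h
    exact hx (h2 x h)
  · exact (eventually_nhdsSet_iff_forall.1 h1) x hx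

/-- The Gauss-Green inequality `∫_S div Y ≤ P(S)` for a field of length at most one on an open set
`Ω ⊇ S` which is continuously differentiable up to the boundary except for a closed set of vanishing
`(d - 1)`-dimensional measure. -/
theorem setIntegral_divergence_le_perimeter {m : ℕ} (hm : 1 ≤ m) (hd : d = m + 1)
    {Ω B S : Set (EuclideanSpace ℝ (Fin d))}
    {Y : EuclideanSpace ℝ (Fin d) → EuclideanSpace ℝ (Fin d)} (hB : IsClosed B)
    (hB0 : Measure.hausdorffMeasure (m : ℝ) B = 0)
    (hY : ∀ x ∈ closure Ω, x ∉ B → ContDiffAt ℝ 1 Y x) (hY1 : ∀ x ∈ Ω, ‖Y x‖ ≤ 1)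
    (hΩB : Disjoint Ω B) (hS : S ⊆ Ω) (hSm : MeasurableSet S) (hSb : Bornology.IsBounded S)
    (hint : IntegrableOn (divergence Y) S) {C : ℝ} (hC : ∀ x ∈ S, divergence Y x ≤ C) :
    ENNReal.ofReal (∫ x in S, divergence Y x) ≤ perimeter S := by
  rcases eq_or_ne (perimeter S) ⊤ with htop | htop
  · rw [htop]; exact le_top
  set P := (perimeter S).toReal with hP
  refine ENNReal.ofReal_le_of_le_toReal ?_
  obtain ⟨C₀, hC0, hcut⟩ := exists_cutoff hd
  have key : ∀ ε > 0, ∫ x in S, divergence Y x ≤ (1 + ε) * P + (|C| + 1) * (C₀ * ε) := by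
    intro ε hε
    have hKc : IsCompact (closure S) := hSb.isCompact_closure
    have hKB : IsCompact (closure S ∩ B) := hKc.inter_right hB
    obtain ⟨F, c, r, hr, hcov, hsum⟩ := exists_finite_ball_cover hKB hm
      (measure_mono_null inter_subset_right hB0) hε
    obtain ⟨η, h1, h2, h3, h4, h5, h6⟩ := hcut F c r hr
    have h5' : ∫ x, (1 - η x) ≤ C₀ * ε := h5.trans (by gcongr)
    have h6' : ∫ x, ‖fderiv ℝ η x‖ ≤ C₀ * ε := h6.trans (by gcongr)
    set A := closure S ∩ tsupport η with hA
    have hAc : IsCompact A := hKc.inter_right (isClosed_tsupport η)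
    have hAB : ∀ x ∈ A, x ∉ B := by
      intro x hx hxB
      obtain ⟨i, hi, hxi⟩ := mem_iUnion₂.1 (hcov ⟨hx.1, hxB⟩)
      refine (notMem_tsupport_iff_eventuallyEq.2 ?_) hx.2
      filter_upwards [Metric.isOpen_ball.mem_nhds hxi] with y hy using h3 i hi y hy
    let O : Set (EuclideanSpace ℝ (Fin d)) := {y | ContDiffAt ℝ 1 Y y ∧ ‖Y y‖ < 1 + ε}
    have hO : IsOpen O := by
      rw [isOpen_iff_mem_nhds]
      intro x hx
      filter_upwards [hx.1.eventually (by simp),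
        hx.1.continuousAt.norm.eventually (gt_mem_nhds hx.2)] with y hy1 hy2 using ⟨hy1, hy2⟩
    have hAO : A ⊆ O := by
      intro x hx
      have hxΩ : x ∈ closure Ω := closure_mono hS hx.1
      have hYx := hY x hxΩ (hAB x hx)
      refine ⟨hYx, lt_of_le_of_lt ?_ (show (1 : ℝ) < 1 + ε by linarith)⟩
      have : (𝓝[Ω] x).NeBot := mem_closure_iff_nhdsWithin_neBot.1 hxΩ
      exact le_of_tendsto (hYx.continuousAt.norm.mono_left nhdsWithin_le_nhds)
        (eventually_nhdsWithin_of_forall hY1)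
    obtain ⟨ψ, g1, g2, g3, g4, g5⟩ := exists_smooth_cutoff hAc hO hAO
    let W : EuclideanSpace ℝ (Fin d) → EuclideanSpace ℝ (Fin d) := fun x => (η x * ψ x) • Y x
    have hψW : ∀ x, x ∉ tsupport ψ → W =ᶠ[𝓝 x] fun _ => 0 := by
      intro x hx
      filter_upwards [notMem_tsupport_iff_eventuallyEq.1 hx] with y hy
      simp [W, hy]
    have hW : ContDiff ℝ 1 W := by
      refine contDiff_iff_contDiffAt.2 fun x => ?_
      by_cases hx : x ∈ tsupport ψ
      · exact (h1.contDiffAt.mul g1.contDiffAt).smul (g4 hx).1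
      · exact contDiffAt_const.congr_of_eventuallyEq (hψW x hx)
    have hWc : HasCompactSupport W :=
      HasCompactSupport.intro g3 fun x hx => (hψW x hx).self_of_nhds
    have hWn : ∀ x, ‖W x‖ ≤ 1 + ε := by
      intro x
      by_cases hx : x ∈ tsupport ψ
      · rw [norm_smul, Real.norm_of_nonneg (mul_nonneg (h2 x).1 (g2 x).1)]
        have e1 : η x * ψ x ≤ 1 := mul_le_one₀ (h2 x).2 (g2 x).1 (g2 x).2
        calc η x * ψ x * ‖Y x‖ ≤ 1 * ‖Y x‖ := by gcongr
          _ ≤ 1 + ε := by rw [one_mul]; exact (g4 hx).2.le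
      · rw [(hψW x hx).self_of_nhds, norm_zero]; linarith
    -- on `S` the second cutoff has no effect
    have hWS : ∀ x ∈ S, W =ᶠ[𝓝 x] fun y => η y • Y y := by
      intro x hx
      by_cases hxη : x ∈ tsupport η
      · filter_upwards [g5 x ⟨subset_closure hx, hxη⟩] with y hy
        simp [W, hy]
      · filter_upwards [notMem_tsupport_iff_eventuallyEq.1 hxη] with y hy
        simp [W, hy]
    have hdivW : ∀ x ∈ S, divergence Y x ≤
        divergence W x + |C| * (1 - η x) + ‖fderiv ℝ η x‖ := by
      intro x hx
      have hYd := (hY x (subset_closure (hS hx))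
        (disjoint_left.1 hΩB (hS hx))).differentiableAt one_ne_zero
      rw [divergence_congr (hWS x hx),
        divergence_smul (h1.differentiable one_ne_zero x).hasFDerivAt hYd]
      have e1 : -‖fderiv ℝ η x‖ ≤ fderiv ℝ η x (Y x) := by
        have := (fderiv ℝ η x).le_opNorm (Y x)
        have e2 : ‖fderiv ℝ η x‖ * ‖Y x‖ ≤ ‖fderiv ℝ η x‖ * 1 := by
          gcongr; exact hY1 x (hS hx)
        have e3 := neg_abs_le (fderiv ℝ η x (Y x))
        rw [Real.norm_eq_abs] at this
        linarith
      have e4 : divergence Y x * (1 - η x) ≤ |C| * (1 - η x) :=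
        mul_le_mul_of_nonneg_right ((hC x hx).trans (le_abs_self C)) (by linarith [(h2 x).2])
      nlinarith
    have hWdiv := integrable_divergence hW hWc
    obtain ⟨i1, i3⟩ := integrable_cutoff h1 h4
    have hWP : ∫ x in S, divergence W x ≤ (1 + ε) * P := by
      have h1ε : 0 < 1 + ε := by linarith
      have e1 := ofReal_setIntegral_divergence_le_perimeter S
        (X := fun x => (1 + ε)⁻¹ • W x) (hW.const_smul (1 + ε)⁻¹)
        (hWc.comp_left (g := fun w => (1 + ε)⁻¹ • w) (smul_zero _)) (fun x => by
          rw [norm_smul, norm_inv, Real.norm_of_nonneg h1ε.le, inv_mul_le_iff₀ h1ε, mul_one]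
          exact hWn x)
      have e2 := (ENNReal.ofReal_le_iff_le_toReal htop).1 e1
      have e3 : ∀ x, divergence (fun x => (1 + ε)⁻¹ • W x) x = (1 + ε)⁻¹ * divergence W x :=
        fun x => divergence_const_smul _ (hW.differentiable one_ne_zero x)
      simp only [e3] at e2
      rw [integral_const_mul, inv_mul_le_iff₀ h1ε] at e2
      exact e2
    calc ∫ x in S, divergence Y x
        ≤ ∫ x in S, (divergence W x + |C| * (1 - η x) + ‖fderiv ℝ η x‖) :=
          setIntegral_mono_on hint ((hWdiv.add (i1.const_mul |C|)).add i3).integrableOn hSm hdivW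
      _ = (∫ x in S, divergence W x) + |C| * (∫ x in S, (1 - η x)) +
            ∫ x in S, ‖fderiv ℝ η x‖ := by
          have i4 : Integrable (fun x => divergence W x + |C| * (1 - η x)) volume :=
            hWdiv.add (i1.const_mul |C|)
          rw [integral_add i4.integrableOn i3.integrableOn,
            integral_add hWdiv.integrableOn (i1.const_mul |C|).integrableOn, integral_const_mul]
      _ ≤ (1 + ε) * P + |C| * (C₀ * ε) + C₀ * ε := by
          have f1 : ∫ x in S, (1 - η x) ≤ C₀ * ε :=
            (setIntegral_le_integral i1 (Eventually.of_forall fun x => by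
              simpa using (h2 x).2)).trans h5'
          have f2 : ∫ x in S, ‖fderiv ℝ η x‖ ≤ C₀ * ε :=
            (setIntegral_le_integral i3 (Eventually.of_forall fun x => norm_nonneg _)).trans h6'
          gcongr
      _ = _ := by ring
  have hlim : Tendsto (fun ε : ℝ => (1 + ε) * P + (|C| + 1) * (C₀ * ε)) (𝓝[>] 0) (𝓝 P) := by
    have : Continuous (fun ε : ℝ => (1 + ε) * P + (|C| + 1) * (C₀ * ε)) := by fun_prop
    have h := (this.tendsto 0).mono_left (nhdsWithin_le_nhds (s := Ioi 0))
    simpa using h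
  exact ge_of_tendsto hlim (eventually_nhdsWithin_of_forall fun ε hε => key ε hε)

end GaussGreen

/-! ### The irregular part of the boundary of the tube is negligible -/

/-- A one-dimensional case of Sard's theorem, for the Hausdorff measure of the set of critical
values of a curve. -/
lemma hausdorffMeasure_image_eq_zero_of_deriv_eq_zero {V : Type*} [NormedAddCommGroup V]
    [NormedSpace ℝ V] [MeasurableSpace V] [BorelSpace V] {F F' : ℝ → V}
    (hF : ∀ s, HasDerivAt F (F' s) s) (hF' : Continuous F') {C : Set ℝ} (hC : ∀ s ∈ C, F' s = 0) :
    Measure.hausdorffMeasure 1 (F '' C) = 0 := by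
  have hcov : F '' C ⊆ ⋃ n : ℤ, F '' (C ∩ Icc (n : ℝ) (n + 1)) := by
    rintro _ ⟨s, hs, rfl⟩
    exact mem_iUnion.2 ⟨⌊s⌋, s, ⟨hs, Int.floor_le s, (Int.lt_floor_add_one s).le⟩, rfl⟩
  refine measure_mono_null hcov (measure_iUnion_null fun n => ?_)
  -- on a short interval containing a critical point the curve is `ε`-Lipschitz
  have key : ∀ ε : NNReal, 0 < ε →
      Measure.hausdorffMeasure 1 (F '' (C ∩ Icc (n : ℝ) (n + 1))) ≤ ε := by
    intro ε hε
    have huc := isCompact_Icc.uniformContinuousOn_of_continuous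
      (hF'.continuousOn (s := Icc (n : ℝ) (n + 1)))
    obtain ⟨δ, hδ, hδ'⟩ := Metric.uniformContinuousOn_iff.1 huc ε (by exact_mod_cast hε)
    obtain ⟨N, hN⟩ := exists_nat_one_div_lt hδ
    have hN0 : (0 : ℝ) < N + 1 := by positivity
    let I : ℕ → Set ℝ := fun k => Icc (n + k / (N + 1)) (n + (k + 1) / (N + 1))
    have hsub : F '' (C ∩ Icc (n : ℝ) (n + 1)) ⊆ ⋃ k ∈ Finset.range (N + 1),
        F '' (C ∩ Icc (n : ℝ) (n + 1) ∩ I k) := by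
      rintro _ ⟨s, ⟨hsC, hs⟩, rfl⟩
      have hs0 : 0 ≤ (s - n) * (N + 1) := mul_nonneg (by linarith [hs.1]) hN0.le
      have hs1 : (s - n) * (N + 1) ≤ N + 1 := by nlinarith [hs.2]
      rcases hs1.eq_or_lt with he | hlt
      · have hsn : s = n + 1 := by
          have := mul_right_cancel₀ hN0.ne' (he.trans (one_mul _).symm)
          linarith
        refine mem_iUnion₂.2 ⟨N, by simp, s, ⟨⟨hsC, hs⟩, ?_, ?_⟩, rfl⟩
        · have : (N : ℝ) / (N + 1) ≤ 1 := by rw [div_le_one hN0]; linarith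
          linarith
        · rw [div_self hN0.ne']; linarith
      · refine mem_iUnion₂.2 ⟨⌊(s - n) * (N + 1)⌋₊, ?_, s, ⟨⟨hsC, hs⟩, ?_, ?_⟩, rfl⟩
        · rw [Finset.mem_range, Nat.floor_lt hs0]; exact_mod_cast hlt
        · have := Nat.floor_le hs0
          have h2 := (div_le_iff₀ hN0).2 this
          linarith
        · have := (Nat.lt_floor_add_one ((s - n) * (N + 1))).le
          have h2 := (le_div_iff₀ hN0).2 this
          linarith
    have hpiece : ∀ k ∈ Finset.range (N + 1), Measure.hausdorffMeasure 1
        (F '' (C ∩ Icc (n : ℝ) (n + 1) ∩ I k)) ≤ ε * ENNReal.ofReal (1 / (N + 1)) := by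
      intro k hk
      have hkN : ((k : ℝ) + 1) ≤ N + 1 := by exact_mod_cast Finset.mem_range.1 hk
      have hIk : I k ⊆ Icc (n : ℝ) (n + 1) := by
        refine Icc_subset_Icc ?_ ?_
        · have : 0 ≤ (k : ℝ) / (N + 1) := by positivity
          linarith
        · have := (div_le_one hN0).2 hkN
          linarith
      rcases (C ∩ Icc (n : ℝ) (n + 1) ∩ I k).eq_empty_or_nonempty with he | ⟨s, ⟨hsC, -⟩, hsI⟩
      · rw [he]; simp
      have hsmall : ∀ u ∈ I k, ‖F' u‖₊ ≤ ε := by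
        intro u hu
        have hd : dist u s < δ := by
          rw [Real.dist_eq, abs_lt]
          have : ((k : ℝ) + 1) / (N + 1) = k / (N + 1) + 1 / (N + 1) := add_div _ _ _
          constructor <;> linarith [hu.1, hu.2, hsI.1, hsI.2]
        have h3 := hδ' u (hIk hu) s (hIk hsI) hd
        rw [hC s hsC, dist_zero_right] at h3
        exact_mod_cast h3.le
      have hlip : LipschitzOnWith ε F (I k) :=
        (convex_Icc _ _).lipschitzOnWith_of_nnnorm_hasDerivWithin_le
          (fun u _ => (hF u).hasDerivWithinAt) hsmall
      refine ((hlip.mono inter_subset_right).hausdorffMeasure_image_le zero_le_one).trans ?_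
      rw [ENNReal.rpow_one, hausdorffMeasure_real]
      gcongr
      refine (measure_mono inter_subset_right).trans_eq ?_
      rw [Real.volume_Icc]
      congr 1
      ring
    refine (measure_mono hsub).trans ((measure_biUnion_finset_le _ _).trans
      ((Finset.sum_le_card_nsmul _ _ _ hpiece).trans_eq ?_))
    rw [Finset.card_range, nsmul_eq_mul, mul_left_comm, ← ENNReal.ofReal_natCast,
      ← ENNReal.ofReal_mul (by positivity)]
    have : ((N + 1 : ℕ) : ℝ) * (1 / (N + 1)) = 1 := by push_cast; field_simp
    rw [this]; simp
  by_contra hne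
  obtain ⟨ε, hε, hlt⟩ := ENNReal.lt_iff_exists_nnreal_btwn.1 (pos_iff_ne_zero.2 hne)
  exact absurd (key ε (by exact_mod_cast hε)) (not_le.2 hlt)

/-- The transversal zeros of a family of functions of one variable form a null set. -/
lemma volume_zeros_eq_zero {f g : ℝ × ℝ → ℝ} (hf : Continuous f) (hg : Continuous g)
    (hfg : ∀ s u, HasDerivAt (fun t => f (s, t)) (g (s, u)) u) :
    volume {p : ℝ × ℝ | f p = 0 ∧ g p ≠ 0} = 0 := by
  have hmeas : MeasurableSet {p : ℝ × ℝ | f p = 0 ∧ g p ≠ 0} :=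
    (isClosed_eq hf continuous_const).measurableSet.inter
      (isOpen_ne_fun hg continuous_const).measurableSet
  rw [Measure.volume_eq_prod, Measure.measure_prod_null hmeas]
  refine Eventually.of_forall fun s => Set.Countable.measure_zero ?_ _
  refine (countable_setOfPred_isolated_right_within (s := {t | f (s, t) = 0})).mono ?_
  intro u hu
  have hu0 : f (s, u) = 0 := hu.1
  refine ⟨hu0, ?_⟩
  have h1 := (hfg s u).eventually_ne (c := 0) hu.2
  rw [← empty_mem_iff_bot, mem_nhdsWithin_iff_eventually]
  filter_upwards [eventually_nhdsWithin_iff.1 h1] with t ht hmem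
  exact ht (ne_of_gt hmem.2) hmem.1

/-- Four pairwise orthogonal vectors of a three-dimensional space, three of them nonzero. -/
lemma eq_zero_of_orthogonal_three {u v w z : EuclideanSpace ℝ (Fin 3)} (hu : u ≠ 0) (hv : v ≠ 0)
    (hw : w ≠ 0) (huv : inner ℝ u v = 0) (huw : inner ℝ u w = 0) (hvw : inner ℝ v w = 0)
    (huz : inner ℝ u z = 0) (hvz : inner ℝ v z = 0) (hwz : inner ℝ w z = 0) : z = 0 := by
  by_contra hz
  have hli : LinearIndependent ℝ ![u, v, w, z] := by
    refine linearIndependent_of_ne_zero_of_inner_eq_zero (𝕜 := ℝ) ?_ ?_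
    · intro i; fin_cases i <;> simpa
    · intro i j hij
      fin_cases i <;> fin_cases j <;> first | exact absurd rfl hij | simpa | (simpa [real_inner_comm])
  have := hli.fintype_card_le_finrank
  simp at this

namespace IsTubeAxis

variable {d : ℕ} {γ : ℝ → EuclideanSpace ℝ (Fin d)} {a : ℝ} {x : EuclideanSpace ℝ (Fin d)}

lemma injective (h : IsTubeAxis γ a) : Function.Injective γ := fun s s' e =>
  h.param_unique (γ s) s s' (by simpa using h.pos) (by rw [e]; simpa using h.pos) (by simp)
    (by rw [e]; simp)

/-- The points of the closed tube at which the parameter or the calibrating field may fail to be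
continuously differentiable. -/
def irregularSet (γ : ℝ → EuclideanSpace ℝ (Fin d)) (a : ℝ) : Set (EuclideanSpace ℝ (Fin d)) :=
  {x | Metric.infDist x (range γ) ≤ a ∧ ¬ IsRegularPoint γ x}

/-- The centres of curvature at the points of maximal curvature `1 / a`: there the boundary of the
tube is singular. -/
def focalSet (γ : ℝ → EuclideanSpace ℝ (Fin d)) (a : ℝ) : Set (EuclideanSpace ℝ (Fin d)) :=
  (fun s => γ s + a ^ 2 • deriv (deriv γ) s) '' {s | a * ‖deriv (deriv γ) s‖ = 1}

lemma isClosed_irregularSet (h : IsTubeAxis γ a) : IsClosed (irregularSet γ a) :=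
  (isClosed_le (Metric.continuous_infDist_pt _) continuous_const).inter
    h.isOpen_setOf_isRegularPoint.isClosed_compl

lemma disjoint_tube_irregularSet (h : IsTubeAxis γ a) : Disjoint (tube γ a) (irregularSet γ a) :=
  disjoint_left.2 fun _ hx hx' => hx'.2 (h.isRegularPoint_of_mem hx)

/-- Equality in the Cauchy-Schwarz inequality: a point at distance `a` is focal only if it is a
centre of curvature. -/
lemma inner_lt_one_of_notMem_focalSet (h : IsTubeAxis γ a) {s : ℝ} (hs : ‖x - γ s‖ = a)
    (hx : x ∉ focalSet γ a) : inner ℝ (deriv (deriv γ) s) (x - γ s) < 1 := by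
  have ha := h.pos
  have h1 := h.inner_curvature_le s (x - γ s)
  rw [hs, div_self ha.ne'] at h1
  refine lt_of_le_of_ne h1 fun he => hx ?_
  have hk := h.curvature_le s
  have hk' : (a * ‖deriv (deriv γ) s‖) ^ 2 ≤ 1 := by
    have : 0 ≤ a * ‖deriv (deriv γ) s‖ := by positivity
    nlinarith
  have hsq : ‖(x - γ s) - a ^ 2 • deriv (deriv γ) s‖ ^ 2 ≤ 0 := by
    rw [norm_sub_sq_real, hs, inner_smul_right, real_inner_comm, he, norm_smul,
      Real.norm_of_nonneg (by positivity)]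
    nlinarith
  have h0 : (x - γ s) - a ^ 2 • deriv (deriv γ) s = 0 := by
    rw [← norm_eq_zero, ← sq_eq_zero_iff]
    exact le_antisymm hsq (sq_nonneg _)
  refine ⟨s, ?_, ?_⟩
  · have h2 := congrArg norm (sub_eq_zero.1 h0)
    rw [hs, norm_smul, Real.norm_of_nonneg (by positivity)] at h2
    change a * ‖deriv (deriv γ) s‖ = 1
    have h3 : a * (a * ‖deriv (deriv γ) s‖) = a * 1 := by linear_combination -h2
    exact mul_left_cancel₀ ha.ne' h3
  · change γ s + a ^ 2 • deriv (deriv γ) s = x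
    rw [← sub_eq_zero.1 h0]; abel

lemma irregularSet_subset (h : IsTubeAxis γ a) :
    irregularSet γ a ⊆ focalSet γ a ∪ (touchingSet γ a \ focalSet γ a) := by
  rintro x ⟨hx, hreg⟩
  by_cases hfoc : x ∈ focalSet γ a
  · exact Or.inl hfoc
  refine Or.inr ⟨?_, hfoc⟩
  have hxa : Metric.infDist x (range γ) = a := by
    refine le_antisymm hx (not_lt.1 fun hlt => hreg (h.isRegularPoint_of_mem hlt))
  by_contra htouch
  have hv := h.norm_normalPart x
  rw [hxa] at hv
  have hjac : tubeJacobian γ x ≠ 0 := by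
    have := h.inner_lt_one_of_notMem_focalSet hv hfoc
    rw [tubeJacobian]
    exact ne_of_gt (by rw [normalPart]; linarith)
  refine hreg ⟨h.contDiffAt_nearestParam (fun s hs => ?_) hjac, hjac⟩
  by_contra hne
  rw [hxa] at hs
  exact htouch ⟨hxa, γ s, mem_range_self s, γ (nearestParam γ x), mem_range_self _,
    fun e => hne (h.injective e), by rw [dist_eq_norm, hs], by rw [dist_eq_norm]; exact hv⟩

/-- At a non-focal nearest point, moving `x` towards it leads into the normal disc of a nearby
point of the curve. -/
lemma exists_param_of_inner_neg (h : IsTubeAxis γ a) (hxa : Metric.infDist x (range γ) = a) {s : ℝ}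
    (hs : ‖x - γ s‖ = a) (hf : inner ℝ (deriv (deriv γ) s) (x - γ s) < 1)
    {w : EuclideanSpace ℝ (Fin d)} (hw : inner ℝ w (x - γ s) < 0) {δ : ℝ} (hδ : 0 < δ) :
    ∀ᶠ t in 𝓝[>] (0 : ℝ), ∃ u, |u - s| < δ ∧ ‖x + t • w - γ u‖ < a ∧
      inner ℝ (x + t • w - γ u) (deriv γ u) = 0 := by
  have hge : ∀ u, a ≤ ‖x - γ u‖ := fun u => by
    rw [← hxa, ← dist_eq_norm]; exact Metric.infDist_le_dist_of_mem (mem_range_self u)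
  have hs0 : inner ℝ (x - γ s) (deriv γ s) = 0 := h.inner_eq_zero_of_nearest (by rw [hs, hxa])
  -- `s` is an isolated minimum since the first-order condition holds transversally
  have hder : HasDerivAt (fun u => inner ℝ (x - γ u) (deriv γ u))
      (inner ℝ (deriv (deriv γ) s) (x - γ s) - 1) s := by
    refine (((h.hasDerivAt s).const_sub x).inner ℝ (h.hasDerivAt_deriv s)).congr_deriv ?_
    rw [inner_neg_left, h.inner_deriv_self, real_inner_comm]; ring
  have hiso : ∀ᶠ u in 𝓝[≠] s, a < ‖x - γ u‖ := by
    filter_upwards [hder.eventually_ne (c := 0) (by linarith)] with u hu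
    refine lt_of_le_of_ne (hge u) fun e => hu ?_
    exact h.inner_eq_zero_of_nearest (by rw [← e, hxa])
  obtain ⟨δ₁, hδ1, hδ1'⟩ := Metric.eventually_nhds_iff.1 (eventually_nhdsWithin_iff.1 hiso)
  set r := min δ δ₁ / 2 with hr
  have hr0 : 0 < r := by positivity
  have hrδ : r < δ := by have := min_le_left δ δ₁; have : 0 < min δ δ₁ := by positivity
                         linarith
  have hrδ1 : r < δ₁ := by have := min_le_right δ δ₁; have : 0 < min δ δ₁ := by positivity
                           linarith
  have hend : ∀ u, |u - s| = r → a < ‖x - γ u‖ := fun u hu =>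
    hδ1' (by rw [Real.dist_eq, hu]; exact hrδ1) fun e => by
      rw [mem_singleton_iff.1 e] at hu; simp at hu; linarith
  have hev : ∀ u, |u - s| = r → ∀ᶠ t in 𝓝[>] (0 : ℝ), a < ‖x + t • w - γ u‖ := by
    intro u hu
    have hc : Continuous fun t : ℝ => ‖x + t • w - γ u‖ := by fun_prop
    have h0 : ∀ᶠ t in 𝓝 (0 : ℝ), a < ‖x + t • w - γ u‖ :=
      (hc.tendsto 0).eventually (lt_mem_nhds (by simpa using hend u hu))
    exact h0.filter_mono nhdsWithin_le_nhds
  have hmid : ∀ᶠ t in 𝓝[>] (0 : ℝ), ‖x + t • w - γ s‖ < a := by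
    have hc : Continuous fun t : ℝ => 2 * inner ℝ w (x - γ s) + t * ‖w‖ ^ 2 := by fun_prop
    have h0 : ∀ᶠ t in 𝓝 (0 : ℝ), 2 * inner ℝ w (x - γ s) + t * ‖w‖ ^ 2 < 0 :=
      (hc.tendsto 0).eventually (gt_mem_nhds (by simp only [zero_mul, add_zero]; linarith))
    filter_upwards [h0.filter_mono nhdsWithin_le_nhds, self_mem_nhdsWithin] with t ht ht0
    have ht0' : 0 < t := ht0
    have e1 : x + t • w - γ s = (x - γ s) + t • w := by abel
    have e2 : ‖x + t • w - γ s‖ ^ 2 < a ^ 2 := by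
      rw [e1, norm_add_sq_real, hs, inner_smul_right, real_inner_comm, norm_smul,
        Real.norm_of_nonneg ht0'.le]
      nlinarith
    exact lt_of_pow_lt_pow_left₀ 2 h.pos.le e2
  filter_upwards [hev (s - r) (by simp [abs_of_pos hr0]), hev (s + r) (by simp [abs_of_pos hr0]),
    hmid] with t h1 h2 h3
  obtain ⟨u, hu, hmin⟩ := isCompact_Icc.exists_isMinOn (s := Icc (s - r) (s + r))
    ⟨s, by constructor <;> linarith⟩ (f := fun u => ‖x + t • w - γ u‖)
    (continuous_const.sub h.continuous).norm.continuousOn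
  have hus : ‖x + t • w - γ u‖ < a :=
    lt_of_le_of_lt (hmin (show s ∈ _ by constructor <;> linarith)) h3
  have hu' : u ∈ Ioo (s - r) (s + r) := by
    refine ⟨lt_of_le_of_ne hu.1 fun e => ?_, lt_of_le_of_ne hu.2 fun e => ?_⟩
    · rw [← e] at hus; linarith
    · rw [e] at hus; linarith
  refine ⟨u, ?_, hus, h.inner_eq_zero_of_isLocalMin ?_⟩
  · rw [abs_lt]; constructor <;> linarith [hu'.1, hu'.2]
  · filter_upwards [Ioo_mem_nhds hu'.1 hu'.2] with v hv
    exact hmin (Ioo_subset_Icc_self hv)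

/-- Where the boundary of the tube touches itself at a non-focal point, that point is the midpoint
of two points of the curve; otherwise the two sheets of the tube would overlap. -/
lemma add_eq_zero_of_touching (h : IsTubeAxis γ a) (hxa : Metric.infDist x (range γ) = a) {s s' : ℝ}
    (hne : s ≠ s') (hs : ‖x - γ s‖ = a) (hs' : ‖x - γ s'‖ = a) (hx : x ∉ focalSet γ a) :
    (x - γ s) + (x - γ s') = 0 := by
  by_contra hcon
  have hpos : 0 < ‖(x - γ s) + (x - γ s')‖ ^ 2 := by
    have := norm_pos_iff.2 hcon
    positivity
  rw [norm_add_sq_real, hs, hs'] at hpos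
  have hδ : 0 < |s - s'| / 2 := by
    have := abs_pos.2 (sub_ne_zero.2 hne)
    positivity
  have e1 := h.exists_param_of_inner_neg hxa hs (h.inner_lt_one_of_notMem_focalSet hs hx)
    (w := -((x - γ s) + (x - γ s'))) (by
      rw [inner_neg_left, inner_add_left, real_inner_self_eq_norm_sq, hs, real_inner_comm]
      linarith) hδ
  have e2 := h.exists_param_of_inner_neg hxa hs' (h.inner_lt_one_of_notMem_focalSet hs' hx)
    (w := -((x - γ s) + (x - γ s'))) (by
      rw [inner_neg_left, inner_add_left, real_inner_self_eq_norm_sq, hs']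
      linarith) hδ
  obtain ⟨t, ⟨u, hu, hu1, hu2⟩, ⟨u', hu', hu1', hu2'⟩⟩ := (e1.and e2).exists
  have := h.param_unique _ u u' hu1 hu1' hu2 hu2'
  rw [← this] at hu'
  have h3 := abs_sub_le s u s'
  rw [abs_sub_comm s u] at h3
  linarith

/-- The pairs of parameters of opposite points at which the tube can touch itself. -/
def touchingPairs (γ : ℝ → EuclideanSpace ℝ (Fin d)) (a : ℝ) : Set (ℝ × ℝ) :=
  {p | ‖γ p.2 - γ p.1‖ = 2 * a ∧ inner ℝ (deriv γ p.1) (γ p.2 - γ p.1) = 0 ∧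
    inner ℝ (deriv γ p.2) (γ p.2 - γ p.1) = 0}

lemma touchingSet_diff_subset (h : IsTubeAxis γ a) : touchingSet γ a \ focalSet γ a ⊆
    (fun p : ℝ × ℝ => (2⁻¹ : ℝ) • (γ p.1 + γ p.2)) '' touchingPairs γ a := by
  rintro x ⟨⟨hxa, p, ⟨s, rfl⟩, q, ⟨s', rfl⟩, hpq, hp, hq⟩, hx⟩
  rw [dist_eq_norm] at hp hq
  have h0 := h.add_eq_zero_of_touching hxa (fun e => hpq (by rw [e])) hp hq hx
  have hw : γ s' - γ s = (2 : ℝ) • (x - γ s) := by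
    have : (2 : ℝ) • (x - γ s) = ((x - γ s) + (x - γ s')) + (γ s' - γ s) := by
      rw [two_smul]; abel
    rw [this, h0, zero_add]
  have hw' : γ s' - γ s = (-2 : ℝ) • (x - γ s') := by
    have : (-2 : ℝ) • (x - γ s') = -((x - γ s) + (x - γ s')) + (γ s' - γ s) := by
      rw [neg_smul, two_smul]; abel
    rw [this, h0, neg_zero, zero_add]
  have n1 := h.inner_eq_zero_of_nearest (hp.trans hxa.symm)
  have n2 := h.inner_eq_zero_of_nearest (hq.trans hxa.symm)
  refine ⟨(s, s'), ⟨?_, ?_, ?_⟩, ?_⟩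
  · simp only; rw [hw, norm_smul, hp]; norm_num
  · simp only; rw [hw, inner_smul_right, real_inner_comm, n1, mul_zero]
  · simp only; rw [hw', inner_smul_right, real_inner_comm, n2, mul_zero]
  · simp only
    have : γ s + γ s' = (2 : ℝ) • x := by
      rw [← sub_eq_zero, ← neg_eq_zero, ← h0, two_smul]; abel
    rw [this, smul_smul]; norm_num

lemma lipschitzWith_midpoint (h : IsTubeAxis γ a) :
    LipschitzWith 1 (fun p : ℝ × ℝ => (2⁻¹ : ℝ) • (γ p.1 + γ p.2)) := by
  have hl : ∀ s t, ‖γ s - γ t‖ ≤ |s - t| := by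
    intro s t
    have := Convex.norm_image_sub_le_of_norm_deriv_le (f := γ) (s := univ) (C := 1)
      (x := t) (y := s) (fun x _ => (h.hasDerivAt x).differentiableAt)
      (fun x _ => (h.unit_speed x).le) convex_univ (mem_univ _) (mem_univ _)
    simpa using this
  refine LipschitzWith.of_dist_le_mul fun p q => ?_
  rw [dist_eq_norm, ← smul_sub, norm_smul, NNReal.coe_one, one_mul, Prod.dist_eq, Real.dist_eq,
    Real.dist_eq]
  have e : γ p.1 + γ p.2 - (γ q.1 + γ q.2) = (γ p.1 - γ q.1) + (γ p.2 - γ q.2) := by abel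
  rw [e]
  have h1 := norm_add_le (γ p.1 - γ q.1) (γ p.2 - γ q.2)
  have h2 := hl p.1 q.1
  have h3 := hl p.2 q.2
  have h4 := le_max_left |p.1 - q.1| |p.2 - q.2|
  have h5 := le_max_right |p.1 - q.1| |p.2 - q.2|
  rw [Real.norm_of_nonneg (by norm_num)]
  linarith

/-- In three-dimensional space the pairs of touching parameters form a null set. Up to a null set,
the derivatives of the defining relations with respect to the second parameter vanish as well, and
all these relations together determine the first parameter by the second one. -/
lemma volume_touchingPairs {γ : ℝ → EuclideanSpace ℝ (Fin 3)} (h : IsTubeAxis γ a) :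
    volume (touchingPairs γ a) = 0 := by
  have ha := h.pos
  have cγ : Continuous γ := h.continuous
  have cT : Continuous (deriv γ) := h.contDiff_deriv.continuous
  have cκ : Continuous (deriv (deriv γ)) := h.contDiff_deriv_deriv.continuous
  have z1 := volume_zeros_eq_zero
    (f := fun p : ℝ × ℝ => inner ℝ (deriv γ p.1) (γ p.2 - γ p.1))
    (g := fun p => inner ℝ (deriv γ p.1) (deriv γ p.2)) (by fun_prop) (by fun_prop)
    (fun s u => ((hasDerivAt_const u (deriv γ s)).inner ℝ
      ((h.hasDerivAt u).sub_const (γ s))).congr_deriv (by simp))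
  have z2 := volume_zeros_eq_zero
    (f := fun p : ℝ × ℝ => inner ℝ (deriv γ p.2) (γ p.2 - γ p.1))
    (g := fun p => 1 + inner ℝ (deriv (deriv γ) p.2) (γ p.2 - γ p.1)) (by fun_prop) (by fun_prop)
    (fun s u => ((h.hasDerivAt_deriv u).inner ℝ ((h.hasDerivAt u).sub_const (γ s))).congr_deriv
      (by rw [h.inner_deriv_self]))
  have z3 := volume_zeros_eq_zero
    (f := fun p : ℝ × ℝ => inner ℝ (deriv γ p.1) (deriv γ p.2))
    (g := fun p => inner ℝ (deriv γ p.1) (deriv (deriv γ) p.2)) (by fun_prop) (by fun_prop)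
    (fun s u => ((hasDerivAt_const u (deriv γ s)).inner ℝ (h.hasDerivAt_deriv u)).congr_deriv
      (by simp))
  have z4 : volume {p : ℝ × ℝ | γ p.1 = γ p.2 + (4 * a ^ 2) • deriv (deriv γ) p.2} = 0 := by
    have hm : MeasurableSet {p : ℝ × ℝ | γ p.1 = γ p.2 + (4 * a ^ 2) • deriv (deriv γ) p.2} :=
      (isClosed_eq (by fun_prop) (by fun_prop)).measurableSet
    rw [Measure.volume_eq_prod, Measure.prod_apply_symm hm]
    refine lintegral_eq_zero_of_ae_eq_zero (Eventually.of_forall fun u => ?_)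
    refine Set.Subsingleton.measure_zero (fun s hs s' hs' => h.injective ?_) _
    have e1 : γ s = γ u + (4 * a ^ 2) • deriv (deriv γ) u := hs
    have e2 : γ s' = γ u + (4 * a ^ 2) • deriv (deriv γ) u := hs'
    rw [e1, e2]
  refine measure_mono_null ?_ (measure_union_null (measure_union_null z1 z2)
    (measure_union_null z3 z4))
  rintro ⟨s, u⟩ ⟨hw, h1, h2⟩
  by_contra hcon
  simp only [mem_union, mem_ofPred_eq, not_or, not_and, not_not] at hcon h1 h2 hw
  obtain ⟨⟨c1, c2⟩, c3, c4⟩ := hcon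
  have d1 := c1 h1
  have d2 := c2 h2
  have d3 := c3 d1
  apply c4
  set w := γ u - γ s with hwdef
  have hww : inner ℝ w w = 4 * a ^ 2 := by rw [real_inner_self_eq_norm_sq, hw]; ring
  have hz := eq_zero_of_orthogonal_three (u := deriv γ s) (v := deriv γ u) (w := w)
    (z := (4 * a ^ 2) • deriv (deriv γ) u + w)
    (norm_ne_zero_iff.1 (by rw [h.unit_speed]; norm_num))
    (norm_ne_zero_iff.1 (by rw [h.unit_speed]; norm_num))
    (norm_ne_zero_iff.1 (by rw [hw]; positivity)) d1 h1 h2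
    (by rw [inner_add_right, inner_smul_right, d3, h1]; simp)
    (by rw [inner_add_right, inner_smul_right, h.inner_deriv_deriv, h2]; simp)
    (by rw [inner_add_right, inner_smul_right, real_inner_comm, hww]
        linear_combination (4 * a ^ 2) * d2)
  have : γ s = γ u + (4 * a ^ 2) • deriv (deriv γ) u
      - ((4 * a ^ 2) • deriv (deriv γ) u + w) := by rw [hwdef]; abel
  rw [this, hz, sub_zero]

lemma hausdorffMeasure_touchingSet_diff (h : IsTubeAxis γ a) {m : ℕ} (hd : d = m + 1)
    (hm : 2 ≤ m) : Measure.hausdorffMeasure (m : ℝ) (touchingSet γ a \ focalSet γ a) = 0 := by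
  refine measure_mono_null h.touchingSet_diff_subset ?_
  rcases hm.eq_or_lt with rfl | hm3
  · subst hd
    have h1 := h.lipschitzWith_midpoint.hausdorffMeasure_image_le
      (d := 2) zero_le_two (touchingPairs γ a)
    rw [hausdorffMeasure_prod_real, volume_touchingPairs h, mul_zero] at h1
    exact le_antisymm (by exact_mod_cast h1) zero_le
  · have h1 : dimH ((fun p : ℝ × ℝ => (2⁻¹ : ℝ) • (γ p.1 + γ p.2)) '' touchingPairs γ a) < (m : NNReal) := by
      refine lt_of_le_of_lt (dimH_mono (image_subset_range _ _)) ?_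
      refine lt_of_le_of_lt h.lipschitzWith_midpoint.dimH_range_le ?_
      rw [Real.dimH_univ_eq_finrank]
      simp
      exact_mod_cast hm3
    exact_mod_cast hausdorffMeasure_of_dimH_lt h1

lemma hausdorffMeasure_focalSet (h : IsTubeAxis γ a) {m : ℕ} (hd : d = m + 1) (hm : 1 ≤ m) :
    Measure.hausdorffMeasure (m : ℝ) (focalSet γ a) = 0 := by
  have ha := h.pos
  have hsm : ContDiff ℝ ∞ (fun s => γ s + a ^ 2 • deriv (deriv γ) s) := by
    have h1 := h.smooth
    have h2 := h.contDiff_deriv_deriv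
    fun_prop
  rcases hm.eq_or_lt with rfl | hm2
  · subst hd
    have hκ : ∀ s, HasDerivAt (deriv (deriv γ)) (deriv (deriv (deriv γ)) s) s := fun s =>
      IsUnboundedCompleteCurve.hasDerivAt h.contDiff_deriv_deriv s
    rw [Nat.cast_one]
    refine hausdorffMeasure_image_eq_zero_of_deriv_eq_zero
      (F' := fun s => deriv γ s + a ^ 2 • deriv (deriv (deriv γ)) s)
      (fun s => (h.hasDerivAt s).add ((hκ s).const_smul (a ^ 2))) ?_ ?_
    · have c1 := h.contDiff_deriv.continuous
      have c2 := (IsUnboundedCompleteCurve.contDiff_deriv h.contDiff_deriv_deriv).continuous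
      fun_prop
    · intro s hs
      have hs1 : a * ‖deriv (deriv γ) s‖ = 1 := hs
      -- the curvature is maximal at `s`
      have hmax : IsLocalMax (fun t => ‖deriv (deriv γ) t‖ ^ 2) s := by
        refine Eventually.of_forall fun t => ?_
        have : ‖deriv (deriv γ) t‖ ≤ ‖deriv (deriv γ) s‖ :=
          le_of_mul_le_mul_left ((h.curvature_le t).trans_eq hs1.symm) ha
        dsimp only
        gcongr
      have hκκ : inner ℝ (deriv (deriv γ) s) (deriv (deriv (deriv γ)) s) = 0 := by
        have := hmax.hasDerivAt_eq_zero (hκ s).norm_sq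
        linarith
      have hT3 : inner ℝ (deriv (deriv (deriv γ)) s) (deriv γ s)
          = - ‖deriv (deriv γ) s‖ ^ 2 := by
        have := inner_deriv_of_inner_eq_zero (hκ s) (h.hasDerivAt_deriv _)
          (fun s => by rw [real_inner_comm]; exact h.inner_deriv_deriv s)
        rw [this, real_inner_self_eq_norm_sq]
      have key := eq_smul_of_orthogonal_plane (h.unit_speed s)
        (n := a • deriv (deriv γ) s) (v := deriv (deriv (deriv γ)) s)
        (by rw [norm_smul, Real.norm_of_nonneg ha.le, hs1])
        (by rw [inner_smul_left, real_inner_comm, h.inner_deriv_deriv, mul_zero])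
        (by rw [inner_smul_right, real_inner_comm, hκκ, mul_zero])
      rw [key, hT3, smul_smul]
      have : a ^ 2 * -‖deriv (deriv γ) s‖ ^ 2 = -1 := by
        linear_combination (-a * ‖deriv (deriv γ) s‖ - 1) * hs1
      rw [this]; simp
  · have h1 : dimH (focalSet γ a) < (m : NNReal) := by
      refine lt_of_le_of_lt (dimH_mono (image_subset_range _ _)) ?_
      refine lt_of_le_of_lt (hsm.of_le (by simp)).dimH_range_le ?_
      simp
      exact_mod_cast hm2
    exact_mod_cast hausdorffMeasure_of_dimH_lt h1

lemma hausdorffMeasure_irregularSet (h : IsTubeAxis γ a) {m : ℕ} (hd : d = m + 1) (hm : 1 ≤ m)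
    (htouch : d = 2 → Measure.hausdorffMeasure 1 (touchingSet γ a) = 0) :
    Measure.hausdorffMeasure (m : ℝ) (irregularSet γ a) = 0 := by
  refine measure_mono_null h.irregularSet_subset
    (measure_union_null (h.hausdorffMeasure_focalSet hd hm) ?_)
  rcases hm.eq_or_lt with rfl | hm2
  · rw [Nat.cast_one]
    exact measure_mono_null sdiff_subset (htouch hd)
  · exact h.hausdorffMeasure_touchingSet_diff hd hm2

end IsTubeAxis

/-! ### Sets whose indicator function has no gradient in an open set -/

section LocallyConstant

variable {d : ℕ}

/-- If the indicator function of `S` has vanishing distributional gradient in `Ω`, then near every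
point of `Ω` the set `S` or its complement is negligible: the mollified indicator functions are
locally constant. -/
lemma exists_mem_nhds_null_or_null {Ω S : Set (EuclideanSpace ℝ (Fin d))} (hΩ : IsOpen Ω)
    (hS : MeasurableSet S)
    (h0 : ∀ φ : EuclideanSpace ℝ (Fin d) → ℝ, ContDiff ℝ 1 φ → HasCompactSupport φ →
      tsupport φ ⊆ Ω → ∀ e, ∫ x in S, fderiv ℝ φ x e = 0) {x₀ : EuclideanSpace ℝ (Fin d)}
    (hx : x₀ ∈ Ω) : ∃ U ∈ 𝓝 x₀, volume (S ∩ U) = 0 ∨ volume (U \ S) = 0 := by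
  obtain ⟨r, hr, hrΩ⟩ := Metric.isOpen_iff.1 hΩ x₀ hx
  have hr2 : 0 < r / 2 := by positivity
  refine ⟨Metric.ball x₀ (r / 2), Metric.ball_mem_nhds _ hr2, ?_⟩
  let b : ℕ → ContDiffBump (0 : EuclideanSpace ℝ (Fin d)) := fun n =>
    ⟨r / 4 / (n + 1) / 2, r / 4 / (n + 1), by positivity, half_lt_self (by positivity)⟩
  have hb : ∀ n, (b n).rOut ≤ r / 4 := fun n => div_le_self (by positivity) (by simp)
  have hb0 : Tendsto (fun n => (b n).rOut) atTop (𝓝 0) := by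
    have := (tendsto_one_div_add_atTop_nhds_zero_nat (𝕜 := ℝ)).const_mul (r / 4)
    simpa [b, div_eq_mul_inv] using this
  set χ : EuclideanSpace ℝ (Fin d) → ℝ := S.indicator fun _ => 1 with hχ
  have hχi : LocallyIntegrable χ volume :=
    (locallyIntegrable_const (1 : ℝ)).indicator hS
  have hae := ContDiffBump.ae_convolution_tendsto_right_of_locallyIntegrable (K := 2) (φ := b)
    (l := atTop) hb0 (Eventually.of_forall fun n => by
      change r / 4 / (n + 1) ≤ 2 * (r / 4 / (n + 1) / 2); linarith) hχi
  have hconst : ∀ n, ∀ x ∈ Metric.ball x₀ (r / 2), ∀ y ∈ Metric.ball x₀ (r / 2),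
      ((b n).normed volume ⋆[ContinuousLinearMap.lsmul ℝ ℝ, volume] χ) x =
      ((b n).normed volume ⋆[ContinuousLinearMap.lsmul ℝ ℝ, volume] χ) y := by
    intro n
    set ψ := (b n).normed (volume : Measure (EuclideanSpace ℝ (Fin d))) with hψ
    have hψ1 : ContDiff ℝ 1 ψ := (b n).contDiff_normed
    have hψc : HasCompactSupport ψ := (b n).hasCompactSupport_normed
    have hder : ∀ x ∈ Metric.ball x₀ (r / 2),
        HasFDerivAt (ψ ⋆[ContinuousLinearMap.lsmul ℝ ℝ, volume] χ)
          (0 : EuclideanSpace ℝ (Fin d) →L[ℝ] ℝ) x := by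
      intro x hx
      rw [← convolution_flip]
      refine (hψc.hasFDerivAt_convolution_right _ hχi hψ1 x).congr_fderiv ?_
      ext e
      rw [convolution_precompR_apply _ hχi (hψc.fderiv (𝕜 := ℝ))
        (hψ1.continuous_fderiv one_ne_zero)]
      have hφ1 : ContDiff ℝ 1 (fun t => ψ (x - t)) := by fun_prop
      have hzero : ∀ t, t ∉ Metric.closedBall x (r / 4) → ψ (x - t) = 0 := by
        intro t ht
        have : x - t ∉ Function.support ψ := by
          rw [hψ, ContDiffBump.support_normed_eq, Metric.mem_ball, dist_zero_right, not_lt,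
            ← dist_eq_norm, dist_comm]
          exact (hb n).trans (not_le.1 ht).le
        exact Function.notMem_support.1 this
      have hφc : HasCompactSupport (fun t => ψ (x - t)) :=
        HasCompactSupport.intro (isCompact_closedBall x (r / 4)) hzero
      have hφΩ : tsupport (fun t => ψ (x - t)) ⊆ Ω := by
        have hball : Metric.closedBall x (r / 4) ⊆ Metric.ball x₀ r := by
          refine Metric.closedBall_subset_ball' ?_
          have := Metric.mem_ball.1 hx
          linarith
        refine (closure_minimal (t := Metric.closedBall x (r / 4)) (fun t ht => ?_)
          Metric.isClosed_closedBall).trans (hball.trans hrΩ)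
        by_contra hcon
        exact ht (hzero t hcon)
      have h1 := h0 _ hφ1 hφc hφΩ e
      have h2 : ∀ t, fderiv ℝ (fun t => ψ (x - t)) t e = - fderiv ℝ ψ (x - t) e := by
        intro t
        have e1 : HasFDerivAt (fun t => x - t)
            (-(ContinuousLinearMap.id ℝ (EuclideanSpace ℝ (Fin d)))) t :=
          (hasFDerivAt_id t).const_sub x
        have e2 := ((hψ1.differentiable one_ne_zero (x - t)).hasFDerivAt.comp t e1).fderiv
        change fderiv ℝ (fun t => ψ (x - t)) t = _ at e2
        rw [e2]; simp
      simp only [h2] at h1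
      rw [integral_neg, neg_eq_zero, ← integral_indicator hS] at h1
      rw [convolution_def, zero_apply, ← h1]
      congr 1
      funext t
      by_cases ht : t ∈ S <;> simp [hχ, ht]
    intro x hx y hy
    have := (convex_ball x₀ (r / 2)).norm_image_sub_le_of_norm_hasFDerivWithin_le (C := 0)
      (fun z hz => (hder z hz).hasFDerivWithinAt) (by simp) hy hx
    rw [zero_mul, norm_le_zero_iff, sub_eq_zero] at this
    exact this
  by_contra! hcon
  obtain ⟨x, ⟨hxS, hxb⟩, hxl⟩ := nonempty_of_measure_ne_zero
    ((measure_inter_conull (s := S ∩ Metric.ball x₀ (r / 2)) (mem_ae_iff.1 hae)).trans_ne hcon.1)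
  obtain ⟨y, ⟨hyb, hyS⟩, hyl⟩ := nonempty_of_measure_ne_zero
    ((measure_inter_conull (s := Metric.ball x₀ (r / 2) \ S) (mem_ae_iff.1 hae)).trans_ne hcon.2)
  have hxl' : Tendsto (fun n => ((b n).normed volume ⋆[ContinuousLinearMap.lsmul ℝ ℝ, volume] χ) x)
    atTop (𝓝 (χ x)) := hxl
  have hyl' : Tendsto (fun n => ((b n).normed volume ⋆[ContinuousLinearMap.lsmul ℝ ℝ, volume] χ) y)
    atTop (𝓝 (χ y)) := hyl
  have := tendsto_nhds_unique (hxl'.congr fun n => hconst n x hxb y hyb) hyl'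
  simp [hχ, hxS, hyS] at this

/-- Global form of the previous lemma: in a connected open set such a set is negligible or has
negligible complement. -/
lemma null_or_null_of_isPreconnected {Ω S : Set (EuclideanSpace ℝ (Fin d))} (hΩ : IsOpen Ω)
    (hc : IsPreconnected Ω) (hS : MeasurableSet S) (hSΩ : S ⊆ Ω)
    (h0 : ∀ φ : EuclideanSpace ℝ (Fin d) → ℝ, ContDiff ℝ 1 φ → HasCompactSupport φ →
      tsupport φ ⊆ Ω → ∀ e, ∫ x in S, fderiv ℝ φ x e = 0) :
    volume S = 0 ∨ volume (Ω \ S) = 0 := by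
  have hopen : ∀ T : Set (EuclideanSpace ℝ (Fin d)),
      IsOpen {x | ∃ U ∈ 𝓝 x, volume (T ∩ U) = 0} := by
    intro T
    rw [isOpen_iff_mem_nhds]
    rintro x ⟨U, hU, hU0⟩
    filter_upwards [eventually_mem_nhds_iff.2 hU] with y hy using ⟨U, hy, hU0⟩
  have hdisj : Disjoint {x | ∃ U ∈ 𝓝 x, volume (S ∩ U) = 0}
      {x | ∃ U ∈ 𝓝 x, volume (Sᶜ ∩ U) = 0} := by
    refine disjoint_left.2 ?_
    rintro x ⟨U, hU, hU0⟩ ⟨U', hU', hU0'⟩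
    have h1 : volume (U ∩ U') = 0 := by
      refine measure_mono_null (fun y hy => ?_) (measure_union_null hU0 hU0')
      by_cases hyS : y ∈ S
      · exact Or.inl ⟨hyS, hy.1⟩
      · exact Or.inr ⟨hyS, hy.2⟩
    exact (Measure.measure_pos_of_mem_nhds volume (inter_mem hU hU')).ne' h1
  have hcov : Ω ⊆ {x | ∃ U ∈ 𝓝 x, volume (S ∩ U) = 0} ∪ {x | ∃ U ∈ 𝓝 x, volume (Sᶜ ∩ U) = 0} := by
    intro x hx
    obtain ⟨U, hU, h1 | h1⟩ := exists_mem_nhds_null_or_null hΩ hS h0 hx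
    · exact Or.inl ⟨U, hU, h1⟩
    · exact Or.inr ⟨U, hU, by rwa [inter_comm, ← sdiff_eq]⟩
  rcases hc.subset_or_subset (hopen S) (hopen Sᶜ) hdisj hcov with h1 | h1
  · left
    refine measure_null_of_locally_null S fun x hx => ?_
    obtain ⟨U, hU, hU0⟩ := h1 (hSΩ hx)
    exact ⟨S ∩ U, inter_mem self_mem_nhdsWithin (mem_nhdsWithin_of_mem_nhds hU), hU0⟩
  · right
    refine measure_null_of_locally_null _ fun x hx => ?_
    obtain ⟨U, hU, hU0⟩ := h1 hx.1
    refine ⟨Sᶜ ∩ U, inter_mem ?_ (mem_nhdsWithin_of_mem_nhds hU), hU0⟩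
    exact mem_of_superset self_mem_nhdsWithin fun y hy => hy.2

end LocallyConstant

/-! ### The lower bound, and its strictness -/

namespace IsTubeAxis

variable {d : ℕ} {γ : ℝ → EuclideanSpace ℝ (Fin d)} {a : ℝ}

lemma range_subset_tube (h : IsTubeAxis γ a) : range γ ⊆ tube γ a := fun x hx => by
  change Metric.infDist x (range γ) < a
  rw [Metric.infDist_zero_of_mem hx]; exact h.pos

lemma isPreconnected_tube (h : IsTubeAxis γ a) : IsPreconnected (tube γ a) := by
  refine isPreconnected_of_forall (γ 0) fun y hy =>
    ⟨range γ ∪ Metric.ball (γ (nearestParam γ y)) a, union_subset h.range_subset_tube ?_,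
      Or.inl (mem_range_self 0), Or.inr ?_, ?_⟩
  · intro z hz
    exact (Metric.infDist_le_dist_of_mem (mem_range_self _)).trans_lt (Metric.mem_ball.1 hz)
  · rw [Metric.mem_ball, dist_eq_norm]
    exact h.mem_tube_iff.1 hy
  · exact IsPreconnected.union (γ (nearestParam γ y)) (mem_range_self _)
      (Metric.mem_ball_self h.pos) (isPreconnected_range h.continuous)
      (convex_ball _ _).isPreconnected

/-- The calibration inequality, with room for a perturbation of the calibrating field. -/
lemma ofReal_le_perimeter (h : IsTubeAxis γ a) (hd : 2 ≤ d)
    (htouch : d = 2 → Measure.hausdorffMeasure 1 (touchingSet γ a) = 0)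
    {S : Set (EuclideanSpace ℝ (Fin d))} (hS : IsCompetitor (tube γ a) S)
    {Z : EuclideanSpace ℝ (Fin d) → EuclideanSpace ℝ (Fin d)} (hZ : ContDiff ℝ 1 Z)
    (hZc : HasCompactSupport Z) (hZ1 : ∀ x ∈ tube γ a, ‖calibration γ a x + Z x‖ ≤ 1) :
    ENNReal.ofReal (((d : ℝ) - 1) / a * volume.real S + ∫ x in S, divergence Z x)
      ≤ perimeter S := by
  have hSfin : volume S ≠ ⊤ := hS.bounded.measure_lt_top.ne
  have hreg : ∀ x ∈ closure (tube γ a), x ∉ irregularSet γ a → IsRegularPoint γ x := by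
    intro x hx hxB
    by_contra hcon
    exact hxB ⟨closure_tube_subset γ a hx, hcon⟩
  have hdiv : ∀ x ∈ S, divergence (fun y => calibration γ a y + Z y) x
      = ((d : ℝ) - 1) / a + divergence Z x := by
    intro x hx
    have hr := h.isRegularPoint_of_mem (hS.subset hx)
    rw [divergence_add ((h.contDiffAt_calibration hr).differentiableAt one_ne_zero)
      (hZ.differentiable one_ne_zero x), h.divergence_calibration hr]
  have hint : IntegrableOn (fun x => ((d : ℝ) - 1) / a + divergence Z x) S :=
    (integrableOn_const hSfin).add (integrable_divergence hZ hZc).integrableOn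
  obtain ⟨C, hC⟩ := (hasCompactSupport_divergence hZc).exists_bound_of_continuous
    (continuous_divergence hZ)
  have key := setIntegral_divergence_le_perimeter (m := d - 1) (by omega) (by omega)
    (Y := fun y => calibration γ a y + Z y) h.isClosed_irregularSet
    (h.hausdorffMeasure_irregularSet (by omega) (by omega) htouch)
    (fun x hx hxB => (h.contDiffAt_calibration (hreg x hx hxB)).add hZ.contDiffAt) hZ1
    h.disjoint_tube_irregularSet hS.subset hS.measurable hS.bounded
    (hint.congr_fun (fun x hx => (hdiv x hx).symm) hS.measurable) (C := ((d : ℝ) - 1) / a + C)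
    (fun x hx => by
      rw [hdiv x hx]
      have := (le_abs_self _).trans (hC x)
      linarith)
  have hcst : IntegrableOn (fun _ => ((d : ℝ) - 1) / a) S := integrableOn_const hSfin
  rw [setIntegral_congr_fun hS.measurable hdiv, integral_add hcst
    (integrable_divergence hZ hZc).integrableOn, setIntegral_const, smul_eq_mul, mul_comm] at key
  exact key

lemma le_perimeter (h : IsTubeAxis γ a) (hd : 2 ≤ d)
    (htouch : d = 2 → Measure.hausdorffMeasure 1 (touchingSet γ a) = 0)
    {S : Set (EuclideanSpace ℝ (Fin d))} (hS : IsCompetitor (tube γ a) S) :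
    ENNReal.ofReal (((d : ℝ) - 1) / a) * volume S ≤ perimeter S := by
  have hSfin : volume S ≠ ⊤ := hS.bounded.measure_lt_top.ne
  have hc : 0 ≤ ((d : ℝ) - 1) / a := by
    have : (2 : ℝ) ≤ d := by exact_mod_cast hd
    exact div_nonneg (by linarith) h.pos.le
  have := h.ofReal_le_perimeter hd htouch hS (Z := fun _ => 0) contDiff_const
    HasCompactSupport.zero (fun x hx => by simpa using (h.norm_calibration_lt hx).le)
  rw [← ofReal_measureReal hSfin, ← ENNReal.ofReal_mul hc]
  simpa [divergence] using this

/-- If equality holds for `S`, then its indicator function has no gradient in the tube, since the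
calibrating field can be perturbed there in every direction. -/
lemma setIntegral_fderiv_eq_zero_of_perimeter_le (h : IsTubeAxis γ a) (hd : 2 ≤ d)
    (htouch : d = 2 → Measure.hausdorffMeasure 1 (touchingSet γ a) = 0)
    {S : Set (EuclideanSpace ℝ (Fin d))} (hS : IsCompetitor (tube γ a) S)
    (hle : perimeter S ≤ ENNReal.ofReal (((d : ℝ) - 1) / a) * volume S)
    {φ : EuclideanSpace ℝ (Fin d) → ℝ} (hφ : ContDiff ℝ 1 φ) (hφc : HasCompactSupport φ)
    (hφΩ : tsupport φ ⊆ tube γ a) (e : EuclideanSpace ℝ (Fin d)) :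
    ∫ x in S, fderiv ℝ φ x e = 0 := by
  have hSfin : volume S ≠ ⊤ := hS.bounded.measure_lt_top.ne
  have hc : 0 ≤ ((d : ℝ) - 1) / a := by
    have : (2 : ℝ) ≤ d := by exact_mod_cast hd
    exact div_nonneg (by linarith) h.pos.le
  obtain ⟨δ, hδ, hδ1⟩ : ∃ δ > 0, ∀ x ∈ tsupport φ, ‖calibration γ a x‖ ≤ 1 - δ := by
    rcases (tsupport φ).eq_empty_or_nonempty with he | hne
    · exact ⟨1, one_pos, by simp [he]⟩
    · obtain ⟨x, hx, hmax⟩ := IsCompact.exists_isMaxOn hφc hne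
        (f := fun x => ‖calibration γ a x‖) (fun x hx => (h.contDiffAt_calibration
          (h.isRegularPoint_of_mem (hφΩ hx))).continuousAt.norm.continuousWithinAt)
      refine ⟨1 - ‖calibration γ a x‖, sub_pos.2 (h.norm_calibration_lt (hφΩ hx)), fun y hy => ?_⟩
      have : ‖calibration γ a y‖ ≤ ‖calibration γ a x‖ := hmax hy
      linarith
  obtain ⟨M, hM⟩ := hφc.exists_bound_of_continuous hφ.continuous
  set τ := δ / ((|M| + 1) * (‖e‖ + 1)) with hτ
  have hτ0 : 0 < τ := by positivity
  have key : ∀ t : ℝ, |t| = τ → t * ∫ x in S, fderiv ℝ φ x e ≤ 0 := by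
    intro t ht
    have hdivZ : ∀ x, divergence (fun x => φ x • (t • e)) x = t * fderiv ℝ φ x e := fun x => by
      rw [divergence_smul_const (hφ.differentiable one_ne_zero x).hasFDerivAt, map_smul,
        smul_eq_mul]
    have hZ := h.ofReal_le_perimeter hd htouch hS (Z := fun x => φ x • (t • e))
      (hφ.smul contDiff_const) hφc.smul_right (fun x hx => ?_)
    · have h2 := hZ.trans hle
      rw [← ofReal_measureReal hSfin, ← ENNReal.ofReal_mul hc,
        ENNReal.ofReal_le_ofReal_iff (by positivity)] at h2
      simp only [hdivZ] at h2
      rw [integral_const_mul] at h2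
      linarith
    · by_cases hxs : x ∈ tsupport φ
      · refine (norm_add_le _ _).trans ?_
        have e1 := hδ1 x hxs
        have e2 : ‖φ x • t • e‖ ≤ δ := by
          rw [norm_smul, norm_smul, Real.norm_eq_abs t, ht]
          have h3 : ‖φ x‖ ≤ |M| + 1 := (hM x).trans ((le_abs_self M).trans (by linarith))
          calc ‖φ x‖ * (τ * ‖e‖) ≤ (|M| + 1) * (τ * (‖e‖ + 1)) := by
                gcongr; linarith
            _ = δ := by rw [hτ]; field_simp
        linarith
      · rw [image_eq_zero_of_notMem_tsupport hxs, zero_smul, add_zero]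
        exact (h.norm_calibration_lt hx).le
  have k1 := key τ (abs_of_pos hτ0)
  have k2 := key (-τ) (by rw [abs_neg, abs_of_pos hτ0])
  refine le_antisymm ?_ ?_
  · exact nonpos_of_mul_nonpos_right k1 hτ0
  · by_contra! hneg
    have := mul_neg_of_pos_of_neg hτ0 hneg
    linarith

/-- Equality in the isoperimetric inequality would make `S` equal to the unbounded tube up to a
null set. -/
lemma not_perimeter_le (h : IsTubeAxis γ a) (hd : 2 ≤ d)
    (htouch : d = 2 → Measure.hausdorffMeasure 1 (touchingSet γ a) = 0)
    (hunb : ¬ Bornology.IsBounded (range γ))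
    {S : Set (EuclideanSpace ℝ (Fin d))} (hS : IsCompetitor (tube γ a) S) :
    ¬ perimeter S ≤ ENNReal.ofReal (((d : ℝ) - 1) / a) * volume S := by
  intro hle
  rcases null_or_null_of_isPreconnected (isOpen_tube γ a) h.isPreconnected_tube hS.measurable
    hS.subset (fun φ h1 h2 h3 e =>
      h.setIntegral_fderiv_eq_zero_of_perimeter_le hd htouch hS hle h1 h2 h3 e) with h0 | h0
  · exact hS.volume_ne_zero h0
  · obtain ⟨R, hR⟩ := hS.bounded.subset_closedBall (0 : EuclideanSpace ℝ (Fin d))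
    obtain ⟨x, hx, hxR⟩ : ∃ x ∈ range γ, x ∉ Metric.closedBall (0 : EuclideanSpace ℝ (Fin d)) R := by
      by_contra! hcon
      exact hunb (Metric.isBounded_closedBall.subset hcon)
    have hopen : IsOpen (tube γ a \ Metric.closedBall (0 : EuclideanSpace ℝ (Fin d)) R) :=
      (isOpen_tube γ a).sdiff Metric.isClosed_closedBall
    refine (hopen.measure_pos volume ⟨x, h.range_subset_tube hx, hxR⟩).ne' ?_
    exact measure_mono_null (sdiff_subset_sdiff_right hR) h0

end IsTubeAxis

/-! ### Integral identities for weights on the tube -/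

/-- The primitive of a continuous function with vanishing integral and support in `[-M, M]`. -/
lemma exists_primitive {α : ℝ → ℝ} {M : ℝ} (hα : Continuous α)
    (hα0 : ∀ s ∉ Icc (-M) M, α s = 0) (hint : ∫ s in (-M)..M, α s = 0) :
    ∃ A : ℝ → ℝ, ContDiff ℝ 1 A ∧ (∀ s, HasDerivAt A (α s) s) ∧ ∀ s ∉ Icc (-M) M, A s = 0 := by
  have hder : ∀ s, HasDerivAt (fun s => ∫ t in (-M)..s, α t) (α s) s := fun s =>
    intervalIntegral.integral_hasDerivAt_right (hα.intervalIntegrable _ _)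
      (hα.stronglyMeasurableAtFilter _ _) hα.continuousAt
  refine ⟨fun s => ∫ t in (-M)..s, α t, contDiff_one_iff_deriv.2
    ⟨fun s => (hder s).differentiableAt, ?_⟩, hder, fun s hs => ?_⟩
  · rwa [show deriv (fun s => ∫ t in (-M)..s, α t) = α from funext fun s => (hder s).deriv]
  · rcases not_and_or.1 hs with h1 | h1
    · rw [not_le] at h1
      change ∫ t in (-M)..s, α t = 0
      rw [intervalIntegral.integral_symm, intervalIntegral.integral_of_le h1.le,
        ← integral_Ico_eq_integral_Ioc, setIntegral_eq_zero_of_forall_eq_zero, neg_zero]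
      intro t ht
      exact hα0 t fun h => absurd h.1 (not_le.2 ht.2)
    · rw [not_le] at h1
      change ∫ t in (-M)..s, α t = 0
      rw [← intervalIntegral.integral_add_adjacent_intervals (hα.intervalIntegrable (-M) M)
        (hα.intervalIntegrable M s), hint, zero_add, intervalIntegral.integral_of_le h1.le]
      refine setIntegral_eq_zero_of_forall_eq_zero fun t ht => ?_
      exact hα0 t fun h => absurd h.2 (not_le.2 ht.1)

/-- The integral theorem for a divergence, with the domain of integration restricted to an open set
containing the support. -/
lemma setIntegral_divergence_eq_zero {d : ℕ} {Ω K : Set (EuclideanSpace ℝ (Fin d))}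
    {X : EuclideanSpace ℝ (Fin d) → EuclideanSpace ℝ (Fin d)}
    (hK : IsCompact K) (hKΩ : K ⊆ Ω) (hX : ∀ x ∈ Ω, ContDiffAt ℝ 1 X x)
    (h0 : ∀ x, x ∉ K → X x = 0) : ∫ x in Ω, divergence X x = 0 := by
  rw [setIntegral_eq_integral_of_forall_compl_eq_zero,
    integral_divergence_eq_zero_of_isCompact hK hKΩ hX h0]
  intro x hx
  refine divergence_eq_zero_of_notMem_tsupport fun hxs => hx (hKΩ ?_)
  refine closure_minimal (fun y hy => ?_) hK.isClosed hxs
  by_contra hcon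
  exact hy (h0 y hcon)

lemma ContinuousOn.integrableOn_of_eq_zero_off_compact {d : ℕ}
    {Ω K : Set (EuclideanSpace ℝ (Fin d))} {g : EuclideanSpace ℝ (Fin d) → ℝ}
    (hg : ContinuousOn g Ω) (hΩ : MeasurableSet Ω) (hK : IsCompact K) (hKΩ : K ⊆ Ω)
    (h0 : ∀ x, x ∉ K → g x = 0) : IntegrableOn g Ω :=
  ((hg.mono hKΩ).integrableOn_compact hK).of_forall_sdiff_eq_zero hΩ fun x hx => h0 x hx.2

/-- The closed tube of radius `b` over the parameters in `[-M, M]`. -/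
def tubeSegment {d : ℕ} (γ : ℝ → EuclideanSpace ℝ (Fin d)) (b M : ℝ) :
    Set (EuclideanSpace ℝ (Fin d)) :=
  {x | ‖normalPart γ x‖ ≤ b ∧ nearestParam γ x ∈ Icc (-M) M}

/-- A radial profile: a nonnegative `C¹` function of the squared distance to the curve, supported
in the tube of radius `b`. -/
structure IsProfile (β : ℝ → ℝ) (b : ℝ) : Prop where
  contDiff : ContDiff ℝ 1 β
  nonneg : ∀ t, 0 ≤ β t
  eq_zero : ∀ t, b ^ 2 ≤ t → β t = 0

/-- A longitudinal weight: a continuous function of the parameter with support in `[-M, M]`. -/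
structure IsWeight (α : ℝ → ℝ) (M : ℝ) : Prop where
  continuous : Continuous α
  eq_zero : ∀ s ∉ Icc (-M) M, α s = 0

lemma IsProfile.deriv_eq_zero {β : ℝ → ℝ} {b : ℝ} (hβ : IsProfile β b) {t : ℝ} (ht : b ^ 2 < t) :
    deriv β t = 0 := by
  have : β =ᶠ[𝓝 t] fun _ => 0 := by
    filter_upwards [lt_mem_nhds ht] with u hu using hβ.eq_zero u hu.le
  rw [this.deriv_eq, deriv_const]

namespace IsTubeAxis

variable {d : ℕ} {γ : ℝ → EuclideanSpace ℝ (Fin d)} {a : ℝ}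

lemma tubeSegment_subset (h : IsTubeAxis γ a) {b : ℝ} (hb : b < a) (M : ℝ) :
    tubeSegment γ b M ⊆ tube γ a := fun _ hx => h.mem_tube_iff.2 (hx.1.trans_lt hb)

lemma continuousOn_nearestParam (h : IsTubeAxis γ a) :
    ContinuousOn (nearestParam γ) (tube γ a) := fun _ hx =>
  (h.contDiffAt_nearestParam_of_mem hx).continuousAt.continuousWithinAt

lemma continuousOn_normalPart (h : IsTubeAxis γ a) :
    ContinuousOn (normalPart γ) (tube γ a) := fun _ hx =>
  (h.contDiffAt_normalPart (h.contDiffAt_nearestParam_of_mem hx)).continuousAt.continuousWithinAt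

lemma continuousOn_tubeJacobian_inv (h : IsTubeAxis γ a) :
    ContinuousOn (fun x => (tubeJacobian γ x)⁻¹) (tube γ a) := fun _ hx =>
  ((h.contDiffAt_tubeJacobian
    (h.contDiffAt_nearestParam_of_mem hx)).continuousAt.inv₀
      (h.tubeJacobian_pos hx).ne').continuousWithinAt

lemma isBounded_setOf_nearestParam_mem (h : IsTubeAxis γ a) (M : ℝ) :
    Bornology.IsBounded {x | x ∈ tube γ a ∧ nearestParam γ x ∈ Icc (-M) M} := by
  obtain ⟨C, hC⟩ := (isCompact_Icc (a := -M) (b := M)).exists_bound_of_continuousOn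
    h.continuous.continuousOn
  refine isBounded_iff_forall_norm_le.2 ⟨C + a, fun x hx => ?_⟩
  have h1 := hC _ hx.2
  have h2 := h.mem_tube_iff.1 hx.1
  calc ‖x‖ = ‖γ (nearestParam γ x) + normalPart γ x‖ := by rw [normalPart, add_sub_cancel]
    _ ≤ _ := (norm_add_le _ _).trans (by linarith)

lemma isCompact_tubeSegment (h : IsTubeAxis γ a) {b : ℝ} (hb : b < a) (M : ℝ) :
    IsCompact (tubeSegment γ b M) := by
  refine Metric.isCompact_of_isClosed_isBounded ?_ ((h.isBounded_setOf_nearestParam_mem M).subset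
    fun x hx => ⟨h.tubeSegment_subset hb M hx, hx.2⟩)
  have h1 : IsClosed {x | ‖normalPart γ x‖ ≤ b} := by
    simp only [h.norm_normalPart]
    exact isClosed_le (Metric.continuous_infDist_pt _) continuous_const
  exact (h.continuousOn_nearestParam.mono fun x hx =>
    h.mem_tube_iff.2 (lt_of_le_of_lt hx hb)).preimage_isClosed_of_isClosed h1 isClosed_Icc

lemma mul_eq_zero_of_notMem_tubeSegment {α β : ℝ → ℝ} {b M : ℝ} (hb : 0 ≤ b)
    (hα0 : ∀ s ∉ Icc (-M) M, α s = 0) (hβ0 : ∀ t, b ^ 2 < t → β t = 0)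
    {x : EuclideanSpace ℝ (Fin d)} (hx : x ∉ tubeSegment γ b M) :
    α (nearestParam γ x) * β (‖normalPart γ x‖ ^ 2) = 0 := by
  rcases not_and_or.1 hx with h1 | h1
  · rw [hβ0 _ (by rw [not_le] at h1; gcongr), mul_zero]
  · rw [hα0 _ h1, zero_mul]

lemma integrableOn_weight (h : IsTubeAxis γ a) {α β : ℝ → ℝ} {b M : ℝ} (hb : 0 ≤ b) (hba : b < a)
    (hα : IsWeight α M) (hβ : Continuous β) (hβ0 : ∀ t, b ^ 2 < t → β t = 0)
    {g : EuclideanSpace ℝ (Fin d) → ℝ} (hg : ContinuousOn g (tube γ a)) :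
    IntegrableOn (fun x => α (nearestParam γ x) * β (‖normalPart γ x‖ ^ 2) * g x) (tube γ a) := by
  refine ContinuousOn.integrableOn_of_eq_zero_off_compact ?_ (isOpen_tube γ a).measurableSet
    (h.isCompact_tubeSegment hba M) (h.tubeSegment_subset hba M) fun x hx => by
      rw [mul_eq_zero_of_notMem_tubeSegment hb hα.eq_zero hβ0 hx, zero_mul]
  exact ((hα.continuous.comp_continuousOn h.continuousOn_nearestParam).mul
    (hβ.comp_continuousOn (h.continuousOn_normalPart.norm.pow 2))).mul hg

lemma contDiffAt_weight (h : IsTubeAxis γ a) {A β : ℝ → ℝ} (hA : ContDiff ℝ 1 A)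
    (hβ : ContDiff ℝ 1 β) {x : EuclideanSpace ℝ (Fin d)} (hx : IsRegularPoint γ x) :
    ContDiffAt ℝ 1 (fun y => A (nearestParam γ y) * β (‖normalPart γ y‖ ^ 2)) x :=
  (contDiffAt_comp_nearestParam hA hx.1).mul
    (hβ.contDiffAt.comp x ((h.contDiffAt_normalPart hx.1).norm_sq ℝ))

lemma hasFDerivAt_weight (h : IsTubeAxis γ a) {A β : ℝ → ℝ} {A' β' : ℝ}
    {x : EuclideanSpace ℝ (Fin d)} (hx : IsRegularPoint γ x)
    (hA : HasDerivAt A A' (nearestParam γ x)) (hβ : HasDerivAt β β' (‖normalPart γ x‖ ^ 2)) :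
    HasFDerivAt (fun y => A (nearestParam γ y) * β (‖normalPart γ y‖ ^ 2))
      ((A (nearestParam γ x) * (β' * 2)) • innerSL ℝ (normalPart γ x) +
        (A' * β (‖normalPart γ x‖ ^ 2) * (tubeJacobian γ x)⁻¹) •
          innerSL ℝ (deriv γ (nearestParam γ x))) x := by
  refine ((h.hasFDerivAt_comp_nearestParam hx hA).fun_mul
    (h.hasFDerivAt_comp_norm_sq hx hβ)).congr_fderiv ?_
  rw [smul_smul, smul_smul]
  congr 2
  ring

/-- Weights of integral zero: integrate the divergence of `A(σ) β(‖v‖²) T`, where `A' = α`. -/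
lemma setIntegral_weight_mul_inv_jacobian_eq_zero (h : IsTubeAxis γ a) {α β : ℝ → ℝ} {b M : ℝ}
    (hb : 0 ≤ b) (hba : b < a) (hα : IsWeight α M) (hβ : IsProfile β b)
    (hint : ∫ s in (-M)..M, α s = 0) :
    ∫ x in tube γ a, α (nearestParam γ x) * β (‖normalPart γ x‖ ^ 2) * (tubeJacobian γ x)⁻¹
      = 0 := by
  obtain ⟨A, hA, hA', hA0⟩ := exists_primitive hα.continuous hα.eq_zero hint
  rw [← setIntegral_divergence_eq_zero (X := fun y =>
      (A (nearestParam γ y) * β (‖normalPart γ y‖ ^ 2)) • deriv γ (nearestParam γ y))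
    (h.isCompact_tubeSegment hba M) (h.tubeSegment_subset hba M) (fun x hx => ?_) (fun x hx => ?_)]
  · refine setIntegral_congr_fun (isOpen_tube γ a).measurableSet fun x hx => ?_
    have hr := h.isRegularPoint_of_mem hx
    have hw := h.hasFDerivAt_weight hr (hA' _)
      (hβ.contDiff.differentiable one_ne_zero _).hasDerivAt
    rw [divergence_smul hw
      ((contDiffAt_comp_nearestParam (h.contDiff_deriv.of_le (by simp)) hr.1).differentiableAt
        one_ne_zero), h.divergence_tangent hr]
    simp [h.inner_normalPart, h.unit_speed]
  · have hr := h.isRegularPoint_of_mem hx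
    exact (h.contDiffAt_weight hA hβ.contDiff hr).smul
      (contDiffAt_comp_nearestParam (h.contDiff_deriv.of_le (by simp)) hr.1)
  · rw [mul_eq_zero_of_notMem_tubeSegment hb hA0 (fun t ht => hβ.eq_zero t ht.le) hx, zero_smul]

/-- The Jacobian averages out over normal discs: integrate the divergence of `α(σ) q(‖v‖²) κ / f`,
where `2 q' = β`. -/
lemma setIntegral_weight_mul_inv_jacobian (h : IsTubeAxis γ a) {α β : ℝ → ℝ} {b M : ℝ}
    (hb : 0 ≤ b) (hba : b < a) (hα : IsWeight α M) (hα1 : ContDiff ℝ 1 α) (hβ : IsProfile β b) :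
    ∫ x in tube γ a, α (nearestParam γ x) * β (‖normalPart γ x‖ ^ 2) * (tubeJacobian γ x)⁻¹
      = ∫ x in tube γ a, α (nearestParam γ x) * β (‖normalPart γ x‖ ^ 2) := by
  have hβc := hβ.contDiff.continuous
  have hq : ∀ t, HasDerivAt (fun t => 1 / 2 * ∫ u in (b ^ 2)..t, β u) (1 / 2 * β t) t := fun t =>
    (intervalIntegral.integral_hasDerivAt_right (hβc.intervalIntegrable _ _)
      (hβc.stronglyMeasurableAtFilter _ _) hβc.continuousAt).const_mul _
  set q : ℝ → ℝ := fun t => 1 / 2 * ∫ u in (b ^ 2)..t, β u with hqdef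
  have hq1 : ContDiff ℝ 1 q := contDiff_one_iff_deriv.2
    ⟨fun t => (hq t).differentiableAt, by
      rw [show deriv q = fun t => 1 / 2 * β t from funext fun t => (hq t).deriv]
      fun_prop⟩
  have hq0 : ∀ t, b ^ 2 < t → q t = 0 := by
    intro t ht
    simp only [hqdef]
    rw [intervalIntegral.integral_of_le ht.le, setIntegral_eq_zero_of_forall_eq_zero, mul_zero]
    exact fun u hu => hβ.eq_zero u hu.1.le
  have hβ0 : ∀ t, b ^ 2 < t → β t = 0 := fun t ht => hβ.eq_zero t ht.le
  have i1 := h.integrableOn_weight hb hba hα hβc hβ0 h.continuousOn_tubeJacobian_inv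
  have i2 := h.integrableOn_weight hb hba hα hβc hβ0 (continuousOn_const (c := (1 : ℝ)))
  simp only [mul_one] at i2
  rw [← sub_eq_zero, ← integral_sub i1 i2,
    ← setIntegral_divergence_eq_zero (X := fun y =>
      (α (nearestParam γ y) * q (‖normalPart γ y‖ ^ 2)) • curvatureField γ y)
    (h.isCompact_tubeSegment hba M) (h.tubeSegment_subset hba M) (fun x hx => ?_) (fun x hx => ?_)]
  · refine setIntegral_congr_fun (isOpen_tube γ a).measurableSet fun x hx => ?_
    have hr := h.isRegularPoint_of_mem hx
    have hw := h.hasFDerivAt_weight hr (hα1.differentiable one_ne_zero _).hasDerivAt (hq _)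
    rw [divergence_smul hw ((h.contDiffAt_curvatureField hr).differentiableAt one_ne_zero),
      h.divergence_curvatureField hr]
    simp [h.inner_tangent_curvatureField, inner_normalPart_curvatureField hr.2]
    ring
  · have hr := h.isRegularPoint_of_mem hx
    exact (h.contDiffAt_weight hα1 hq1 hr).smul (h.contDiffAt_curvatureField hr)
  · rw [mul_eq_zero_of_notMem_tubeSegment hb hα.eq_zero hq0 hx, zero_smul]

/-- The integral of the divergence of `α(σ) β(‖v‖²) v`, which links the lateral variation of a
weight to its mass. -/
lemma setIntegral_weight_deriv (h : IsTubeAxis γ a) {α β : ℝ → ℝ} {b M : ℝ}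
    (hb : 0 ≤ b) (hba : b < a) (hα : IsWeight α M) (hα1 : ContDiff ℝ 1 α) (hβ : IsProfile β b) :
    ∫ x in tube γ a, α (nearestParam γ x) * deriv β (‖normalPart γ x‖ ^ 2) *
        (2 * ‖normalPart γ x‖ ^ 2)
      = -(((d : ℝ) - 1) *
        ∫ x in tube γ a, α (nearestParam γ x) * β (‖normalPart γ x‖ ^ 2)) := by
  have hβc := hβ.contDiff.continuous
  have hβ0 : ∀ t, b ^ 2 < t → β t = 0 := fun t ht => hβ.eq_zero t ht.le
  have i1 := h.integrableOn_weight hb hba hα hβc hβ0 h.continuousOn_tubeJacobian_inv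
  have i2 := h.integrableOn_weight hb hba hα hβc hβ0 (continuousOn_const (c := (d : ℝ)))
  have hsq : ContinuousOn (fun x => 2 * ‖normalPart γ x‖ ^ 2) (tube γ a) :=
    (h.continuousOn_normalPart.norm.pow 2).const_mul 2
  have i3 := h.integrableOn_weight hb hba hα (hβ.contDiff.continuous_deriv le_rfl)
    (fun t ht => hβ.deriv_eq_zero ht) hsq
  have key := setIntegral_divergence_eq_zero (X := fun y =>
      (α (nearestParam γ y) * β (‖normalPart γ y‖ ^ 2)) • normalPart γ y)
    (h.isCompact_tubeSegment hba M) (h.tubeSegment_subset hba M) (fun x hx => by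
      have hr := h.isRegularPoint_of_mem hx
      exact (h.contDiffAt_weight hα1 hβ.contDiff hr).smul (h.contDiffAt_normalPart hr.1))
    (fun x hx => by
      rw [mul_eq_zero_of_notMem_tubeSegment hb hα.eq_zero hβ0 hx, zero_smul])
  have i12 : IntegrableOn (fun x => α (nearestParam γ x) * β (‖normalPart γ x‖ ^ 2) * d -
      α (nearestParam γ x) * β (‖normalPart γ x‖ ^ 2) * (tubeJacobian γ x)⁻¹) (tube γ a) :=
    i2.sub i1
  have hdiv : ∀ x ∈ tube γ a, divergence (fun y =>
      (α (nearestParam γ y) * β (‖normalPart γ y‖ ^ 2)) • normalPart γ y) x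
      = (α (nearestParam γ x) * β (‖normalPart γ x‖ ^ 2) * d -
        α (nearestParam γ x) * β (‖normalPart γ x‖ ^ 2) * (tubeJacobian γ x)⁻¹) +
        α (nearestParam γ x) * deriv β (‖normalPart γ x‖ ^ 2) * (2 * ‖normalPart γ x‖ ^ 2) := by
    intro x hx
    have hr := h.isRegularPoint_of_mem hx
    have hw := h.hasFDerivAt_weight hr (hα1.differentiable one_ne_zero _).hasDerivAt
      (hβ.contDiff.differentiable one_ne_zero _).hasDerivAt
    rw [divergence_smul hw ((h.contDiffAt_normalPart hr.1).differentiableAt one_ne_zero),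
      h.divergence_normalPart hr]
    have h1 : inner ℝ (deriv γ (nearestParam γ x)) (normalPart γ x) = 0 := by
      rw [real_inner_comm, h.inner_normalPart]
    simp [h1]
    ring
  rw [setIntegral_congr_fun (isOpen_tube γ a).measurableSet hdiv, integral_add i12 i3,
    integral_sub i2 i1, h.setIntegral_weight_mul_inv_jacobian hb hba hα hα1 hβ,
    integral_mul_const] at key
  linarith

end IsTubeAxis

/-! ### The upper bound by truncated tubes -/

namespace IsTubeAxis

variable {d : ℕ} {γ : ℝ → EuclideanSpace ℝ (Fin d)} {a : ℝ}

/-- The mass of a weight over a unit of length does not depend on the longitudinal profile. -/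
lemma setIntegral_weight_inv_jacobian_eq (h : IsTubeAxis γ a) {α φ β : ℝ → ℝ} {b M ℓ : ℝ}
    (hb : 0 ≤ b) (hba : b < a) (hα : IsWeight α M) (hα1 : ContDiff ℝ 1 α) (hφ : IsWeight φ M)
    (hβ : IsProfile β b) (hℓ : ∫ s in (-M)..M, α s = ℓ * ∫ s in (-M)..M, φ s) :
    ℓ * ∫ x in tube γ a, φ (nearestParam γ x) * β (‖normalPart γ x‖ ^ 2) * (tubeJacobian γ x)⁻¹
      = ∫ x in tube γ a, α (nearestParam γ x) * β (‖normalPart γ x‖ ^ 2) := by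
  have hβ0 : ∀ t, b ^ 2 < t → β t = 0 := fun t ht => hβ.eq_zero t ht.le
  have hw : IsWeight (fun s => α s - ℓ * φ s) M :=
    ⟨hα.continuous.sub (hφ.continuous.const_mul ℓ),
      fun s hs => by rw [hα.eq_zero s hs, hφ.eq_zero s hs, mul_zero, sub_zero]⟩
  have i1 := h.integrableOn_weight hb hba hα hβ.contDiff.continuous hβ0
    h.continuousOn_tubeJacobian_inv
  have i2 := h.integrableOn_weight hb hba hφ hβ.contDiff.continuous hβ0
    h.continuousOn_tubeJacobian_inv
  have key := h.setIntegral_weight_mul_inv_jacobian_eq_zero hb hba hw hβ (by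
    rw [intervalIntegral.integral_sub (hα.continuous.intervalIntegrable _ _)
      ((hφ.continuous.const_mul ℓ).intervalIntegrable _ _), intervalIntegral.integral_const_mul,
      hℓ, sub_self])
  rw [← h.setIntegral_weight_mul_inv_jacobian hb hba hα hα1 hβ, ← integral_const_mul]
  rw [← sub_eq_zero, ← integral_sub (i2.const_mul ℓ) i1, ← neg_eq_zero, ← integral_neg, ← key]
  refine integral_congr_ae (Eventually.of_forall fun x => ?_)
  change -(ℓ * _ - _) = _
  ring

/-- The variation of a smooth weight with one ascent and one descent over a length `ℓ`, and with a
profile that is constant up to the radius `p`. -/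
lemma setIntegral_weight_mul_divergence_le (h : IsTubeAxis γ a) {α φ₁ φ₂ β : ℝ → ℝ}
    {b p M ℓ : ℝ} (hp : 0 < p) (hb : 0 ≤ b) (hba : b < a) (hα : IsWeight α M)
    (hφ₁ : IsWeight φ₁ M) (hφ₂ : IsWeight φ₂ M) (hα' : ∀ s, HasDerivAt α (φ₁ s - φ₂ s) s)
    (hα0 : ∀ s, 0 ≤ α s) (hφ₁0 : ∀ s, 0 ≤ φ₁ s) (hφ₂0 : ∀ s, 0 ≤ φ₂ s) (hβ : IsProfile β b)
    (hβ' : ∀ t, deriv β t ≤ 0) (hβp : ∀ t, t < p ^ 2 → deriv β t = 0)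
    (hℓ : 0 < ℓ) (h1 : ∫ s in (-M)..M, α s = ℓ * ∫ s in (-M)..M, φ₁ s)
    (h2 : ∫ s in (-M)..M, α s = ℓ * ∫ s in (-M)..M, φ₂ s)
    {X : EuclideanSpace ℝ (Fin d) → EuclideanSpace ℝ (Fin d)} (hX : ContDiff ℝ 1 X)
    (hX1 : ∀ x, ‖X x‖ ≤ 1) :
    ∫ x in tube γ a, α (nearestParam γ x) * β (‖normalPart γ x‖ ^ 2) * divergence X x
      ≤ (2 / ℓ + ((d : ℝ) - 1) / p) *
        ∫ x in tube γ a, α (nearestParam γ x) * β (‖normalPart γ x‖ ^ 2) := by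
  have hα1 : ContDiff ℝ 1 α := contDiff_one_iff_deriv.2 ⟨fun s => (hα' s).differentiableAt, by
    rw [show deriv α = fun s => φ₁ s - φ₂ s from funext fun s => (hα' s).deriv]
    exact hφ₁.continuous.sub hφ₂.continuous⟩
  have hφ : IsWeight (fun s => φ₁ s - φ₂ s) M := ⟨hφ₁.continuous.sub hφ₂.continuous,
    fun s hs => by rw [hφ₁.eq_zero s hs, hφ₂.eq_zero s hs, sub_zero]⟩
  have hβc := hβ.contDiff.continuous
  have hβ'c : Continuous (deriv β) := hβ.contDiff.continuous_deriv le_rfl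
  have hβ0 : ∀ t, b ^ 2 < t → β t = 0 := fun t ht => hβ.eq_zero t ht.le
  have hβ'0 : ∀ t, b ^ 2 < t → deriv β t = 0 := fun t ht => hβ.deriv_eq_zero ht
  have hT : ContinuousOn (fun x => (tubeJacobian γ x)⁻¹ *
      inner ℝ (deriv γ (nearestParam γ x)) (X x)) (tube γ a) :=
    h.continuousOn_tubeJacobian_inv.mul ((h.contDiff_deriv.continuous.comp_continuousOn
      h.continuousOn_nearestParam).inner hX.continuous.continuousOn)
  have hv : ContinuousOn (fun x => 2 * inner ℝ (normalPart γ x) (X x)) (tube γ a) :=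
    (h.continuousOn_normalPart.inner hX.continuous.continuousOn).const_mul 2
  have hsq : ContinuousOn (fun x => 2 * ‖normalPart γ x‖ ^ 2) (tube γ a) :=
    (h.continuousOn_normalPart.norm.pow 2).const_mul 2
  have i1 := h.integrableOn_weight hb hba hα hβc hβ0 (continuous_divergence hX).continuousOn
  have i2 := h.integrableOn_weight hb hba hα hβ'c hβ'0 hv
  have i3 := h.integrableOn_weight hb hba hφ hβc hβ0 hT
  have i4 := h.integrableOn_weight hb hba hα hβ'c hβ'0 hsq
  have i5 := h.integrableOn_weight hb hba hφ₁ hβc hβ0 h.continuousOn_tubeJacobian_inv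
  have i6 := h.integrableOn_weight hb hba hφ₂ hβc hβ0 h.continuousOn_tubeJacobian_inv
  have hzero := setIntegral_divergence_eq_zero (X := fun y =>
      (α (nearestParam γ y) * β (‖normalPart γ y‖ ^ 2)) • X y)
    (h.isCompact_tubeSegment hba M) (h.tubeSegment_subset hba M)
    (fun x hx => (h.contDiffAt_weight hα1 hβ.contDiff (h.isRegularPoint_of_mem hx)).smul
      hX.contDiffAt)
    (fun x hx => by rw [mul_eq_zero_of_notMem_tubeSegment hb hα.eq_zero hβ0 hx, zero_smul])
  have hdiv : ∀ x ∈ tube γ a, divergence (fun y =>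
      (α (nearestParam γ y) * β (‖normalPart γ y‖ ^ 2)) • X y) x
      = α (nearestParam γ x) * β (‖normalPart γ x‖ ^ 2) * divergence X x +
        (α (nearestParam γ x) * deriv β (‖normalPart γ x‖ ^ 2) *
            (2 * inner ℝ (normalPart γ x) (X x)) +
          (φ₁ (nearestParam γ x) - φ₂ (nearestParam γ x)) * β (‖normalPart γ x‖ ^ 2) *
            ((tubeJacobian γ x)⁻¹ * inner ℝ (deriv γ (nearestParam γ x)) (X x))) := by
    intro x hx
    have hw := h.hasFDerivAt_weight (h.isRegularPoint_of_mem hx) (hα' _)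
      (hβ.contDiff.differentiable one_ne_zero _).hasDerivAt
    rw [divergence_smul hw (hX.differentiable one_ne_zero x)]
    simp
    ring
  rw [setIntegral_congr_fun (isOpen_tube γ a).measurableSet hdiv] at hzero
  have i23 := i2.add i3
  have hsplit := integral_add i1 i23
  have hle : -∫ x in tube γ a, (α (nearestParam γ x) * deriv β (‖normalPart γ x‖ ^ 2) *
            (2 * inner ℝ (normalPart γ x) (X x)) +
          (φ₁ (nearestParam γ x) - φ₂ (nearestParam γ x)) * β (‖normalPart γ x‖ ^ 2) *
            ((tubeJacobian γ x)⁻¹ * inner ℝ (deriv γ (nearestParam γ x)) (X x)))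
      ≤ ∫ x in tube γ a, ((-p⁻¹) * (α (nearestParam γ x) * deriv β (‖normalPart γ x‖ ^ 2) *
            (2 * ‖normalPart γ x‖ ^ 2)) +
          (φ₁ (nearestParam γ x) * β (‖normalPart γ x‖ ^ 2) * (tubeJacobian γ x)⁻¹ +
            φ₂ (nearestParam γ x) * β (‖normalPart γ x‖ ^ 2) * (tubeJacobian γ x)⁻¹)) := by
    rw [← integral_neg]
    refine setIntegral_mono_on i23.neg ((i4.const_mul _).add (i5.add i6))
      (isOpen_tube γ a).measurableSet fun x hx => ?_
    have hf : 0 < (tubeJacobian γ x)⁻¹ := inv_pos.2 (h.tubeJacobian_pos hx)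
    have e1 : |inner ℝ (deriv γ (nearestParam γ x)) (X x)| ≤ 1 := by
      refine (abs_real_inner_le_norm _ _).trans ?_
      rw [h.unit_speed, one_mul]
      exact hX1 x
    have e2 : inner ℝ (normalPart γ x) (X x) ≤ ‖normalPart γ x‖ := by
      refine (real_inner_le_norm _ _).trans (mul_le_of_le_one_right (norm_nonneg _) (hX1 x))
    have e3 : -(α (nearestParam γ x) * deriv β (‖normalPart γ x‖ ^ 2) *
        (2 * inner ℝ (normalPart γ x) (X x))) ≤
        (-p⁻¹) * (α (nearestParam γ x) * deriv β (‖normalPart γ x‖ ^ 2) *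
          (2 * ‖normalPart γ x‖ ^ 2)) := by
      rcases lt_or_ge (‖normalPart γ x‖ ^ 2) (p ^ 2) with hlt | hge
      · simp [hβp _ hlt]
      · have hpv : p ≤ ‖normalPart γ x‖ := (sq_le_sq₀ hp.le (norm_nonneg _)).1 hge
        have e4 : inner ℝ (normalPart γ x) (X x) ≤ p⁻¹ * ‖normalPart γ x‖ ^ 2 := by
          refine e2.trans ?_
          rw [inv_mul_eq_div, le_div_iff₀ hp, sq]
          gcongr
        have e5 : 0 ≤ α (nearestParam γ x) * -deriv β (‖normalPart γ x‖ ^ 2) :=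
          mul_nonneg (hα0 _) (by linarith [hβ' (‖normalPart γ x‖ ^ 2)])
        have := mul_le_mul_of_nonneg_left e4 e5
        linarith
    have e6 : -((φ₁ (nearestParam γ x) - φ₂ (nearestParam γ x)) * β (‖normalPart γ x‖ ^ 2) *
        ((tubeJacobian γ x)⁻¹ * inner ℝ (deriv γ (nearestParam γ x)) (X x))) ≤
        φ₁ (nearestParam γ x) * β (‖normalPart γ x‖ ^ 2) * (tubeJacobian γ x)⁻¹ +
          φ₂ (nearestParam γ x) * β (‖normalPart γ x‖ ^ 2) * (tubeJacobian γ x)⁻¹ := by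
      have e7 : 0 ≤ β (‖normalPart γ x‖ ^ 2) * (tubeJacobian γ x)⁻¹ := mul_nonneg (hβ.nonneg _) hf.le
      have e8 : -((φ₁ (nearestParam γ x) - φ₂ (nearestParam γ x)) *
          inner ℝ (deriv γ (nearestParam γ x)) (X x)) ≤
          φ₁ (nearestParam γ x) + φ₂ (nearestParam γ x) := by
        have f1 := abs_le.1 e1
        have f2 := mul_nonneg (hφ₁0 (nearestParam γ x)) (by linarith [f1.1] :
          0 ≤ 1 + inner ℝ (deriv γ (nearestParam γ x)) (X x))
        have f3 := mul_nonneg (hφ₂0 (nearestParam γ x)) (by linarith [f1.2] :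
          0 ≤ 1 - inner ℝ (deriv γ (nearestParam γ x)) (X x))
        linarith
      have := mul_le_mul_of_nonneg_right e8 e7
      linarith
    change -(_ + _) ≤ _ * _ + (_ + _)
    linarith
  have hsum := integral_add (i4.const_mul (-p⁻¹)) (i5.add i6)
  have hsum' := integral_add i5 i6
  rw [integral_const_mul, h.setIntegral_weight_deriv hb hba hα hα1 hβ] at hsum
  have m1 := h.setIntegral_weight_inv_jacobian_eq hb hba hα hα1 hφ₁ hβ h1
  have m2 := h.setIntegral_weight_inv_jacobian_eq hb hba hα hα1 hφ₂ hβ h2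
  simp only [Pi.add_apply] at hsplit hsum hsum'
  rw [hsum, hsum'] at hle
  rw [hzero] at hsplit
  set I := ∫ x in tube γ a, α (nearestParam γ x) * β (‖normalPart γ x‖ ^ 2)
  rw [(eq_div_iff hℓ.ne').2 ((mul_comm _ _).trans m1),
    (eq_div_iff hℓ.ne').2 ((mul_comm _ _).trans m2)] at hle
  have : (2 / ℓ + ((d : ℝ) - 1) / p) * I = -p⁻¹ * -((d - 1) * I) + (I / ℓ + I / ℓ) := by
    field_simp
    ring
  rw [this]
  linarith

end IsTubeAxis

lemma exists_profile {p b : ℝ} (hp : 0 < p) (hpb : p < b) :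
    ∃ β : ℝ → ℝ, IsProfile β b ∧ (∀ t, β t ≤ 1) ∧ (∀ t, deriv β t ≤ 0) ∧
      (∀ t, t < p ^ 2 → deriv β t = 0) ∧ ∀ t, t ≤ p ^ 2 → β t = 1 := by
  have hsq : 0 < b ^ 2 - p ^ 2 := by nlinarith
  have hone : ∀ t, t ≤ p ^ 2 → Real.smoothTransition ((b ^ 2 - t) / (b ^ 2 - p ^ 2)) = 1 :=
    fun t ht => Real.smoothTransition.one_of_one_le ((one_le_div hsq).2 (by linarith))
  refine ⟨fun t => Real.smoothTransition ((b ^ 2 - t) / (b ^ 2 - p ^ 2)), ⟨?_, ?_, ?_⟩, ?_, ?_, ?_,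
    hone⟩
  · exact Real.smoothTransition.contDiff.comp (by fun_prop)
  · exact fun t => Real.smoothTransition.nonneg _
  · exact fun t ht => Real.smoothTransition.zero_of_nonpos
      (div_nonpos_of_nonpos_of_nonneg (by linarith) hsq.le)
  · exact fun t => Real.smoothTransition.le_one _
  · refine fun t => Antitone.deriv_nonpos fun t u htu => Real.smoothTransition.monotone ?_
    gcongr
  · intro t ht
    have : (fun t => Real.smoothTransition ((b ^ 2 - t) / (b ^ 2 - p ^ 2))) =ᶠ[𝓝 t] fun _ => 1 := by
      filter_upwards [gt_mem_nhds ht] with u hu using hone u hu.le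
    rw [this.deriv_eq, deriv_const]

/-- A weight which rises from zero to one next to the parameter `0` and falls back next to `L`. The
descent is a translate of the ascent, so that its integral is exactly `L`. -/
lemma exists_weight {L ε : ℝ} (hL : 0 < L) (hε : 0 < ε) (hε1 : ε ≤ 1) :
    ∃ α φ₁ φ₂ : ℝ → ℝ, IsWeight α (L + 1) ∧ IsWeight φ₁ (L + 1) ∧ IsWeight φ₂ (L + 1) ∧
      (∀ s, HasDerivAt α (φ₁ s - φ₂ s) s) ∧ (∀ s, 0 ≤ α s ∧ α s ≤ 1) ∧ (∀ s, 0 ≤ φ₁ s) ∧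
      (∀ s, 0 ≤ φ₂ s) ∧ ∫ s in (-(L + 1))..(L + 1), α s = L ∧
      ∫ s in (-(L + 1))..(L + 1), φ₁ s = 1 ∧ ∫ s in (-(L + 1))..(L + 1), φ₂ s = 1 ∧
      (∀ s, s ≤ 0 → α s = 0) ∧ (∀ s, ε ≤ s → s ≤ L → α s = 1) ∧ ∀ s, L + ε ≤ s → α s = 0 := by
  set ψ : ℝ → ℝ := fun s => Real.smoothTransition (s / ε) with hψ
  have hψ1 : ContDiff ℝ 1 ψ := Real.smoothTransition.contDiff.comp (by fun_prop)
  have hψ0 : ∀ s, s ≤ 0 → ψ s = 0 := fun s hs =>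
    Real.smoothTransition.zero_of_nonpos (div_nonpos_of_nonpos_of_nonneg hs hε.le)
  have hψe : ∀ s, ε ≤ s → ψ s = 1 := fun s hs =>
    Real.smoothTransition.one_of_one_le ((one_le_div hε).2 hs)
  have hψm : Monotone ψ := fun s t hst => Real.smoothTransition.monotone (by gcongr)
  have hψnn : ∀ s, 0 ≤ ψ s := fun s => Real.smoothTransition.nonneg _
  have hψle : ∀ s, ψ s ≤ 1 := fun s => Real.smoothTransition.le_one _
  have hψd : ∀ s, HasDerivAt ψ (deriv ψ s) s := fun s =>
    (hψ1.differentiable one_ne_zero s).hasDerivAt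
  have hψd' : ∀ s, HasDerivAt (fun s => ψ (s - L)) (deriv ψ (s - L)) s := fun s =>
    (hψd (s - L)).comp_sub_const s L
  have hψdc : Continuous (deriv ψ) := hψ1.continuous_deriv le_rfl
  have hψd0 : ∀ s, s < 0 ∨ ε < s → deriv ψ s = 0 := by
    rintro s (hs | hs)
    · have : ψ =ᶠ[𝓝 s] fun _ => 0 := by
        filter_upwards [gt_mem_nhds hs] with u hu using hψ0 u hu.le
      rw [this.deriv_eq, deriv_const]
    · have : ψ =ᶠ[𝓝 s] fun _ => 1 := by
        filter_upwards [lt_mem_nhds hs] with u hu using hψe u hu.le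
      rw [this.deriv_eq, deriv_const]
  have hnot : ∀ s ∉ Icc (-(L + 1)) (L + 1), s < -(L + 1) ∨ L + 1 < s := fun s hs => by
    rcases not_and_or.1 hs with h | h
    · exact Or.inl (not_le.1 h)
    · exact Or.inr (not_le.1 h)
  have hψc := hψ1.continuous
  have hz1 : ∀ s, s ≤ 0 → ψ s - ψ (s - L) = 0 := fun s hs => by
    rw [hψ0 s hs, hψ0 _ (by linarith), sub_zero]
  have hz2 : ∀ s, L + ε ≤ s → ψ s - ψ (s - L) = 0 := fun s hs => by
    rw [hψe s (by linarith), hψe _ (by linarith), sub_self]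
  refine ⟨fun s => ψ s - ψ (s - L), deriv ψ, fun s => deriv ψ (s - L), ⟨by fun_prop, ?_⟩,
    ⟨hψdc, ?_⟩, ⟨by fun_prop, ?_⟩, fun s => (hψd s).sub (hψd' s), fun s => ⟨?_, ?_⟩,
    fun s => hψm.deriv_nonneg, fun s => hψm.deriv_nonneg, ?_, ?_, ?_, hz1, ?_, hz2⟩
  · intro s hs
    rcases hnot s hs with h | h
    · exact hz1 s (by linarith)
    · exact hz2 s (by linarith)
  · intro s hs
    refine hψd0 s ?_
    rcases hnot s hs with h | h
    · left; linarith
    · right; linarith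
  · intro s hs
    refine hψd0 _ ?_
    rcases hnot s hs with h | h
    · left; linarith
    · right; linarith
  · exact sub_nonneg.2 (hψm (by linarith))
  · linarith [hψnn (s - L), hψle s]
  · rw [intervalIntegral.integral_sub (hψc.intervalIntegrable _ _)
      (Continuous.intervalIntegrable (by fun_prop) _ _),
      intervalIntegral.integral_comp_sub_right ψ L,
      intervalIntegral.integral_interval_sub_interval_comm (hψc.intervalIntegrable _ _)
        (hψc.intervalIntegrable _ _) (hψc.intervalIntegrable _ _)]
    have e1 : ∫ s in (-(L + 1))..(-(L + 1) - L), ψ s = 0 := by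
      rw [intervalIntegral.integral_congr (g := fun _ => 0), intervalIntegral.integral_zero]
      intro s hs
      rw [uIcc_of_ge (by linarith)] at hs
      exact hψ0 s (by linarith [hs.2])
    have e2 : ∫ s in (L + 1)..(L + 1 - L), ψ s = -L := by
      rw [intervalIntegral.integral_congr (g := fun _ => 1), intervalIntegral.integral_const]
      · simp
      · intro s hs
        rw [uIcc_of_ge (by linarith)] at hs
        exact hψe s (by linarith [hs.1])
    rw [e1, e2]
    ring
  · rw [intervalIntegral.integral_eq_sub_of_hasDerivAt (fun s _ => hψd s)
      (hψdc.intervalIntegrable _ _), hψe _ (by linarith), hψ0 _ (by linarith), sub_zero]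
  · rw [intervalIntegral.integral_eq_sub_of_hasDerivAt (fun s _ => hψd' s)
      (Continuous.intervalIntegrable (by fun_prop) _ _)]
    rw [hψe _ (by linarith), hψ0 _ (by linarith), sub_zero]
  · intro s h1 h2
    change ψ s - ψ (s - L) = 1
    rw [hψe s h1, hψ0 _ (by linarith), sub_zero]

/-- The part of the tube over the parameters in `(0, L]`. -/
def truncatedTube {d : ℕ} (γ : ℝ → EuclideanSpace ℝ (Fin d)) (a L : ℝ) :
    Set (EuclideanSpace ℝ (Fin d)) :=
  {x | x ∈ tube γ a ∧ nearestParam γ x ∈ Ioc 0 L}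

namespace IsTubeAxis

variable {d : ℕ} {γ : ℝ → EuclideanSpace ℝ (Fin d)} {a : ℝ}

lemma measurableSet_nearestParam_mem (h : IsTubeAxis γ a) {I : Set ℝ} (hI : MeasurableSet I) :
    MeasurableSet {x | x ∈ tube γ a ∧ nearestParam γ x ∈ I} := by
  have h1 : Measurable ((tube γ a).domRestrict (nearestParam γ)) :=
    h.continuousOn_nearestParam.domRestrict.measurable
  have h2 := (isOpen_tube γ a).measurableSet.subtype_image (h1 hI)
  convert h2 using 1
  ext x
  simp [Set.domRestrict, and_comm]

lemma isCompetitor_truncatedTube (h : IsTubeAxis γ a) {L : ℝ} (hL : 0 < L) :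
    IsCompetitor (tube γ a) (truncatedTube γ a L) := by
  refine ⟨fun x hx => hx.1, (h.isBounded_setOf_nearestParam_mem L).subset
    fun x hx => ⟨hx.1, by linarith [hx.2.1], hx.2.2⟩, h.measurableSet_nearestParam_mem
    measurableSet_Ioc, ?_⟩
  have hopen : IsOpen (tube γ a ∩ nearestParam γ ⁻¹' Ioo 0 L) :=
    h.continuousOn_nearestParam.isOpen_inter_preimage (isOpen_tube γ a) isOpen_Ioo
  have hmem : γ (L / 2) ∈ tube γ a ∩ nearestParam γ ⁻¹' Ioo 0 L := by
    refine ⟨h.range_subset_tube (mem_range_self _), ?_⟩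
    rw [mem_preimage, h.nearestParam_eq (s := L / 2) (by simpa using h.pos) (by simp)]
    constructor <;> linarith
  refine ((hopen.measure_pos volume ⟨_, hmem⟩).trans_le (measure_mono ?_)).ne'
  exact fun x hx => ⟨hx.1, Ioo_subset_Ioc_self hx.2⟩

/-- Approximation of the indicator function of the truncated tube by admissible weights. -/
lemma tendsto_setIntegral_weight (h : IsTubeAxis γ a) {L : ℝ} {α β : ℕ → ℝ → ℝ} {b : ℕ → ℝ}
    (hα : ∀ n, IsWeight (α n) (L + 1)) (hα1 : ∀ n s, 0 ≤ α n s ∧ α n s ≤ 1)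
    (hβ : ∀ n, IsProfile (β n) (b n)) (hβ1 : ∀ n t, β n t ≤ 1)
    (hαlim : ∀ s, Tendsto (fun n => α n s) atTop (𝓝 ((Ioc 0 L).indicator (fun _ => 1) s)))
    (hβlim : ∀ t, t < a ^ 2 → Tendsto (fun n => β n t) atTop (𝓝 1))
    {g : EuclideanSpace ℝ (Fin d) → ℝ} (hg : Continuous g) {C : ℝ} (hC : ∀ x, ‖g x‖ ≤ C) :
    Tendsto (fun n => ∫ x in tube γ a,
        α n (nearestParam γ x) * β n (‖normalPart γ x‖ ^ 2) * g x) atTop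
      (𝓝 (∫ x in truncatedTube γ a L, g x)) := by
  have hSm : MeasurableSet (truncatedTube γ a L) :=
    h.measurableSet_nearestParam_mem measurableSet_Ioc
  have hS : ∫ x in truncatedTube γ a L, g x
      = ∫ x in tube γ a, (truncatedTube γ a L).indicator g x := by
    rw [setIntegral_indicator hSm, inter_eq_self_of_subset_right (s := tube γ a) fun x hx => hx.1]
  have hBm := h.measurableSet_nearestParam_mem (measurableSet_Icc (a := -(L + 1)) (b := L + 1))
  rw [hS]
  refine tendsto_integral_of_dominated_convergence
    ({x | x ∈ tube γ a ∧ nearestParam γ x ∈ Icc (-(L + 1)) (L + 1)}.indicator fun _ => C)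
    (fun n => ?_) ?_
    (fun n => (ae_restrict_iff' (isOpen_tube γ a).measurableSet).2
      (Eventually.of_forall fun x hx => ?_)) ?_
  · refine ContinuousOn.aestronglyMeasurable ?_ (isOpen_tube γ a).measurableSet
    exact (((hα n).continuous.comp_continuousOn h.continuousOn_nearestParam).mul
      ((hβ n).contDiff.continuous.comp_continuousOn (h.continuousOn_normalPart.norm.pow 2))).mul
        hg.continuousOn
  · exact ((integrable_indicator_iff hBm).2 (integrableOn_const
      (h.isBounded_setOf_nearestParam_mem (L + 1)).measure_lt_top.ne)).integrableOn
  · by_cases hσ : nearestParam γ x ∈ Icc (-(L + 1)) (L + 1)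
    · rw [indicator_of_mem (show x ∈ {x | x ∈ tube γ a ∧ nearestParam γ x ∈
        Icc (-(L + 1)) (L + 1)} from ⟨hx, hσ⟩), norm_mul, norm_mul,
        Real.norm_of_nonneg (hα1 n _).1, Real.norm_of_nonneg ((hβ n).nonneg _)]
      exact (mul_le_of_le_one_left (norm_nonneg _)
        (mul_le_one₀ (hα1 n _).2 ((hβ n).nonneg _) (hβ1 n _))).trans (hC x)
    · rw [indicator_of_notMem fun hcon => hσ hcon.2, (hα n).eq_zero _ hσ]
      simp
  · refine (ae_restrict_iff' (isOpen_tube γ a).measurableSet).2 (Eventually.of_forall fun x hx => ?_)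
    have hv : ‖normalPart γ x‖ ^ 2 < a ^ 2 := by
      have := h.mem_tube_iff.1 hx
      gcongr
    have hlim := ((hαlim (nearestParam γ x)).mul (hβlim _ hv)).mul_const (g x)
    have heq : (truncatedTube γ a L).indicator g x
        = (Ioc 0 L).indicator (fun _ => (1 : ℝ)) (nearestParam γ x) * 1 * g x := by
      by_cases hσ : nearestParam γ x ∈ Ioc 0 L
      · rw [indicator_of_mem (show x ∈ truncatedTube γ a L from ⟨hx, hσ⟩), indicator_of_mem hσ]
        ring
      · rw [indicator_of_notMem fun hcon => hσ hcon.2, indicator_of_notMem hσ]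
        ring
    rw [heq]
    exact hlim

lemma perimeter_truncatedTube_le (h : IsTubeAxis γ a) {L : ℝ} (hL : 0 < L) :
    perimeter (truncatedTube γ a L) ≤
      ENNReal.ofReal ((2 / L + ((d : ℝ) - 1) / a) * volume.real (truncatedTube γ a L)) := by
  have ha := h.pos
  let ε : ℕ → ℝ := fun n => 1 / ((n : ℝ) + 1)
  have hε0 : ∀ n, 0 < ε n := fun n => by positivity
  have hε1 : ∀ n, ε n ≤ 1 := fun n => by
    rw [div_le_one (by positivity)]
    linarith [n.cast_nonneg (α := ℝ)]
  have hεlim : Tendsto ε atTop (𝓝 0) := tendsto_one_div_add_atTop_nhds_zero_nat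
  -- the profiles fall from one to zero between the radii `p n < b n`, both of which tend to `a`
  let p : ℕ → ℝ := fun n => a * (1 - ε n / 2)
  let b : ℕ → ℝ := fun n => a * (1 - ε n / 4)
  have hp0 : ∀ n, 0 < p n := fun n => mul_pos ha (by linarith [hε1 n])
  have hpb : ∀ n, p n < b n := fun n => mul_lt_mul_of_pos_left (by linarith [hε0 n]) ha
  have hba : ∀ n, b n < a := fun n => by
    have := mul_lt_mul_of_pos_left (show 1 - ε n / 4 < 1 by linarith [hε0 n]) ha
    rwa [mul_one] at this
  have hplim : Tendsto p atTop (𝓝 a) := by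
    have := ((hεlim.div_const 2).const_sub 1).const_mul a
    simpa using this
  choose β hβ hβ1 hβ' hβp hβone using fun n => exists_profile (hp0 n) (hpb n)
  choose α φ₁ φ₂ hα hφ₁ hφ₂ hα' hα1 hφ₁0 hφ₂0 hαi hφ₁i hφ₂i hα0 hαone hαL using
    fun n => exists_weight hL (hε0 n) (hε1 n)
  have hαlim : ∀ s, Tendsto (fun n => α n s) atTop (𝓝 ((Ioc 0 L).indicator (fun _ => 1) s)) := by
    intro s
    refine tendsto_const_nhds.congr' ?_
    rcases le_or_gt s 0 with hs | hs
    · exact Eventually.of_forall fun n => by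
        rw [indicator_of_notMem fun hcon => absurd hcon.1 (not_lt.2 hs)]
        exact (hα0 n s hs).symm
    rcases le_or_gt s L with hsL | hsL
    · filter_upwards [hεlim.eventually (gt_mem_nhds hs)] with n hn
      rw [indicator_of_mem (show s ∈ Ioc 0 L from ⟨hs, hsL⟩)]
      exact (hαone n s hn.le hsL).symm
    · filter_upwards [hεlim.eventually (gt_mem_nhds (sub_pos.2 hsL))] with n hn
      rw [indicator_of_notMem fun hcon => absurd hcon.2 (not_le.2 hsL)]
      exact (hαL n s (by linarith)).symm
  have hβlim : ∀ t, t < a ^ 2 → Tendsto (fun n => β n t) atTop (𝓝 1) := by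
    intro t ht
    refine tendsto_const_nhds.congr' ?_
    filter_upwards [(hplim.pow 2).eventually (lt_mem_nhds ht)] with n hn
    exact (hβone n t hn.le).symm
  refine iSup_le fun X => iSup_le fun hX => iSup_le fun hXc => iSup_le fun hX1 => ?_
  refine ENNReal.ofReal_le_ofReal ?_
  obtain ⟨C, hC⟩ := (hasCompactSupport_divergence hXc).exists_bound_of_continuous
    (continuous_divergence hX)
  have l1 := h.tendsto_setIntegral_weight hα hα1 hβ hβ1 hαlim hβlim (continuous_divergence hX) hC
  have l2 := h.tendsto_setIntegral_weight hα hα1 hβ hβ1 hαlim hβlim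
    (continuous_const (y := (1 : ℝ))) (C := 1) (by simp)
  simp only [mul_one] at l2
  rw [setIntegral_const, smul_eq_mul, mul_one] at l2
  refine le_of_tendsto_of_tendsto' l1 (((tendsto_const_nhds.div hplim ha.ne').const_add (2 / L)).mul
    l2) fun n => ?_
  exact h.setIntegral_weight_mul_divergence_le (hp0 n) ((hp0 n).trans (hpb n)).le (hba n) (hα n)
    (hφ₁ n) (hφ₂ n) (hα' n) (fun s => (hα1 n s).1) (hφ₁0 n) (hφ₂0 n) (hβ n) (hβ' n) (hβp n) hL
    (by rw [hαi, hφ₁i, mul_one]) (by rw [hαi, hφ₂i, mul_one]) hX hX1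

lemma cheegerConstant_tube_le (h : IsTubeAxis γ a) :
    cheegerConstant (tube γ a) ≤ ENNReal.ofReal (((d : ℝ) - 1) / a) := by
  have hlim : Tendsto (fun L : ℝ => ENNReal.ofReal (2 / L + ((d : ℝ) - 1) / a)) atTop
      (𝓝 (ENNReal.ofReal (((d : ℝ) - 1) / a))) := by
    have := (tendsto_const_nhds (x := (2 : ℝ))).div_atTop tendsto_id |>.add_const (((d : ℝ) - 1) / a)
    rw [zero_add] at this
    exact ENNReal.tendsto_ofReal this
  refine ge_of_tendsto hlim ?_
  filter_upwards [eventually_gt_atTop 0] with L hL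
  have hS := h.isCompetitor_truncatedTube hL
  refine (iInf₂_le _ hS).trans (ENNReal.div_le_of_le_mul ?_)
  refine (h.perimeter_truncatedTube_le hL).trans_eq ?_
  rw [ENNReal.ofReal_mul' measureReal_nonneg, ofReal_measureReal hS.bounded.measure_lt_top.ne]

end IsTubeAxis

theorem mainTheorem3 (d : ℕ) (hd : 2 ≤ d) (γ : ℝ → EuclideanSpace ℝ (Fin d))
    (hγ : IsUnboundedCompleteCurve γ) (a : ℝ) (ha : 0 < a)
    (hover : DoesNotOverlap γ a)
    (htouch : d = 2 → Measure.hausdorffMeasure 1 (touchingSet γ a) = 0) :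
    cheegerConstant (tube γ a) = ENNReal.ofReal (((d : ℝ) - 1) / a) ∧
      ¬ ∃ S : Set (EuclideanSpace ℝ (Fin d)), IsCheegerSet (tube γ a) S := by
  have h := DoesNotOverlap.isTubeAxis hd hγ ha hover
  have heq : cheegerConstant (tube γ a) = ENNReal.ofReal (((d : ℝ) - 1) / a) := by
    refine le_antisymm h.cheegerConstant_tube_le (le_iInf₂ fun S hS => ?_)
    rw [ENNReal.le_div_iff_mul_le (Or.inl hS.volume_ne_zero)
      (Or.inl hS.bounded.measure_lt_top.ne)]
    exact h.le_perimeter hd htouch hS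
  refine ⟨heq, ?_⟩
  rintro ⟨S, hS, hSeq⟩
  refine h.not_perimeter_le hd htouch hγ.unbounded hS ?_
  rw [← heq, ← hSeq, ENNReal.div_mul_cancel hS.volume_ne_zero hS.bounded.measure_lt_top.ne]
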